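/- Let $d\in\{2,3\}$, $k\ge 1$, let $\Omega\subset\mathbb R^d$ be a domain, and let $\Gamma_0\subset\Omega$ be a closed compact connected $C^{k+2}$ hypersurface with $\Gamma_0=\partial\Omega_1$ for a domain $\Omega_1\subset\Omega$. Put $\Omega_2=\Omega\setminus\Omega_1$ and let $\Pi_0(x)$ be a point of $\Gamma_0$ nearest to $x$ (unique near $\Gamma_0$). **Straight meshes.** For $\tilde h>0$, $\kappa\in\mathbb R$ consider finite sets $\tilde{\mathcal J}_1\neq\emptyset$, $\tilde{\mathcal J}_2$ of non-degenerate closed $d$-simplices, $\tilde{\mathcal J}=\tilde{\mathcal J}_1\cup\tilde{\mathcal J}_2$, with unions $\tilde\Omega_1,\tilde\Omega_2$, such that: the vertices of the elements of $\tilde{\mathcal J}_1$ lie in $\overline\Omega_1$; $\tilde\Omega_2=\overline{\Omega\setminus\tilde\Omega_1}$ and $\tilde\Omega_1\cup\tilde\Omega_2=\overline\Omega$ (so the boundary of $\overline\Omega$ is piecewise linear); the diameters are at most $\tilde h$ in $\tilde{\mathcal J}_1$ and at most $2\tilde h$ in $\tilde{\mathcal J}_2$; any two distinct elements of $\tilde{\mathcal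 J}$ meet in a common proper (possibly empty) face; the mesh is shape regular and uniform with constant $\kappa$ (each $\tilde K\in\tilde{\mathcal J}$ contains a ball of radius $r>0$ with $\operatorname{diam}\tilde K'\le\kappa r$, for each $\tilde K'\in\tilde{\mathcal J}$). An *interface facet* is a facet of the form $\tilde K_1\cap\tilde K_2$ with $\tilde K_i\in\tilde{\mathcal J}_i$; let $\tilde\Gamma_0$ be the union of these. All vertices of interface facets lie on $\Gamma_0$, and a facet of an element of $\tilde{\mathcal J}_i$ with all its vertices on $\Gamma_0$ lies in no other element of $\tilde{\mathcal J}_i$. **The map $\Psi^h$.** Let $\tilde K\in\tilde{\mathcal J}$ have vertices $a_j$ and barycentric coordinates $\mu_j$, and let $S=\{j:a_j\in\Gamma_0\}$. If $|S|\ge 2$, $\tilde\mu(x):=\sum_{j\in S}\mu_j(x)$ and $y(x):=\sum_{j\in S}\frac{\mu_j(x)}{\tilde\mu(x)}a_j$, then for $x\in\tilde K$ $$\Psi^h|_{\tilde K}(x)=x+\tilde\mu(x)^{k+2}\bigl(\Pi_0(y(x))-y(x)\bigr)\ \text{ if }\tilde\mu(x)\neq0,\qquad \Psi^h|_{\tilde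 K}(x)=x\ \text{ otherwise;}$$ if $|S|\le1$, $\Psi^h|_{\tilde K}$ is the identity. Let $\tilde I^h\Psi^h$ be its elementwise Lagrange interpolant of degree $k$ at the points of $\tilde K$ with barycentric coordinates in $\frac1k\mathbb Z$. Let $(\hat K,\hat P^k,\hat\Sigma^k)$ be the degree $k$ Lagrange element on the reference simplex, $F_{\tilde K}:\hat K\to\tilde K$ the affine map, and $F_K:=[\tilde I^h\Psi^h]|_{\tilde K}\circ F_{\tilde K}$, $K:=F_K(\hat K)$, $P^k:=\{\hat\chi\circ F_K^{-1}:\hat\chi\in\hat P^k\}$, $\Sigma^k:=\{\chi\mapsto\hat\sigma(\chi\circ F_K):\hat\sigma\in\hat\Sigma^k\}$. Let $\mathcal J_i,\mathcal J$ be the curved elements $K$ from $\tilde{\mathcal J}_i,\tilde{\mathcal J}$, $\Omega_i^h,\Omega^h$ their unions, and $\Gamma^h$ the union of the images under $\tilde I^h\Psi^h$ (taken from the element of $\tilde{\mathcal J}_1$) of the interface facets. **Notions.** $(K,P^k,\Sigma^k)$ is a *$k$-bulk finite element* with reference map $F_K$ if $F_K\in C^{k+1}(\hat K)$ is injective; $F_K(x)=Ax+b+\Phi(x)$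 with $A$ invertible, $\sup_{\hat K}|D\Phi\,A^{-1}|<1$ and $\sup_{\hat K}|D^n\Phi|\,|A|^{-n}<\infty$ for $2\le n\le k+1$; $K$ has non-empty interior and its boundary is the union of the images of the facets of $\hat K$; and $\Sigma^k$ is a basis of the dual of the finite-dimensional space $P^k$. A *$k$-surface finite element* has, in the same way, an injective $C^{k+1}$ reference map of rank $d-1$ on the $(d-1)$-dimensional reference simplex. A finite family of (curved) elements is a *conforming admissible subdivision* of its union if distinct elements do not overlap and meet in a common proper (possibly empty) face; $N(K)\cap K'=N(K')\cap K$ for the sets $N(K)=F_K(N(\hat K))$ of Lagrange nodes; and element functions in $P^k(K)$, $P^k(K')$ that agree at the common nodes agree on $K\cap K'$. A *triangulated bulk domain* is a non-empty set equal to the closure of its interior with such a subdivision into $k$-bulk finite elements; a *triangulated hypersurface* is a non-empty Lipschitz hypersurface without boundary (locally mapped onto a piece of a hyperplane by a bi-Lipschitz change of coordinates of $\mathbb R^d$) with such a subdivision into $k$-surface finite elements. **Claim.** For every $\kappa$ there are $h_0>0$ and $C$, depending only on $\Omega,\Omega_1,\Gamma_0,k,\kappa$, such that for all meshes as above with $\tilde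 h\le h_0$: 1. $\Psi^h$ is well defined on $\overline\Omega$ (the elementwise definitions agree on intersections); on every $\tilde K\in\tilde{\mathcal J}$ it is $C^{k+1}$ and injective; and $\Psi^h(\tilde\Gamma_0)=\Gamma_0$. 2. Every $(K,P^k,\Sigma^k)$ is a $k$-bulk finite element with reference map $F_K$, and $\mathcal J_1,\mathcal J_2,\mathcal J$ are conforming admissible subdivisions that make $\Omega_1^h,\Omega_2^h,\Omega^h$ triangulated bulk domains. Moreover $\Omega^h=\overline\Omega$. 3. If $\tilde E=\tilde K_1\cap\tilde K_2$ is an interface facet, the interpolants from $\tilde K_1$ and from $\tilde K_2$ agree on $\tilde E$, and its image is $K_1\cap K_2$. Moreover $\Gamma^h=\Omega_1^h\cap\Omega_2^h$, and $\Gamma^h$ is a triangulated hypersurface, subdivided by the images of the interface facets. 4. (Approximation) The Lagrange nodes of $\Gamma^h$ lie on $\Gamma_0$, and the Hausdorff distances of $\Gamma^h$ from $\Gamma_0$ and of $\Omega_i^h$ from $\overline\Omega_i$, $i=1,2$, are at most $C\tilde h$. -/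

import Mathlib

noncomputable section

namespace IsoMesh

open Set

abbrev E (d : ℕ) := EuclideanSpace ℝ (Fin d)

/-! ### The interface and the closest point map -/

/-- A closed (compact, without boundary), connected, embedded `C^r` hypersurface: near each of
its points it is the zero set of a `C^r` function with non-vanishing differential. -/
structure IsClosedHypersurface {d : ℕ} (r : ℕ) (Γ : Set (E d)) : Prop where
  isCompact : IsCompact Γ
  isConnected : IsConnected Γ
  locally_level_set : ∀ p ∈ Γ, ∃ U : Set (E d), IsOpen U ∧ p ∈ U ∧ ∃ φ : E d → ℝ,
    ContDiffOn ℝ r φ U ∧ (∀ x ∈ U, fderiv ℝ φ x ≠ 0) ∧ Γ ∩ U = {x ∈ U | φ x = 0}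

/-- A Lipschitz hypersurface without boundary: near each of its points it is mapped onto a
piece of a hyperplane by a bi-Lipschitz change of coordinates of the ambient space. -/
def IsLipschitzHypersurface {d : ℕ} (S : Set (E d)) : Prop :=
  ∀ p ∈ S, ∃ (φ : OpenPartialHomeomorph (E d) (E d)) (L : NNReal) (l : E d →L[ℝ] ℝ),
    p ∈ φ.source ∧ LipschitzOnWith L φ φ.source ∧ LipschitzOnWith L φ.symm φ.target ∧
      l ≠ 0 ∧ ∀ x ∈ φ.source, (x ∈ S ↔ l (φ x) = 0)

/-- A point of `Γ` closest to `x`. It exists if `Γ` is compact and non-empty; it is unique in a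
tubular neighbourhood of a `C^2` hypersurface. -/
def nearestPoint {d : ℕ} (Γ : Set (E d)) (x : E d) : E d :=
  Classical.epsilon fun y => y ∈ Γ ∧ dist x y = Metric.infDist x Γ

/-! ### The reference element -/

/-- Barycentric coordinates with respect to the vertices `0, e₁, …, e_m` of the reference
simplex. -/
def refBary (m : ℕ) (j : Fin (m + 1)) (x : E m) : ℝ :=
  Fin.cases (1 - ∑ i, x i) (fun i => x i) j

def refSimplex (m : ℕ) : Set (E m) := {x | ∀ j, 0 ≤ refBary m j x}

/-- The closed face of the reference simplex spanned by the vertices with index in `s`. -/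
def refFace (m : ℕ) (s : Finset (Fin (m + 1))) : Set (E m) :=
  {x ∈ refSimplex m | ∀ j, j ∉ s → refBary m j x = 0}

/-- The Lagrange nodes of degree `k`: the points of the reference simplex whose barycentric
coordinates are integer multiples of `1 / k`. -/
def refNodes (k m : ℕ) : Set (E m) :=
  {x ∈ refSimplex m | ∀ j, ∃ n : ℕ, (k : ℝ) * refBary m j x = n}

/-- The data `(K, P, Σ)` of a finite element: a set, a space of functions on it, and a set of
functionals on that space. -/
structure FETriple (n : ℕ) where
  carrier : Set (E n)
  P : Submodule ℝ (carrier → ℝ)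
  Sig : Set (Module.Dual ℝ P)

/-- `P` is finite dimensional and `Σ` is a basis of its dual. -/
structure FETriple.IsUnisolvent {n : ℕ} (R : FETriple n) : Prop where
  finiteDimensional : FiniteDimensional ℝ R.P
  linearIndependent : LinearIndependent ℝ (fun σ : R.Sig => (σ : Module.Dual ℝ R.P))
  span_eq_top : Submodule.span ℝ R.Sig = ⊤

/-- The Lagrange element of degree `k` on the reference simplex: polynomials of total degree at
most `k`, with the evaluations at the Lagrange nodes. -/
def refElement (k m : ℕ) : FETriple m where
  carrier := refSimplex m
  P := (MvPolynomial.restrictTotalDegree (Fin m) ℝ k).map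
    (LinearMap.pi fun x : refSimplex m =>
      (MvPolynomial.aeval (fun i => (x : E m) i) : MvPolynomial (Fin m) ℝ →ₐ[ℝ] ℝ).toLinearMap)
  Sig := {σ | ∃ a : refSimplex m, (a : E m) ∈ refNodes k m ∧ ∀ χ, σ χ = χ.1 a}

/-- The element `(K, P, Σ)` with reference map `F`: `K = F(K̂)`,
`P = {χ | χ ∘ F ∈ P̂} = {χ̂ ∘ F⁻¹ | χ̂ ∈ P̂}` (for injective `F`), and
`Σ = {χ ↦ σ̂(χ ∘ F) | σ̂ ∈ Σ̂}`. -/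
def mapElement {m n : ℕ} (F : E m → E n) (R : FETriple m) : FETriple n where
  carrier := F '' R.carrier
  P := R.P.comap (LinearMap.funLeft ℝ ℝ (imageFactorization F R.carrier))
  Sig := {σ | ∃ τ ∈ R.Sig, ∀ χ,
    σ χ = τ ⟨LinearMap.funLeft ℝ ℝ (imageFactorization F R.carrier) χ.1, χ.2⟩}

/-! ### Curved finite elements and subdivisions -/

/-- `F` is the reference map of a `k`-bulk finite element: it is an injective `C^{k+1}` map,
`F(x) = A x + b + Φ(x)` with `A` invertible and `sup |DΦ A⁻¹| < 1`, and
`sup |D^nΦ| ≤ C |A|^n` for `2 ≤ n ≤ k + 1`; the transported triple is a finite element, that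
is, `K` has non-empty interior, its boundary consists of the images of the facets, and `Σ` is a
basis of the dual of `P`. -/
structure IsBulkElement {d : ℕ} (k : ℕ) (F : E d → E d) : Prop where
  contDiffOn : ContDiffOn ℝ ((k + 1 : ℕ) : WithTop ℕ∞) F (refSimplex d)
  injOn : InjOn F (refSimplex d)
  affine_add_small : ∃ (A : E d ≃L[ℝ] E d) (b : E d) (Φ : E d → E d),
    (∀ x, F x = A x + b + Φ x) ∧
    (∃ C < (1 : ℝ), ∀ x ∈ refSimplex d,
      ‖(fderivWithin ℝ Φ (refSimplex d) x).comp (A.symm : E d →L[ℝ] E d)‖ ≤ C) ∧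
    ∀ n : ℕ, 2 ≤ n → n ≤ k + 1 → ∃ C : ℝ, ∀ x ∈ refSimplex d,
      ‖iteratedFDerivWithin ℝ n Φ (refSimplex d) x‖ ≤ C * ‖(A : E d →L[ℝ] E d)‖ ^ n
  interior_nonempty : (interior (F '' refSimplex d)).Nonempty
  frontier_eq : frontier (F '' refSimplex d) = ⋃ j, F '' refFace d {j}ᶜ
  unisolvent : (mapElement F (refElement k d)).IsUnisolvent

/-- `F` is the reference map of a surface finite element of order `k` in codimension one. -/
structure IsSurfaceElement {m : ℕ} (k : ℕ) (F : E m → E (m + 1)) : Prop where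
  contDiffOn : ContDiffOn ℝ ((k + 1 : ℕ) : WithTop ℕ∞) F (refSimplex m)
  injOn : InjOn F (refSimplex m)
  rank_eq : ∀ x ∈ refSimplex m, Function.Injective (fderivWithin ℝ F (refSimplex m) x)
  unisolvent : (mapElement F (refElement k m)).IsUnisolvent

/-- The (curved) elements with reference maps `F i`, `i ∈ J`, form a conforming admissible
subdivision of `D`. -/
structure IsConformingSubdivision {ι : Type*} {m n : ℕ} (k : ℕ) (J : Set ι)
    (F : ι → E m → E n) (D : Set (E n)) : Prop where
  finite : J.Finite
  cover : D = ⋃ i ∈ J, F i '' refSimplex m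
  /-- Two distinct elements do not overlap. -/
  disjoint : ∀ i ∈ J, ∀ j ∈ J, i ≠ j →
    Disjoint (F i '' {x | ∀ l, 0 < refBary m l x}) (F j '' refSimplex m)
  /-- Two distinct elements meet in a common proper (possibly empty) face. -/
  admissible : ∀ i ∈ J, ∀ j ∈ J, i ≠ j → ∃ s t : Finset (Fin (m + 1)),
    s ≠ Finset.univ ∧ t ≠ Finset.univ ∧
    F i '' refSimplex m ∩ F j '' refSimplex m = F i '' refFace m s ∧
    F i '' refFace m s = F j '' refFace m t
  /-- Adjacent elements share their Lagrange nodes. -/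
  nodes : ∀ i ∈ J, ∀ j ∈ J,
    F i '' refNodes k m ∩ F j '' refSimplex m = F j '' refNodes k m ∩ F i '' refSimplex m
  /-- Element functions that agree in the common nodes agree on the intersection. -/
  traces : ∀ i ∈ J, ∀ j ∈ J,
    ∀ χ ∈ (mapElement (F i) (refElement k m)).P, ∀ χ' ∈ (mapElement (F j) (refElement k m)).P,
      (∀ x (hi : x ∈ F i '' refSimplex m) (hj : x ∈ F j '' refSimplex m),
        x ∈ F i '' refNodes k m → χ ⟨x, hi⟩ = χ' ⟨x, hj⟩) →
      ∀ x (hi : x ∈ F i '' refSimplex m) (hj : x ∈ F j '' refSimplex m),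
        χ ⟨x, hi⟩ = χ' ⟨x, hj⟩

structure IsTriangulatedBulkDomain {ι : Type*} {d : ℕ} (k : ℕ) (J : Set ι)
    (F : ι → E d → E d) (D : Set (E d)) : Prop where
  nonempty : D.Nonempty
  closure_interior : closure (interior D) = D
  element : ∀ i ∈ J, IsBulkElement k (F i)
  subdivision : IsConformingSubdivision k J F D

structure IsTriangulatedHypersurface {ι : Type*} {m : ℕ} (k : ℕ) (J : Set ι)
    (F : ι → E m → E (m + 1)) (S : Set (E (m + 1))) : Prop where
  nonempty : S.Nonempty
  hypersurface : IsLipschitzHypersurface S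
  element : ∀ i ∈ J, IsSurfaceElement k (F i)
  subdivision : IsConformingSubdivision k J F S

/-! ### The straight mesh -/

/-- A non-degenerate `d`-simplex in `ℝ^d`, given by its `d + 1` vertices. -/
abbrev Simplex (d : ℕ) := AffineBasis (Fin (d + 1)) ℝ (E d)

/-- The closed face spanned by the vertices with index in `s`. -/
def face {d : ℕ} (T : Simplex d) (s : Finset (Fin (d + 1))) : Set (E d) :=
  convexHull ℝ (T '' s)

/-- The simplex as a closed set. -/
def body {d : ℕ} (T : Simplex d) : Set (E d) := convexHull ℝ (range T)

/-- The facet opposite to the vertex `j`. -/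
def facet {d : ℕ} (T : Simplex d) (j : Fin (d + 1)) : Set (E d) := face T {j}ᶜ

/-- The union of the elements of a mesh. -/
def region {d : ℕ} (J : Set (Simplex d)) : Set (E d) := ⋃ T ∈ J, body T

/-- The interface facets, as pairs (element `T` of the inner mesh, index of the vertex of `T`
opposite to the facet). -/
def interfaceFacets {d : ℕ} (J₁ J₂ : Set (Simplex d)) : Set (Simplex d × Fin (d + 1)) :=
  {p | p.1 ∈ J₁ ∧ ∃ T' ∈ J₂, body p.1 ∩ body T' = facet p.1 p.2}

/-- Initial straight meshes `J₁`, `J₂` of mesh size `h` and regularity constant `κ`, fitted to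
the hypersurface `Γ`, which bounds the inner domain `Ω₁` in `Ω`. -/
structure IsInitialMesh {d : ℕ} (Ω Ω₁ Γ : Set (E d)) (h κ : ℝ) (J₁ J₂ : Set (Simplex d)) :
    Prop where
  h_pos : 0 < h
  finite₁ : J₁.Finite
  finite₂ : J₂.Finite
  nonempty₁ : J₁.Nonempty
  vertices₁ : ∀ T ∈ J₁, ∀ j, T j ∈ closure Ω₁
  region₂ : region J₂ = closure (Ω \ region J₁)
  region_union : region (J₁ ∪ J₂) = closure Ω
  diam₁ : ∀ T ∈ J₁, Metric.diam (body T) ≤ h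
  diam₂ : ∀ T ∈ J₂, Metric.diam (body T) ≤ 2 * h
  /-- Two distinct elements meet in a common proper (possibly empty) face. -/
  admissible : ∀ T ∈ J₁ ∪ J₂, ∀ T' ∈ J₁ ∪ J₂, T ≠ T' → ∃ s t : Finset (Fin (d + 1)),
    s ≠ Finset.univ ∧ t ≠ Finset.univ ∧ body T ∩ body T' = face T s ∧ face T s = face T' t
  shapeRegular : ∀ T ∈ J₁ ∪ J₂, ∃ c r, 0 < r ∧ Metric.diam (body T) ≤ κ * r ∧
    Metric.closedBall c r ⊆ body T
  uniform : ∀ T ∈ J₁ ∪ J₂, ∀ T' ∈ J₁ ∪ J₂, ∃ c r, 0 < r ∧ Metric.diam (body T') ≤ κ * r ∧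
    Metric.closedBall c r ⊆ body T
  /-- The vertices of interface facets lie on `Γ`. -/
  interface_vertices : ∀ p ∈ interfaceFacets J₁ J₂, ∀ i, i ≠ p.2 → p.1 i ∈ Γ
  /-- A facet of `J₁` (of `J₂`) with all its vertices on `Γ` is a boundary facet: it lies in only
  one element of `J₁` (of `J₂`). -/
  boundary_facet : ∀ J : Set (Simplex d), J = J₁ ∨ J = J₂ → ∀ T ∈ J, ∀ j : Fin (d + 1),
    (∀ i, i ≠ j → T i ∈ Γ) → ∀ T' ∈ J, facet T j ⊆ body T' → T' = T

/-! ### The map `Ψ` and its Lagrange interpolant -/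

open Classical in
/-- The vertices of `T` that lie on `Γ`. -/
def onInterface {d : ℕ} (Γ : Set (E d)) (T : Simplex d) : Finset (Fin (d + 1)) :=
  Finset.univ.filter fun j => T j ∈ Γ

/-- The sum of the barycentric coordinates that belong to the vertices on `Γ`. -/
def muTilde {d : ℕ} (Γ : Set (E d)) (T : Simplex d) (x : E d) : ℝ :=
  ∑ j ∈ onInterface Γ T, T.coord j x

def yPoint {d : ℕ} (Γ : Set (E d)) (T : Simplex d) (x : E d) : E d :=
  ∑ j ∈ onInterface Γ T, (T.coord j x / muTilde Γ T x) • T j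

open Classical in
/-- The map `Ψ` on the simplex `T`; it is the identity unless `T` is an interface element, that
is, unless at least two of its vertices lie on `Γ`. -/
def psiOn {d : ℕ} (k : ℕ) (Γ : Set (E d)) (T : Simplex d) (x : E d) : E d :=
  if 2 ≤ (onInterface Γ T).card ∧ muTilde Γ T x ≠ 0 then
    x + muTilde Γ T x ^ (k + 2) • (nearestPoint Γ (yPoint Γ T x) - yPoint Γ T x)
  else x

open Classical in
/-- The map `Ψ` on the whole mesh `J`, defined element by element. -/
def psi {d : ℕ} (k : ℕ) (Γ : Set (E d)) (J : Set (Simplex d)) (x : E d) : E d :=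
  if hx : ∃ T ∈ J, x ∈ body T then psiOn k Γ hx.choose x else x

/-- The Lagrange node of `T` with barycentric coordinates `α j / k`. -/
def node {d : ℕ} (k : ℕ) (T : Simplex d) (α : Fin (d + 1) → ℕ) : E d :=
  ∑ j, ((α j : ℝ) / k) • T j

/-- The Lagrange basis polynomial of degree `k` on `T` (`∑ j, α j = k`) that belongs to the
node with barycentric coordinates `α j / k`, in the usual product form. -/
def lagrangeBasis {d : ℕ} (k : ℕ) (T : Simplex d) (α : Fin (d + 1) → ℕ) (x : E d) : ℝ :=
  ∏ j, ∏ l ∈ Finset.range (α j), ((k : ℝ) * T.coord j x - l) / (l + 1)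

/-- The Lagrange interpolant of degree `k` of `u` on `T`. -/
def interp {d : ℕ} (k : ℕ) (T : Simplex d) (u : E d → E d) (x : E d) : E d :=
  ∑ α ∈ Finset.piAntidiag Finset.univ k, lagrangeBasis k T α x • u (node k T α)

/-- The affine map from the reference simplex onto `T`. -/
def refMap {d : ℕ} (T : Simplex d) (x : E d) : E d := ∑ j, refBary d j x • T j

/-- The affine map from the reference simplex of dimension `m` onto a facet of `T`. -/
def facetMap {m : ℕ} (p : Simplex (m + 1) × Fin (m + 2)) (x : E m) : E (m + 1) :=
  ∑ i, refBary m i x • p.1 (p.2.succAbove i)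

/-- The degree `k` interpolant of `Ψ` on the element `T` of the mesh `J`. -/
def curve {d : ℕ} (k : ℕ) (Γ : Set (E d)) (J : Set (Simplex d)) (T : Simplex d) : E d → E d :=
  interp k T (psi k Γ J)

/-- The reference map of the curved element that belongs to `T`. -/
def curvedMap {d : ℕ} (k : ℕ) (Γ : Set (E d)) (J : Set (Simplex d)) (T : Simplex d) :
    E d → E d :=
  curve k Γ J T ∘ refMap T

/-- The reference map of the curved interface facet that belongs to `p`. -/
def curvedFacetMap {m : ℕ} (k : ℕ) (Γ : Set (E (m + 1))) (J : Set (Simplex (m + 1)))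
    (p : Simplex (m + 1) × Fin (m + 2)) : E m → E (m + 1) :=
  curve k Γ J p.1 ∘ facetMap p

/-- The union of the curved elements `[IΨ](T)`, `T ∈ J'`, where `J'` is a part of the mesh `J`. -/
def curvedRegion {d : ℕ} (k : ℕ) (Γ : Set (E d)) (J J' : Set (Simplex d)) : Set (E d) :=
  ⋃ T ∈ J', curve k Γ J T '' body T

/-- The union of the curved interface facets. -/
def curvedInterface {d : ℕ} (k : ℕ) (Γ : Set (E d)) (J₁ J₂ : Set (Simplex d)) : Set (E d) :=
  ⋃ p ∈ interfaceFacets J₁ J₂, curve k Γ (J₁ ∪ J₂) p.1 '' facet p.1 p.2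

end IsoMesh

end

/-!
Both `Ψ` and its elementwise interpolant are small Lipschitz perturbations of the identity, hence
restrictions of homeomorphisms of the whole space, and these homeomorphisms carry all properties
of the straight mesh over to the curved one.

*Estimates on one simplex* (`exists_simplex_estimates`). The displacement `Π₀ - id` of the closest
point map vanishes at the vertices on `Γ` and has a Lipschitz differential near `Γ`, so at convex
combinations of these vertices it is of second order in the diameter (`norm_sub_le_of_vanishing`).
Together with shape regularity, this bounds the Lipschitz constants of `Ψ - id` and of its
interpolant by a multiple of the diameter. The power `k + 2` of `μ̃` makes `Ψ` of class `C^{k+1}`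
also at the points where `μ̃` vanishes (`contDiffOn_pow_smul_comp`). The smoothness of the closest
point map follows from the inverse function theorem for the Lagrange multiplier equations
(`IsClosedHypersurface.contDiffAt_nearestPoint`).

*Gluing* (`IsFineMesh.exists_homeomorph`). The definitions agree on common faces, where the
barycentric coordinates agree, and simplices at the boundary of `Ω` have no vertices on `Γ`, so
that both maps extend by the identity. A map that differs from the identity by a `1/2`-Lipschitz
map is a bi-Lipschitz homeomorphism (`exists_homeomorph_of_region`).

*The image of `Ψ`* (`IsFineMesh.image_psi`). In `Ω`, the two regions of the mesh meet in the
interface facets only (`IsInitialMesh.inter_subset_straightInterface`), and these are mapped into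
`Γ`. So the image of the inner region is, off `Γ`, open and closed. It meets the connected set
`Ω₁`, and therefore contains it. If it met the exterior of `Ω₁`, it would contain points at a fixed
distance from `Ω₁` (`exists_exterior_depth`, by the local two-sidedness of `Γ`), which is
impossible for small `h`. Hence the regions are mapped onto `closure Ω₁` and `closure (Ω \ Ω₁)`,
and the interface onto `Γ`.

*The curved mesh.* Injectivity, interiors, boundaries and intersections of curved elements are
images of those of the simplices. Nodes and traces on a common face are handled in
`isConformingSubdivision_of_straight`, since polynomials of degree `k` on a face are determined by
its Lagrange nodes. The curved interface is the image of `Γ` under a bi-Lipschitz homeomorphism,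
and the Hausdorff distances are bounded by the distance of `Ψ` from its interpolant.
-/

noncomputable section

namespace IsoMesh

open Set

/-! ### Barycentric coordinates on the reference simplex -/

@[simp] lemma refBary_zero {m : ℕ} (x : E m) : refBary m 0 x = 1 - ∑ i, x i := rfl

@[simp] lemma refBary_succ {m : ℕ} (i : Fin m) (x : E m) : refBary m i.succ x = x i := rfl

lemma sum_refBary {m : ℕ} (x : E m) : ∑ j, refBary m j x = 1 := by
  simp [Fin.sum_univ_succ]

lemma refBary_ext {m : ℕ} {x y : E m} (h : ∀ j, refBary m j x = refBary m j y) : x = y := by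
  ext i
  simpa using h i.succ

/-- The point of `ℝ^m` with barycentric coordinates `w` (if they add up to `1`). -/
def refPoint {m : ℕ} (w : Fin (m + 1) → ℝ) : E m := WithLp.toLp 2 fun i => w i.succ

lemma refBary_refPoint {m : ℕ} {w : Fin (m + 1) → ℝ} (hw : ∑ j, w j = 1) (j : Fin (m + 1)) :
    refBary m j (refPoint w) = w j := by
  refine Fin.cases ?_ (fun i => ?_) j
  · rw [Fin.sum_univ_succ] at hw
    simp only [refBary_zero, refPoint]
    linarith
  · simp [refPoint]

lemma refBary_sum {m : ℕ} {ι : Type*} (s : Finset ι) (w : ι → ℝ) (x : ι → E m)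
    (hw : ∑ a ∈ s, w a = 1) (j : Fin (m + 1)) :
    refBary m j (∑ a ∈ s, w a • x a) = ∑ a ∈ s, w a * refBary m j (x a) := by
  refine Fin.cases ?_ (fun i => ?_) j
  · simp only [refBary_zero, mul_sub, mul_one, Finset.sum_sub_distrib, hw, Finset.mul_sum]
    rw [Finset.sum_comm]
    simp
  · simp

lemma contDiff_refBary {m : ℕ} {n : WithTop ℕ∞} (j : Fin (m + 1)) :
    ContDiff ℝ n (refBary m j) := by
  refine Fin.cases ?_ (fun i => ?_) j
  · change ContDiff ℝ n fun x : E m => 1 - ∑ i, x i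
    fun_prop
  · change ContDiff ℝ n fun x : E m => x i
    fun_prop

lemma continuous_refBary {m : ℕ} (j : Fin (m + 1)) : Continuous (refBary m j) :=
  (contDiff_refBary (n := 0) j).continuous

lemma refBary_combo {m : ℕ} (j : Fin (m + 1)) (x y : E m) (a b : ℝ) (hab : a + b = 1) :
    refBary m j (a • x + b • y) = a * refBary m j x + b * refBary m j y := by
  have := refBary_sum Finset.univ ![a, b] ![x, y] (by simpa using hab) j
  simpa using this

lemma refBary_le_one {m : ℕ} {x : E m} (hx : x ∈ refSimplex m) (j : Fin (m + 1)) :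
    refBary m j x ≤ 1 := by
  rw [← sum_refBary x]
  exact Finset.single_le_sum (f := fun j => refBary m j x) (fun i _ => hx i) (Finset.mem_univ j)

lemma convex_refSimplex (m : ℕ) : Convex ℝ (refSimplex m) := by
  intro x hx y hy a b ha hb hab j
  rw [refBary_combo j x y a b hab]
  exact add_nonneg (mul_nonneg ha (hx j)) (mul_nonneg hb (hy j))

lemma isClosed_refSimplex (m : ℕ) : IsClosed (refSimplex m) := by
  simp only [refSimplex, ofPred_forall]
  exact isClosed_iInter fun j => isClosed_le continuous_const (continuous_refBary j)

lemma isCompact_refSimplex (m : ℕ) : IsCompact (refSimplex m) := by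
  refine Metric.isCompact_of_isClosed_isBounded (isClosed_refSimplex m) ?_
  refine (Metric.isBounded_closedBall (x := (0 : E m)) (r := Real.sqrt m)).subset fun x hx => ?_
  rw [mem_closedBall_zero_iff, EuclideanSpace.norm_eq]
  refine Real.sqrt_le_sqrt ?_
  calc ∑ i, ‖x i‖ ^ 2 ≤ ∑ _i : Fin m, (1 : ℝ) := by
        refine Finset.sum_le_sum fun i _ => ?_
        have h0 := hx i.succ
        have h1 := refBary_le_one hx i.succ
        simp only [refBary_succ] at h0 h1
        rw [Real.norm_of_nonneg h0]
        nlinarith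
    _ = m := by simp

lemma isOpen_refInterior (m : ℕ) : IsOpen {x : E m | ∀ l, 0 < refBary m l x} := by
  simp only [ofPred_forall]
  exact isOpen_iInter_of_finite fun j => isOpen_lt continuous_const (continuous_refBary j)

/-- The barycentre of the reference simplex has positive barycentric coordinates. -/
lemma refInterior_nonempty (m : ℕ) : {x : E m | ∀ l, 0 < refBary m l x}.Nonempty := by
  refine ⟨refPoint fun _ => 1 / (m + 1 : ℝ), fun l => ?_⟩
  rw [refBary_refPoint (by simp; field_simp)]
  positivity

lemma refInterior_subset_interior (m : ℕ) :
    {x : E m | ∀ l, 0 < refBary m l x} ⊆ interior (refSimplex m) :=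
  interior_maximal (fun _ hx l => (hx l).le) (isOpen_refInterior m)

lemma interior_refSimplex_nonempty (m : ℕ) : (interior (refSimplex m)).Nonempty :=
  (refInterior_nonempty m).mono (refInterior_subset_interior m)

lemma uniqueDiffOn_refSimplex (m : ℕ) : UniqueDiffOn ℝ (refSimplex m) :=
  uniqueDiffOn_convex (convex_refSimplex m) (interior_refSimplex_nonempty m)

/-- An interior point of the reference simplex has positive barycentric coordinates: moving a
little away from the barycentre stays inside. -/
lemma interior_refSimplex (m : ℕ) :
    interior (refSimplex m) = {x : E m | ∀ l, 0 < refBary m l x} := by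
  refine Subset.antisymm (fun x hx l => ?_) (refInterior_subset_interior m)
  obtain ⟨c, hc⟩ := refInterior_nonempty m
  have hcont : Filter.Tendsto (fun t : ℝ => (1 + t) • x + (-t) • c) (nhds 0) (nhds x) := by
    have : Continuous fun t : ℝ => (1 + t) • x + (-t) • c := by fun_prop
    simpa using this.tendsto 0
  have hev := hcont.eventually (mem_interior_iff_mem_nhds.1 hx)
  obtain ⟨ε, hε, hball⟩ := Metric.eventually_nhds_iff.1 hev
  have hmem := hball (y := ε / 2) (by
    rw [Real.dist_eq, sub_zero, abs_of_pos (by positivity)]; linarith) l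
  rw [refBary_combo l x c _ _ (by ring)] at hmem
  have := mul_pos (half_pos hε) (hc l)
  by_contra hneg
  have : (1 + ε / 2) * refBary m l x ≤ 0 :=
    mul_nonpos_of_nonneg_of_nonpos (by positivity) (not_lt.1 hneg)
  linarith

lemma frontier_refSimplex (m : ℕ) :
    frontier (refSimplex m) = ⋃ j, refFace m {j}ᶜ := by
  rw [(isClosed_refSimplex m).frontier_eq, interior_refSimplex]
  ext x
  simp only [mem_sdiff, mem_ofPred_eq, not_forall, not_lt, mem_iUnion, refFace]
  constructor
  · rintro ⟨hx, l, hl⟩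
    refine ⟨l, hx, fun j hj => ?_⟩
    have : j = l := by simpa using hj
    rw [this]
    exact le_antisymm hl (hx l)
  · rintro ⟨l, hx, h⟩
    exact ⟨hx, l, (h l (by simp)).le⟩

/-! ### The affine map of a simplex with given vertices -/

/-- The affine map from the reference simplex onto the simplex with vertices `v`. -/
def vertexMap {m n : ℕ} (v : Fin (m + 1) → E n) (x : E m) : E n := ∑ j, refBary m j x • v j

lemma contDiff_vertexMap {m n : ℕ} {r : WithTop ℕ∞} (v : Fin (m + 1) → E n) :
    ContDiff ℝ r (vertexMap v) :=
  ContDiff.sum fun j _ => (contDiff_refBary j).smul contDiff_const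

lemma vertexMap_eq_affineCombination {m n : ℕ} (v : Fin (m + 1) → E n) (x : E m) :
    vertexMap v x = Finset.univ.affineCombination ℝ v fun j => refBary m j x := by
  rw [Finset.affineCombination_eq_linear_combination _ _ _ (sum_refBary x)]
  rfl

lemma vertexMap_injective {m n : ℕ} {v : Fin (m + 1) → E n} (hv : AffineIndependent ℝ v) :
    Function.Injective (vertexMap v) := by
  intro x y hxy
  rw [vertexMap_eq_affineCombination, vertexMap_eq_affineCombination] at hxy
  have := (affineIndependent_iff_eq_of_fintype_affineCombination_eq ℝ v).1 hv _ _
    (sum_refBary x) (sum_refBary y) hxy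
  exact refBary_ext fun j => congrFun this j

lemma mem_convexHull_image_iff {m n : ℕ} (v : Fin (m + 1) → E n) (s : Finset (Fin (m + 1)))
    (z : E n) : z ∈ convexHull ℝ (v '' s) ↔ ∃ x ∈ refFace m s, vertexMap v x = z := by
  constructor
  · intro hz
    have hconv : Convex ℝ (vertexMap v '' refFace m s) := by
      rintro _ ⟨x, hx, rfl⟩ _ ⟨y, hy, rfl⟩ a b ha hb hab
      refine ⟨a • x + b • y, ⟨convex_refSimplex m hx.1 hy.1 ha hb hab, fun j hj => ?_⟩, ?_⟩
      · rw [refBary_combo j x y a b hab, hx.2 j hj, hy.2 j hj]; simp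
      · simp only [vertexMap, Finset.smul_sum, smul_smul, ← Finset.sum_add_distrib, ← add_smul]
        exact Finset.sum_congr rfl fun j _ => by rw [refBary_combo j x y a b hab]
    refine convexHull_min ?_ hconv hz
    rintro _ ⟨i, hi, rfl⟩
    have hsum : ∑ j, (Pi.single i (1 : ℝ) : Fin (m + 1) → ℝ) j = 1 := by simp
    refine ⟨refPoint (Pi.single i 1), ⟨fun j => ?_, fun j hj => ?_⟩, ?_⟩
    · rw [refBary_refPoint hsum]
      by_cases h : j = i <;> simp [h]
    · rw [refBary_refPoint hsum, Pi.single_apply, if_neg]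
      rintro rfl
      exact hj (by simpa using hi)
    · simp only [vertexMap, refBary_refPoint hsum]
      simp [Pi.single_apply]
  · rintro ⟨x, hx, rfl⟩
    have : vertexMap v x = ∑ j ∈ s, refBary m j x • v j := by
      refine (Finset.sum_subset (Finset.subset_univ s) fun j _ hj => ?_).symm
      rw [hx.2 j hj, zero_smul]
    rw [this]
    refine (convex_convexHull ℝ _).sum_mem (fun j _ => hx.1 j) ?_ fun j hj =>
      subset_convexHull ℝ _ (mem_image_of_mem v hj)
    rw [← sum_refBary x]
    refine Finset.sum_subset (Finset.subset_univ s) fun j _ hj => hx.2 j hj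

lemma image_refFace {m n : ℕ} (v : Fin (m + 1) → E n) (s : Finset (Fin (m + 1))) :
    vertexMap v '' refFace m s = convexHull ℝ (v '' s) :=
  Set.ext fun z => (mem_convexHull_image_iff v s z).symm

lemma refFace_univ (m : ℕ) : refFace m Finset.univ = refSimplex m := by
  ext x; simp [refFace]

lemma image_refSimplex {m n : ℕ} (v : Fin (m + 1) → E n) :
    vertexMap v '' refSimplex m = convexHull ℝ (range v) := by
  rw [← refFace_univ, image_refFace]; simp

/-! ### Polynomials of degree at most `k` and their Lagrange representation -/

/-- The space of polynomial functions of total degree at most `k` on `ℝ^m`. -/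
def polyFun (k m : ℕ) : Submodule ℝ (E m → ℝ) :=
  (MvPolynomial.restrictTotalDegree (Fin m) ℝ k).map
    (LinearMap.pi fun x : E m =>
      (MvPolynomial.aeval (fun i => x i) : MvPolynomial (Fin m) ℝ →ₐ[ℝ] ℝ).toLinearMap)

lemma mem_polyFun {k m : ℕ} {f : E m → ℝ} :
    f ∈ polyFun k m ↔ ∃ p : MvPolynomial (Fin m) ℝ, p.totalDegree ≤ k ∧
      ∀ x : E m, MvPolynomial.aeval (fun i => x i) p = f x := by
  simp only [polyFun, Submodule.mem_map, MvPolynomial.mem_restrictTotalDegree, funext_iff]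
  rfl

lemma mem_refElement_P {k m : ℕ} {f : refSimplex m → ℝ} :
    f ∈ (refElement k m).P ↔ ∃ g ∈ polyFun k m, ∀ x : refSimplex m, g x = f x := by
  constructor
  · rintro ⟨p, hp, rfl⟩
    exact ⟨fun x => MvPolynomial.aeval (fun i => x i) p,
      mem_polyFun.2 ⟨p, (MvPolynomial.mem_restrictTotalDegree _ _ _).1 hp, fun _ => rfl⟩,
      fun _ => rfl⟩
  · rintro ⟨g, hg, h⟩
    obtain ⟨p, hp, hpg⟩ := mem_polyFun.1 hg
    exact ⟨p, (MvPolynomial.mem_restrictTotalDegree _ _ _).2 hp,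
      funext fun x => (hpg x).trans (h x)⟩

lemma polyFun_mono {k l m : ℕ} (h : k ≤ l) : polyFun k m ≤ polyFun l m := by
  intro f hf
  obtain ⟨p, hp, hpf⟩ := mem_polyFun.1 hf
  exact mem_polyFun.2 ⟨p, hp.trans h, hpf⟩

lemma const_mem_polyFun {k m : ℕ} (c : ℝ) : (fun _ => c) ∈ polyFun k m :=
  mem_polyFun.2 ⟨MvPolynomial.C c, by simp, fun x => by simp⟩

lemma coord_mem_polyFun {m : ℕ} (i : Fin m) : (fun x : E m => x i) ∈ polyFun 1 m :=
  mem_polyFun.2 ⟨MvPolynomial.X i, by simp, fun x => by simp⟩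

lemma refBary_mem_polyFun {m : ℕ} (j : Fin (m + 1)) : refBary m j ∈ polyFun 1 m := by
  refine Fin.cases ?_ (fun i => coord_mem_polyFun i) j
  have : refBary m 0 = (fun _ => 1) - ∑ i, fun x : E m => x i := by
    ext x; simp [Finset.sum_apply]
  rw [this]
  exact Submodule.sub_mem _ (const_mem_polyFun 1)
    (Submodule.sum_mem _ fun i _ => coord_mem_polyFun i)

lemma mul_mem_polyFun {a b m : ℕ} {f g : E m → ℝ} (hf : f ∈ polyFun a m)
    (hg : g ∈ polyFun b m) : (fun x => f x * g x) ∈ polyFun (a + b) m := by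
  obtain ⟨p, hp, hpf⟩ := mem_polyFun.1 hf
  obtain ⟨q, hq, hqg⟩ := mem_polyFun.1 hg
  refine mem_polyFun.2 ⟨p * q, (MvPolynomial.totalDegree_mul p q).trans (add_le_add hp hq), ?_⟩
  intro x
  rw [map_mul, hpf, hqg]

lemma prod_mem_polyFun {ι : Type*} {m : ℕ} (s : Finset ι) (e : ι → ℕ) (f : ι → E m → ℝ)
    (hf : ∀ i ∈ s, f i ∈ polyFun (e i) m) :
    (fun x => ∏ i ∈ s, f i x) ∈ polyFun (∑ i ∈ s, e i) m := by
  classical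
  induction s using Finset.induction_on with
  | empty => simpa using const_mem_polyFun (1 : ℝ)
  | insert a s ha ih =>
    simp only [Finset.prod_insert ha, Finset.sum_insert ha]
    exact mul_mem_polyFun (hf a (by simp)) (ih fun i hi => hf i (by simp [hi]))

lemma polyFun_eq_sum {m : ℕ} (p : MvPolynomial (Fin m) ℝ) (x : E m) :
    MvPolynomial.aeval (fun i => x i) p = ∑ e ∈ p.support, p.coeff e * ∏ i, x i ^ e i := by
  rw [MvPolynomial.aeval_def, MvPolynomial.eval₂_eq']
  rfl

lemma degree_le_of_mem_support {m k : ℕ} {p : MvPolynomial (Fin m) ℝ} (hp : p.totalDegree ≤ k)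
    {e : Fin m →₀ ℕ} (he : e ∈ p.support) : ∑ i, e i ≤ k := by
  have := (MvPolynomial.le_totalDegree he).trans hp
  rwa [Finsupp.sum_fintype _ _ (fun _ => rfl)] at this

/-- Composition with a map with affine components preserves the degree. -/
lemma comp_mem_polyFun {k m n : ℕ} {f : E n → ℝ} (hf : f ∈ polyFun k n) {L : E m → E n}
    (hL : ∀ i, (fun x => L x i) ∈ polyFun 1 m) : (fun x => f (L x)) ∈ polyFun k m := by
  obtain ⟨p, hp, hpf⟩ := mem_polyFun.1 hf
  have : (fun x => f (L x)) =
      ∑ e ∈ p.support, p.coeff e • fun x : E m => ∏ i, (L x i) ^ e i := by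
    ext x; rw [← hpf, polyFun_eq_sum]; simp [Finset.sum_apply]
  rw [this]
  refine Submodule.sum_mem _ fun e he => Submodule.smul_mem _ _ ?_
  refine polyFun_mono (degree_le_of_mem_support hp he) ?_
  refine prod_mem_polyFun _ _ _ fun i _ => ?_
  have := prod_mem_polyFun (Finset.range (e i)) (fun _ => 1) (fun _ x => L x i) fun _ _ => hL i
  simpa using this

lemma vertexMap_apply_mem_polyFun {m n : ℕ} (v : Fin (m + 1) → E n) (i : Fin n) :
    (fun x => vertexMap v x i) ∈ polyFun 1 m := by
  have : (fun x => vertexMap v x i) = ∑ j, (v j i) • refBary m j := by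
    ext x; simp [vertexMap, Finset.sum_apply, mul_comm]
  rw [this]
  exact Submodule.sum_mem _ fun j _ => Submodule.smul_mem _ _ (refBary_mem_polyFun j)

/-- The exponents `α` with `∑ j, α j = k`, which index the Lagrange nodes of degree `k`. -/
abbrev NodeIndex (k m : ℕ) := {α : Fin (m + 1) → ℕ // α ∈ Finset.piAntidiag Finset.univ k}

lemma NodeIndex.sum_eq {k m : ℕ} (α : NodeIndex k m) : ∑ j, α.1 j = k :=
  (Finset.mem_piAntidiag.1 α.2).1

/-- The Lagrange node of the reference simplex with barycentric coordinates `α j / k`. -/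
def refNode (k : ℕ) {m : ℕ} (α : Fin (m + 1) → ℕ) : E m := refPoint fun j => (α j : ℝ) / k

lemma refBary_refNode {k m : ℕ} (hk : 1 ≤ k) (α : NodeIndex k m) (j : Fin (m + 1)) :
    refBary m j (refNode k α.1) = (α.1 j : ℝ) / k := by
  refine refBary_refPoint ?_ j
  rw [← Finset.sum_div, ← Nat.cast_sum, α.sum_eq, div_self]
  positivity

lemma refNode_mem {k m : ℕ} (hk : 1 ≤ k) (α : NodeIndex k m) : refNode k α.1 ∈ refNodes k m := by
  refine ⟨fun j => ?_, fun j => ⟨α.1 j, ?_⟩⟩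
  · rw [refBary_refNode hk]; positivity
  · rw [refBary_refNode hk]; field_simp

lemma exists_refNode_eq {k m : ℕ} (hk : 1 ≤ k) {x : E m} (hx : x ∈ refNodes k m) :
    ∃ α : NodeIndex k m, refNode k α.1 = x := by
  choose α hα using hx.2
  have hsum : ∑ j, α j = k := by
    have : ((∑ j, α j : ℕ) : ℝ) = k := by
      push_cast
      rw [← Finset.sum_congr rfl fun j _ => hα j, ← Finset.mul_sum, sum_refBary, mul_one]
    exact_mod_cast this
  refine ⟨⟨α, by simpa [Finset.mem_piAntidiag] using hsum⟩, refBary_ext fun j => ?_⟩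
  rw [refBary_refNode hk]
  simp only
  rw [← hα j]
  have : (k : ℝ) ≠ 0 := by positivity
  field_simp

/-- The Lagrange basis polynomial of the node with index `α`, as a function of the barycentric
coordinates. -/
def baryBasis (k : ℕ) {m : ℕ} (α : Fin (m + 1) → ℕ) (w : Fin (m + 1) → ℝ) : ℝ :=
  ∏ j, ∏ l ∈ Finset.range (α j), ((k : ℝ) * w j - l) / (l + 1)

lemma contDiff_baryBasis (k : ℕ) {m : ℕ} {n : WithTop ℕ∞} (α : Fin (m + 1) → ℕ) :
    ContDiff ℝ n (baryBasis k α) := by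
  unfold baryBasis
  fun_prop

/-- The Lagrange basis polynomial of the node with index `α` on the reference simplex. -/
def refBasis (k : ℕ) {m : ℕ} (α : Fin (m + 1) → ℕ) (x : E m) : ℝ :=
  baryBasis k α fun j => refBary m j x

lemma refBasis_mem_polyFun {k m : ℕ} (α : NodeIndex k m) : refBasis k α.1 ∈ polyFun k m := by
  have h : ∀ j, (fun x : E m =>
      ∏ l ∈ Finset.range (α.1 j), ((k : ℝ) * refBary m j x - l) / (l + 1))
      ∈ polyFun (α.1 j) m := by
    intro j
    have := prod_mem_polyFun (Finset.range (α.1 j)) (fun _ => 1)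
      (fun l (x : E m) => ((k : ℝ) * refBary m j x - l) / (l + 1)) fun l _ => ?_
    · simpa using this
    · have h2 : (fun x : E m => ((k : ℝ) * refBary m j x - l) / (l + 1)) =
          ((k : ℝ) / (l + 1)) • refBary m j - fun _ => (l : ℝ) / (l + 1) := by
        ext x; simp; ring
      rw [h2]
      exact Submodule.sub_mem _ (Submodule.smul_mem _ _ (refBary_mem_polyFun j))
        (const_mem_polyFun _)
  have := prod_mem_polyFun Finset.univ (fun j => α.1 j) _ fun j _ => h j
  rw [α.sum_eq] at this
  exact this

/-- The basis polynomial of `α` vanishes at a point with `k λ_j = n < α_j`. -/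
lemma refBasis_eq_zero {k m : ℕ} {α : Fin (m + 1) → ℕ} {x : E m} {j : Fin (m + 1)} {n : ℕ}
    (hx : (k : ℝ) * refBary m j x = n) (hn : n < α j) : refBasis k α x = 0 := by
  refine Finset.prod_eq_zero (Finset.mem_univ j) ?_
  refine Finset.prod_eq_zero (Finset.mem_range.2 hn) ?_
  rw [hx]; simp

lemma refBasis_refNode_self {k m : ℕ} (hk : 1 ≤ k) (α : NodeIndex k m) :
    refBasis k α.1 (refNode k α.1) = 1 := by
  simp only [refBasis, baryBasis]
  refine Finset.prod_eq_one fun j _ => ?_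
  have hk' : (k : ℝ) ≠ 0 := by positivity
  have hne : ∏ l ∈ Finset.range (α.1 j), ((l : ℝ) + 1) ≠ 0 :=
    Finset.prod_ne_zero_iff.2 fun l _ => by positivity
  rw [Finset.prod_div_distrib, div_eq_one_iff_eq hne, ← Finset.prod_range_reflect]
  refine Finset.prod_congr rfl fun l hl => ?_
  have hl' := Finset.mem_range.1 hl
  rw [refBary_refNode hk, Nat.cast_sub (by omega), Nat.cast_sub (by omega)]
  field_simp
  push_cast
  ring

lemma refBasis_refNode {k m : ℕ} (hk : 1 ≤ k) (α β : NodeIndex k m) :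
    refBasis k α.1 (refNode k β.1) = if α = β then 1 else 0 := by
  split_ifs with h
  · rw [h, refBasis_refNode_self hk]
  · obtain ⟨j, hj⟩ : ∃ j, β.1 j < α.1 j := by
      by_contra! hle
      refine h (Subtype.ext (funext fun j => ?_))
      have := (Finset.sum_eq_sum_iff_of_le fun j _ => hle j).1 (by rw [α.sum_eq, β.sum_eq])
      exact this j (Finset.mem_univ j)
    refine refBasis_eq_zero (j := j) (n := β.1 j) ?_ hj
    rw [refBary_refNode hk]
    have hk' : (k : ℝ) ≠ 0 := by positivity
    field_simp

lemma finrank_polyFun_le (k m : ℕ) :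
    FiniteDimensional ℝ (polyFun k m) ∧
      Module.finrank ℝ (polyFun k m) ≤ Fintype.card (NodeIndex k m) := by
  let b : NodeIndex k m → E m → ℝ := fun α x => ∏ i, x i ^ α.1 i.succ
  have hle : polyFun k m ≤ Submodule.span ℝ (range b) := by
    intro f hf
    obtain ⟨p, hp, hpf⟩ := mem_polyFun.1 hf
    have : f = ∑ e ∈ p.support, p.coeff e • fun x : E m => ∏ i, x i ^ e i := by
      ext x; rw [← hpf, polyFun_eq_sum]; simp [Finset.sum_apply]
    rw [this]
    refine Submodule.sum_mem _ fun e he => Submodule.smul_mem _ _ (Submodule.subset_span ?_)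
    have hdeg := degree_le_of_mem_support hp he
    -- homogenize: the exponent of the additional variable fills up the degree
    refine ⟨⟨Fin.cons (k - ∑ i, e i) e, ?_⟩, ?_⟩
    · simp [Finset.mem_piAntidiag, Fin.sum_univ_succ]
      omega
    · ext x; simp [b]
  have hfin : FiniteDimensional ℝ (Submodule.span ℝ (range b)) :=
    FiniteDimensional.span_of_finite ℝ (finite_range b)
  exact ⟨Submodule.finiteDimensional_of_le hle,
    (Submodule.finrank_mono hle).trans (finrank_range_le_card b)⟩

/-- Lagrange interpolation reproduces polynomials: the basis polynomials are as many linearly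
independent elements of the space as there are monomials. -/
lemma lagrange_formula {k m : ℕ} (hk : 1 ≤ k) {p : E m → ℝ} (hp : p ∈ polyFun k m) (x : E m) :
    p x = ∑ α : NodeIndex k m, refBasis k α.1 x * p (refNode k α.1) := by
  obtain ⟨hfin, hrank⟩ := finrank_polyFun_le k m
  let b : NodeIndex k m → polyFun k m := fun α => ⟨refBasis k α.1, refBasis_mem_polyFun α⟩
  have hind : LinearIndependent ℝ b := by
    rw [Fintype.linearIndependent_iff]
    intro g hg β
    have h1 := congrFun (congrArg Subtype.val hg) (refNode k β.1)
    simpa [b, Finset.sum_apply, refBasis_refNode hk] using h1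
  have hspan := hind.span_eq_top_of_card_eq_finrank'
    (le_antisymm hind.fintype_card_le_finrank hrank)
  have hmem : (⟨p, hp⟩ : polyFun k m) ∈ Submodule.span ℝ (range b) := hspan ▸ Submodule.mem_top
  obtain ⟨c, hc⟩ := (Submodule.mem_span_range_iff_exists_fun ℝ).1 hmem
  have hpx : ∀ y, p y = ∑ α, c α * refBasis k α.1 y := fun y => by
    have := congrFun (congrArg Subtype.val hc) y
    simpa [b, Finset.sum_apply] using this.symm
  have hcoef : ∀ β, p (refNode k β.1) = c β := fun β => by
    rw [hpx]; simp [refBasis_refNode hk]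
  rw [hpx]
  exact Finset.sum_congr rfl fun α _ => by rw [hcoef, mul_comm]

/-- The values of a polynomial on a face are determined by those at the nodes on that face. -/
lemma polyFun_eq_zero_of_nodes {k m : ℕ} (hk : 1 ≤ k) {p : E m → ℝ} (hp : p ∈ polyFun k m)
    (s : Finset (Fin (m + 1))) (h : ∀ x ∈ refNodes k m ∩ refFace m s, p x = 0) {x : E m}
    (hx : x ∈ refFace m s) : p x = 0 := by
  rw [lagrange_formula hk hp]
  refine Finset.sum_eq_zero fun α _ => ?_
  by_cases hα : ∀ j, j ∉ s → α.1 j = 0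
  · rw [h _ ⟨refNode_mem hk α, (refNode_mem hk α).1, fun j hj => ?_⟩, mul_zero]
    rw [refBary_refNode hk, hα j hj]; simp
  · push Not at hα
    obtain ⟨j, hj, hne⟩ := hα
    rw [refBasis_eq_zero (j := j) (n := 0) (by rw [hx.2 j hj]; simp) (Nat.pos_of_ne_zero hne),
      zero_mul]

/-! ### Unisolvence of transported Lagrange elements -/

lemma mem_mapElement_P {k m n : ℕ} {F : E m → E n} {χ : F '' refSimplex m → ℝ} :
    χ ∈ (mapElement F (refElement k m)).P ↔ ∃ g ∈ polyFun k m,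
      ∀ x (hx : x ∈ refSimplex m), g x = χ ⟨F x, mem_image_of_mem F hx⟩ := by
  refine (mem_refElement_P (k := k)).trans ?_
  exact ⟨fun ⟨g, hg, h⟩ => ⟨g, hg, fun x hx => h ⟨x, hx⟩⟩, fun ⟨g, hg, h⟩ =>
    ⟨g, hg, fun x => h x.1 x.2⟩⟩

lemma mem_mapElement_Sig {k m n : ℕ} {F : E m → E n}
    {σ : Module.Dual ℝ (mapElement F (refElement k m)).P} :
    σ ∈ (mapElement F (refElement k m)).Sig ↔ ∃ a : refSimplex m, (a : E m) ∈ refNodes k m ∧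
      ∀ χ, σ χ = χ.1 ⟨F a, mem_image_of_mem F a.2⟩ := by
  constructor
  · rintro ⟨τ, ⟨a, ha, hτ⟩, hσ⟩
    exact ⟨a, ha, fun χ => (hσ χ).trans (hτ _)⟩
  · rintro ⟨a, ha, hσ⟩
    exact ⟨(LinearMap.proj a).comp (refElement k m).P.subtype, ⟨a, ha, fun _ => rfl⟩, hσ⟩

/-- A family of functionals with a dual family that represents every vector is a basis of the
dual space. -/
lemma isBasis_dual_of_dualFamily {V ι : Type*} [AddCommGroup V] [Module ℝ V] [Fintype ι]
    [DecidableEq ι] (b : ι → V) (ev : ι → Module.Dual ℝ V)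
    (hdual : ∀ α β, ev α (b β) = if β = α then 1 else 0)
    (hrepr : ∀ χ : V, χ = ∑ α, ev α χ • b α) :
    FiniteDimensional ℝ V ∧
      LinearIndependent ℝ (fun σ : range ev => (σ : Module.Dual ℝ V)) ∧
      Submodule.span ℝ (range ev) = ⊤ := by
  classical
  have hind : LinearIndependent ℝ ev := by
    rw [Fintype.linearIndependent_iff]
    intro c hc β
    have := congrArg (fun φ : Module.Dual ℝ V => φ (b β)) hc
    simpa [LinearMap.sum_apply, hdual] using this
  refine ⟨Module.finite_def.2 ⟨Finset.univ.image b, eq_top_iff.2 fun χ _ => ?_⟩,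
    hind.linearIndepOn_id, eq_top_iff.2 fun φ _ => ?_⟩
  · rw [hrepr χ]
    exact Submodule.sum_mem _ fun α _ => Submodule.smul_mem _ _ (Submodule.subset_span (by simp))
  · have : φ = ∑ α, φ (b α) • ev α := by
      refine LinearMap.ext fun χ => ?_
      have h1 := congrArg φ (hrepr χ)
      rw [map_sum] at h1
      rw [h1, LinearMap.sum_apply]
      exact Finset.sum_congr rfl fun α _ => by
        rw [map_smul, LinearMap.smul_apply, smul_eq_mul, smul_eq_mul, mul_comm]
    rw [this]
    exact Submodule.sum_mem _ fun α _ => Submodule.smul_mem _ _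
      (Submodule.subset_span (mem_range_self α))

/-- A Lagrange element transported by an injective map is unisolvent: the transported basis
polynomials are dual to the nodal evaluations. -/
lemma mapElement_isUnisolvent {k m n : ℕ} (hk : 1 ≤ k) {F : E m → E n}
    (hF : InjOn F (refSimplex m)) : (mapElement F (refElement k m)).IsUnisolvent := by
  classical
  let Q : Submodule ℝ (F '' refSimplex m → ℝ) := (mapElement F (refElement k m)).P
  have memQ : ∀ χ, χ ∈ Q ↔ ∃ g ∈ polyFun k m,
      ∀ x (hx : x ∈ refSimplex m), g x = χ ⟨F x, mem_image_of_mem F hx⟩ :=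
    fun χ => mem_mapElement_P
  -- the basis polynomials, pulled back to the image, and the evaluations at the image nodes
  let nd : NodeIndex k m → refSimplex m := fun α => ⟨refNode k α.1, (refNode_mem hk α).1⟩
  have hb : ∀ α : NodeIndex k m, ∃ χ : Q, ∀ x (hx : x ∈ refSimplex m),
      refBasis k α.1 x = χ.1 ⟨F x, mem_image_of_mem F hx⟩ := by
    intro α
    let f : F '' refSimplex m → ℝ := fun y => refBasis k α.1 y.2.choose
    have hf : ∀ x (hx : x ∈ refSimplex m), refBasis k α.1 x =
        f ⟨F x, mem_image_of_mem F hx⟩ := by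
      intro x hx
      have hc := (mem_image_of_mem F hx).choose_spec
      exact congrArg _ (hF hc.1 hx hc.2).symm
    exact ⟨⟨f, (memQ f).2 ⟨_, refBasis_mem_polyFun α, hf⟩⟩, hf⟩
  choose b hb using hb
  let ev : NodeIndex k m → Module.Dual ℝ Q := fun α =>
    (LinearMap.proj (⟨F (nd α), mem_image_of_mem F (nd α).2⟩ : F '' refSimplex m)).comp
      Q.subtype
  have hev : ∀ α (χ : Q), ev α χ = χ.1 ⟨F (nd α), mem_image_of_mem F (nd α).2⟩ :=
    fun _ _ => rfl
  have hdual : ∀ α β, ev α (b β) = if β = α then 1 else 0 := fun α β => by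
    rw [hev, ← hb β _ (nd α).2, refBasis_refNode hk]
  have hrepr : ∀ χ : Q, χ = ∑ α, ev α χ • b α := by
    intro χ
    obtain ⟨g, hg, h⟩ := (memQ χ.1).1 χ.2
    ext ⟨y, x, hx, rfl⟩
    have hx' : χ.1 ⟨F x, mem_image_of_mem F hx⟩ = g x := (h x hx).symm
    rw [Submodule.coe_sum, Finset.sum_apply]
    refine hx'.trans ((lagrange_formula hk hg x).trans (Finset.sum_congr rfl fun α _ => ?_))
    rw [h _ (nd α).2, hb α x hx, mul_comm]
    rfl
  have hSig : (mapElement F (refElement k m)).Sig = range ev := by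
    ext σ
    refine mem_mapElement_Sig.trans ⟨?_, ?_⟩
    · rintro ⟨a, ha, hσ⟩
      obtain ⟨α, hα⟩ := exists_refNode_eq hk ha
      refine ⟨α, LinearMap.ext fun χ => ?_⟩
      refine Eq.trans ?_ (hσ χ).symm
      have : nd α = a := Subtype.ext hα
      rw [← this]
      rfl
    · rintro ⟨α, rfl⟩
      exact ⟨nd α, refNode_mem hk α, fun χ => rfl⟩
  obtain ⟨h1, h2, h3⟩ := isBasis_dual_of_dualFamily b ev hdual hrepr
  refine ⟨h1, ?_, ?_⟩
  · rw [hSig]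
    exact h2
  · rw [hSig]
    exact h3

/-! ### Common faces of simplices -/

/-- A vertex of a face is an extreme point, hence a vertex of every simplex with that face. -/
lemma exists_vertex_eq {m n : ℕ} {v v' : Fin (m + 1) → E n} (hv : AffineIndependent ℝ v)
    {s t : Finset (Fin (m + 1))} (h : convexHull ℝ (v '' s) = convexHull ℝ (v' '' t)) {a}
    (ha : a ∈ s) : ∃ b ∈ t, v' b = v a := by
  have hmem : v a ∈ convexHull ℝ (v '' s) := subset_convexHull ℝ _ (mem_image_of_mem v ha)
  suffices hext : v a ∈ (convexHull ℝ (v '' s)).extremePoints ℝ by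
    rw [h] at hext
    obtain ⟨b, hb, hba⟩ := extremePoints_convexHull_subset hext
    exact ⟨b, hb, hba⟩
  have hvert : ∀ x, vertexMap v x = v a → refBary m a x = 1 := by
    intro x hx
    have h1 : vertexMap v (refPoint (Pi.single a 1)) = v a := by
      simp only [vertexMap, refBary_refPoint (show ∑ j, (Pi.single a (1 : ℝ) :
        Fin (m + 1) → ℝ) j = 1 by simp)]
      simp [Pi.single_apply]
    rw [vertexMap_injective hv (hx.trans h1.symm), refBary_refPoint (by simp)]
    simp
  have heq : ∀ x ∈ refSimplex m, refBary m a x = 1 → vertexMap v x = v a := by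
    intro x hx h1
    have h0 : ∀ j, j ≠ a → refBary m j x = 0 := by
      have hs := sum_refBary x
      rw [← Finset.add_sum_erase _ _ (Finset.mem_univ a), h1] at hs
      have hs0 : ∑ j ∈ Finset.univ.erase a, refBary m j x = 0 := by linarith
      intro j hj
      exact (Finset.sum_eq_zero_iff_of_nonneg fun i _ => hx i).1 hs0 j (by simp [hj])
    rw [vertexMap, Finset.sum_eq_single a (fun j _ hj => by rw [h0 j hj, zero_smul]) (by simp),
      h1, one_smul]
  rw [mem_extremePoints]
  refine ⟨hmem, fun y hy z hz hyz => ?_⟩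
  obtain ⟨y', hy', rfl⟩ := (mem_convexHull_image_iff v s y).1 hy
  obtain ⟨z', hz', rfl⟩ := (mem_convexHull_image_iff v s z).1 hz
  obtain ⟨c, d, hc, hd, hcd, hsum⟩ := hyz
  have hcomb : vertexMap v (c • y' + d • z') = v a := by
    rw [← hsum]
    simp only [vertexMap, Finset.smul_sum, smul_smul, ← Finset.sum_add_distrib, ← add_smul]
    exact Finset.sum_congr rfl fun j _ => by rw [refBary_combo j _ _ c d hcd]
  have h1 := hvert _ hcomb
  rw [refBary_combo a _ _ c d hcd] at h1
  have hy1 := refBary_le_one hy'.1 a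
  have hz1 := refBary_le_one hz'.1 a
  exact ⟨heq _ hy'.1 (by nlinarith), heq _ hz'.1 (by nlinarith)⟩

/-- If two simplices share a face, the change of barycentric coordinates on that face is the
restriction of an affine map of the reference simplex that permutes vertices. -/
lemma exists_transfer {m n : ℕ} {v v' : Fin (m + 1) → E n} (hv : AffineIndependent ℝ v)
    (hv' : AffineIndependent ℝ v') (k : ℕ) {s t : Finset (Fin (m + 1))}
    (hst : convexHull ℝ (v '' s) = convexHull ℝ (v' '' t)) :
    ∃ L : E m → E m, (∀ i, (fun x => L x i) ∈ polyFun 1 m) ∧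
      MapsTo L (refSimplex m) (refSimplex m) ∧ MapsTo L (refNodes k m) (refNodes k m) ∧
      (∀ x ∈ refFace m s, vertexMap v' (L x) = vertexMap v x) ∧
      ∀ x ∈ refFace m s, ∀ y, vertexMap v x = vertexMap v' y → L x = y := by
  classical
  choose! σ hσ using fun a (ha : a ∈ s) => exists_vertex_eq hv hst ha
  let L : E m → E m := vertexMap fun a => refPoint (Pi.single (σ a) 1)
  have hL : ∀ x j, refBary m j (L x) = ∑ a, refBary m a x * if j = σ a then 1 else 0 := by
    intro x j
    simp only [L, vertexMap]
    rw [refBary_sum _ _ _ (sum_refBary x)]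
    refine Finset.sum_congr rfl fun a _ => ?_
    rw [refBary_refPoint (by simp), Pi.single_apply]
  have hmap : ∀ x ∈ refFace m s, vertexMap v' (L x) = vertexMap v x := by
    intro x hx
    simp only [vertexMap, hL, Finset.sum_smul]
    rw [Finset.sum_comm]
    refine Finset.sum_congr rfl fun a _ => ?_
    by_cases ha : a ∈ s
    · rw [Finset.sum_eq_single (σ a) (fun j _ hj => by simp [hj]) (by simp)]
      simp [(hσ a ha).2]
    · simp [hx.2 a ha]
  refine ⟨L, fun i => vertexMap_apply_mem_polyFun _ i, fun x hx j => ?_, fun x hx =>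
    ⟨fun j => ?_, fun j => ?_⟩, hmap, fun x hx y hxy =>
      vertexMap_injective hv' ((hmap x hx).trans hxy)⟩
  · rw [hL]
    exact Finset.sum_nonneg fun a _ => mul_nonneg (hx a) (by split_ifs <;> norm_num)
  · rw [hL]
    exact Finset.sum_nonneg fun a _ => mul_nonneg (hx.1 a) (by split_ifs <;> norm_num)
  · choose N hN using hx.2
    refine ⟨∑ a, N a * if j = σ a then 1 else 0, ?_⟩
    rw [hL, Finset.mul_sum]
    push_cast
    exact Finset.sum_congr rfl fun a _ => by rw [← mul_assoc, hN]

lemma mem_refFace_of_vertexMap_mem {m n : ℕ} {v : Fin (m + 1) → E n}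
    (hv : AffineIndependent ℝ v) {s : Finset (Fin (m + 1))} {x : E m}
    (h : vertexMap v x ∈ convexHull ℝ (v '' s)) : x ∈ refFace m s := by
  obtain ⟨y, hy, hyx⟩ := (mem_convexHull_image_iff v s _).1 h
  rwa [← vertexMap_injective hv hyx]

/-- Two polynomials on simplices with a common face agree on it if they agree at its nodes. -/
lemma trace_eq_of_nodes {m n k : ℕ} (hk : 1 ≤ k) {v v' : Fin (m + 1) → E n}
    (hv : AffineIndependent ℝ v) (hv' : AffineIndependent ℝ v') {s t : Finset (Fin (m + 1))}
    (hst : convexHull ℝ (v '' s) = convexHull ℝ (v' '' t)) {p q : E m → ℝ}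
    (hp : p ∈ polyFun k m) (hq : q ∈ polyFun k m)
    (h : ∀ x ∈ refNodes k m ∩ refFace m s, ∀ y ∈ refNodes k m, vertexMap v x = vertexMap v' y →
      p x = q y) {x y : E m} (hx : x ∈ refFace m s) (hxy : vertexMap v x = vertexMap v' y) :
    p x = q y := by
  obtain ⟨L, hLp, -, hLn, hL, hL'⟩ := exists_transfer hv hv' k hst
  have hr : (fun x => p x - q (L x)) ∈ polyFun k m :=
    Submodule.sub_mem _ hp (comp_mem_polyFun hq hLp)
  have := polyFun_eq_zero_of_nodes hk hr s (fun z hz => sub_eq_zero.2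
    (h z hz (L z) (hLn hz.1) (hL z hz.2).symm)) hx
  rw [← hL' x hx y hxy]
  exact sub_eq_zero.1 this

/-- A family of curved elements obtained from a conforming family of straight simplices by one
injective map of the ambient space is a conforming admissible subdivision. -/
lemma isConformingSubdivision_of_straight {ι : Type*} {m n k : ℕ} (hk : 1 ≤ k) {J : Set ι}
    (hJ : J.Finite) {v : ι → Fin (m + 1) → E n} (hv : ∀ i ∈ J, AffineIndependent ℝ (v i))
    {G : E n → E n} (hG : Function.Injective G) {F : ι → E m → E n}
    (hF : ∀ i ∈ J, ∀ x ∈ refSimplex m, F i x = G (vertexMap (v i) x)) {D : Set (E n)}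
    (hD : D = ⋃ i ∈ J, G '' convexHull ℝ (range (v i)))
    (hadm : ∀ i ∈ J, ∀ j ∈ J, i ≠ j → ∃ s t : Finset (Fin (m + 1)),
      s ≠ Finset.univ ∧ t ≠ Finset.univ ∧
      convexHull ℝ (range (v i)) ∩ convexHull ℝ (range (v j)) = convexHull ℝ (v i '' s) ∧
      convexHull ℝ (v i '' s) = convexHull ℝ (v j '' t)) :
    IsConformingSubdivision k J F D := by
  have himg : ∀ i ∈ J, ∀ s, F i '' refFace m s = G '' convexHull ℝ (v i '' s) := by
    intro i hi s
    rw [← image_refFace, image_image]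
    exact image_congr fun x hx => hF i hi x hx.1
  have hbody : ∀ i ∈ J, F i '' refSimplex m = G '' convexHull ℝ (range (v i)) := by
    intro i hi
    rw [← image_refSimplex, image_image]
    exact image_congr fun x hx => hF i hi x hx
  -- equality of images puts the parameter into the common face
  have hface : ∀ i ∈ J, ∀ j ∈ J, ∀ s : Finset (Fin (m + 1)),
      convexHull ℝ (range (v i)) ∩ convexHull ℝ (range (v j)) = convexHull ℝ (v i '' s) →
      ∀ x ∈ refSimplex m, ∀ y ∈ refSimplex m, F i x = F j y →
      x ∈ refFace m s ∧ vertexMap (v i) x = vertexMap (v j) y := by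
    intro i hi j hj s hs x hx y hy hxy
    have heq : vertexMap (v i) x = vertexMap (v j) y := by
      rw [hF i hi x hx, hF j hj y hy] at hxy
      exact hG hxy
    refine ⟨mem_refFace_of_vertexMap_mem (hv i hi) ?_, heq⟩
    rw [← hs]
    refine ⟨?_, ?_⟩
    · rw [← image_refSimplex]; exact mem_image_of_mem _ hx
    · rw [heq, ← image_refSimplex]; exact mem_image_of_mem _ hy
  have hnodes : ∀ i ∈ J, ∀ j ∈ J,
      F i '' refNodes k m ∩ F j '' refSimplex m ⊆ F j '' refNodes k m ∩ F i '' refSimplex m := by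
    intro i hi j hj
    rcases eq_or_ne i j with rfl | hij
    · exact Subset.rfl
    rintro _ ⟨⟨x, hx, rfl⟩, y, hy, hyx⟩
    obtain ⟨s, t, -, -, h1, h2⟩ := hadm i hi j hj hij
    obtain ⟨hxs, heq⟩ := hface i hi j hj s h1 x hx.1 y hy hyx.symm
    obtain ⟨L, -, -, hLn, -, hL'⟩ := exists_transfer (hv i hi) (hv j hj) k h2
    have hLx := hL' x hxs y heq
    exact ⟨⟨y, hLx ▸ hLn hx, hyx⟩, x, hx.1, rfl⟩
  refine ⟨hJ, ?_, ?_, ?_, fun i hi j hj => (hnodes i hi j hj).antisymm (hnodes j hj i hi), ?_⟩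
  · rw [hD]
    exact iUnion₂_congr fun i hi => (hbody i hi).symm
  · intro i hi j hj hij
    obtain ⟨s, t, hs, -, h1, -⟩ := hadm i hi j hj hij
    rw [Set.disjoint_left]
    rintro _ ⟨x, hx, rfl⟩ ⟨y, hy, hyx⟩
    have hxs := (hface i hi j hj s h1 x (fun l => (hx l).le) y hy hyx.symm).1
    obtain ⟨l, hl⟩ : ∃ l, l ∉ s := by
      by_contra! hall
      exact hs (Finset.eq_univ_iff_forall.2 hall)
    exact (hx l).ne' (hxs.2 l hl)
  · intro i hi j hj hij
    obtain ⟨s, t, hs, ht, h1, h2⟩ := hadm i hi j hj hij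
    refine ⟨s, t, hs, ht, ?_, ?_⟩
    · rw [hbody i hi, hbody j hj, ← image_inter hG, h1, himg i hi]
    · rw [himg i hi, himg j hj, h2]
  · intro i hi j hj χ hχ χ' hχ' hagree z hzi hzj
    obtain ⟨p, hp, hpχ⟩ := mem_mapElement_P.1 hχ
    obtain ⟨q, hq, hqχ⟩ := mem_mapElement_P.1 hχ'
    obtain ⟨x, hx, rfl⟩ := hzi
    obtain ⟨y, hy, hyx⟩ := id hzj
    have hpx : χ ⟨F i x, mem_image_of_mem _ hx⟩ = p x := (hpχ x hx).symm
    have hqy : χ' ⟨F i x, hzj⟩ = q y := by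
      rw [hqχ y hy]; congr 2; exact hyx.symm
    rw [hpx, hqy]
    obtain ⟨s, t, h1, h2⟩ : ∃ s t : Finset (Fin (m + 1)),
        convexHull ℝ (range (v i)) ∩ convexHull ℝ (range (v j)) = convexHull ℝ (v i '' s) ∧
        convexHull ℝ (v i '' s) = convexHull ℝ (v j '' t) := by
      rcases eq_or_ne i j with rfl | hij
      · exact ⟨Finset.univ, Finset.univ, by simp, rfl⟩
      · obtain ⟨s, t, -, -, h⟩ := hadm i hi j hj hij
        exact ⟨s, t, h⟩
    obtain ⟨hxs, heq⟩ := hface i hi j hj s h1 x hx y hy hyx.symm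
    refine trace_eq_of_nodes hk (hv i hi) (hv j hj) h2 hp hq (fun a ha b hb hab => ?_) hxs heq
    have hFab : F i a = F j b := by rw [hF i hi a ha.1.1, hF j hj b hb.1, hab]
    have := hagree (F i a) (mem_image_of_mem _ ha.1.1) (hFab ▸ mem_image_of_mem _ hb.1)
      (mem_image_of_mem _ ha.1)
    refine (hpχ a ha.1.1).trans (this.trans (Eq.trans ?_ (hqχ b hb.1).symm))
    congr 2

/-! ### Lipschitz perturbations of the identity -/

/-- A map that is `K`-Lipschitz on each set of a finite closed cover is `K`-Lipschitz: along a
segment, the estimate propagates from one set of the cover to the next. -/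
lemma lipschitzWith_of_finite_closed_cover {V W ι : Type*} [NormedAddCommGroup V]
    [NormedSpace ℝ V] [PseudoMetricSpace W] [Finite ι] {C : ι → Set V}
    (hC : ∀ i, IsClosed (C i)) (hcov : ⋃ i, C i = univ) {f : V → W} {K : NNReal}
    (hf : ∀ i, LipschitzOnWith K f (C i)) : LipschitzWith K f := by
  have hcont : Continuous f :=
    (locallyFinite_of_finite C).continuous hcov hC fun i => (hf i).continuousOn
  refine LipschitzWith.of_dist_le_mul fun x y => ?_
  let γ : ℝ → V := fun t => x + t • (y - x)
  have hγ : Continuous γ := by fun_prop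
  have hγd : ∀ a b, dist (γ a) (γ b) = |a - b| * dist x y := by
    intro a b
    rw [dist_eq_norm, dist_eq_norm, ← norm_neg (x - y), neg_sub, ← Real.norm_eq_abs, ← norm_smul]
    congr 1
    simp only [γ]
    module
  let S : Set ℝ := {t | dist (f x) (f (γ t)) ≤ K * (t * dist x y)}
  have hS : Icc (0 : ℝ) 1 ⊆ S := by
    refine IsClosed.Icc_subset_of_forall_exists_gt ?_ ?_ ?_
    · refine IsClosed.inter (isClosed_le ?_ ?_) isClosed_Icc
      · exact continuous_const.dist (hcont.comp hγ)
      · fun_prop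
    · simp [S, γ]
    · rintro t ⟨ht, ht01⟩ b hb
      -- near `t`, the segment stays in the sets of the cover that contain `γ t`
      have hopen : IsOpen (⋃ i ∈ {i | γ t ∉ C i}, C i)ᶜ :=
        ((toFinite _).isClosed_biUnion fun i _ => hC i).isOpen_compl
      have hmem : γ t ∈ (⋃ i ∈ {i | γ t ∉ C i}, C i)ᶜ := by
        simp only [mem_compl_iff, mem_iUnion, not_exists]
        exact fun i hi h => hi h
      have hev : ∀ᶠ r in nhdsWithin t (Ioi t), γ r ∈ (⋃ i ∈ {i | γ t ∉ C i}, C i)ᶜ :=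
        (hγ.continuousAt.eventually (hopen.mem_nhds hmem)).filter_mono nhdsWithin_le_nhds
      obtain ⟨r, hr, hrb⟩ := (hev.and (Ioc_mem_nhdsGT hb)).exists
      refine ⟨r, ?_, hrb⟩
      obtain ⟨i, hi⟩ := mem_iUnion.1 (hcov.symm ▸ mem_univ (γ r))
      have hti : γ t ∈ C i := by
        by_contra h
        exact hr (mem_iUnion₂.2 ⟨i, h, hi⟩)
      have h1 := (hf i).dist_le_mul _ hti _ hi
      rw [hγd, abs_sub_comm, abs_of_pos (sub_pos.2 hrb.1)] at h1
      have h2 := dist_triangle (f x) (f (γ t)) (f (γ r))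
      have h3 : dist (f x) (f (γ t)) ≤ K * (t * dist x y) := ht
      change dist (f x) (f (γ r)) ≤ K * (r * dist x y)
      calc dist (f x) (f (γ r)) ≤ K * (t * dist x y) + K * ((r - t) * dist x y) := by linarith
        _ = K * (r * dist x y) := by ring
  have := hS (right_mem_Icc.2 zero_le_one)
  simpa [S, γ] using this

/-- A homeomorphism that is Lipschitz together with its inverse, with unspecified constants. -/
def IsBiLipschitz {n : ℕ} (H : E n ≃ₜ E n) : Prop :=
  (∃ L : NNReal, LipschitzWith L H) ∧ ∃ L : NNReal, LipschitzWith L H.symm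

lemma IsBiLipschitz.symm {n : ℕ} {H : E n ≃ₜ E n} (h : IsBiLipschitz H) :
    IsBiLipschitz H.symm := ⟨h.2, h.1⟩

lemma IsBiLipschitz.trans {n : ℕ} {H H' : E n ≃ₜ E n} (h : IsBiLipschitz H)
    (h' : IsBiLipschitz H') : IsBiLipschitz (H.trans H') := by
  obtain ⟨⟨L₁, h₁⟩, L₂, h₂⟩ := h
  obtain ⟨⟨L₃, h₃⟩, L₄, h₄⟩ := h'
  exact ⟨⟨_, h₃.comp h₁⟩, _, h₂.comp h₄⟩

lemma half_lt_inv_nnnorm_refl (n : ℕ) : Subsingleton (E n) ∨ (1 / 2 : NNReal) <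
      ‖((ContinuousLinearEquiv.refl ℝ (E n)).symm : E n →L[ℝ] E n)‖₊⁻¹ := by
  rcases subsingleton_or_nontrivial (E n) with h | h
  · exact Or.inl h
  · right
    have h1 : ‖((ContinuousLinearEquiv.refl ℝ (E n)).symm : E n →L[ℝ] E n)‖₊ = 1 := by
      ext
      simp
    rw [h1, inv_one]
    exact NNReal.half_lt_self one_ne_zero

/-- A perturbation of the identity with Lipschitz constant `1 / 2` is a bi-Lipschitz
homeomorphism. -/
lemma exists_homeomorph_of_lipschitz_sub_id {n : ℕ} {f : E n → E n}
    (hf : LipschitzWith (1 / 2) fun x => f x - x) :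
    ∃ H : E n ≃ₜ E n, (∀ x, H x = f x) ∧ IsBiLipschitz H := by
  have happ : ApproximatesLinearOn f
      (ContinuousLinearEquiv.refl ℝ (E n) : E n →L[ℝ] E n) univ (1 / 2) := by
    exact LipschitzOnWith.approximatesLinearOn (hf.lipschitzOnWith (s := univ))
  have hc := half_lt_inv_nnnorm_refl n
  refine ⟨happ.toHomeomorph f hc, fun x => rfl, ⟨1 / 2 + 1, ?_⟩, 2, ?_⟩
  · have := hf.add LipschitzWith.id
    simp only [id, sub_add_cancel] at this
    exact this
  · refine LipschitzWith.of_dist_le_mul fun y z => ?_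
    obtain ⟨a, rfl⟩ := (happ.toHomeomorph f hc).surjective y
    obtain ⟨b, rfl⟩ := (happ.toHomeomorph f hc).surjective z
    rw [Homeomorph.symm_apply_apply, Homeomorph.symm_apply_apply]
    change dist a b ≤ _ * dist (f a) (f b)
    have h1 := hf.dist_le_mul a b
    rw [dist_eq_norm, dist_eq_norm] at *
    have h2 : a - b = (f a - f b) - ((f a - a) - (f b - b)) := by abel
    have h3 := norm_sub_le (f a - f b) ((f a - a) - (f b - b))
    rw [← h2] at h3
    norm_num at h1 ⊢
    linarith

/-! ### Lipschitz hypersurfaces -/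

lemma IsLipschitzHypersurface.image {n : ℕ} {S : Set (E n)} (hS : IsLipschitzHypersurface S)
    {H : E n ≃ₜ E n} (hH : IsBiLipschitz H) : IsLipschitzHypersurface (H '' S) := by
  rintro _ ⟨p, hp, rfl⟩
  obtain ⟨φ, L, l, hpφ, hL, hL', hl, hiff⟩ := hS p hp
  obtain ⟨⟨L₁, h₁⟩, L₂, h₂⟩ := hH
  refine ⟨H.symm.toOpenPartialHomeomorph.trans φ, max (L * L₂) (L₁ * L), l, ?_, ?_, ?_, hl, ?_⟩
  · simpa using hpφ
  · refine LipschitzOnWith.weaken ?_ (le_max_left _ _)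
    refine hL.comp (h₂.lipschitzOnWith (s := _)) ?_
    intro x hx
    simpa using hx
  · refine LipschitzOnWith.weaken ?_ (le_max_right _ _)
    refine (h₁.lipschitzOnWith (s := univ)).comp (hL'.mono ?_) (mapsTo_univ _ _)
    intro x hx
    simpa using hx
  · intro x hx
    have hx' : H.symm x ∈ φ.source := by simpa using hx
    have := hiff _ hx'
    simp only [OpenPartialHomeomorph.coe_trans, Function.comp_apply,
      Homeomorph.toOpenPartialHomeomorph_apply]
    rw [← this]
    constructor
    · rintro ⟨y, hy, rfl⟩
      simpa using hy
    · exact fun h => ⟨_, h, by simp⟩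

/-- A `C^1` level set with non-vanishing differential is straightened by a map with derivative
the identity, which is bi-Lipschitz near the base point. -/
lemma IsClosedHypersurface.isLipschitzHypersurface {n r : ℕ} (hr : 1 ≤ r) {Γ : Set (E n)}
    (hΓ : IsClosedHypersurface r Γ) : IsLipschitzHypersurface Γ := by
  intro p hp
  obtain ⟨U, hU, hpU, φ, hφ, hd, hset⟩ := hΓ.locally_level_set p hp
  set l := fderiv ℝ φ p with hl
  obtain ⟨w, hw⟩ : ∃ w, l w = 1 := by
    obtain ⟨v, hv⟩ : ∃ v, l v ≠ 0 := by
      by_contra! h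
      exact hd p hpU (ContinuousLinearMap.ext h)
    exact ⟨(l v)⁻¹ • v, by simp [hv]⟩
  -- `l (f x) = φ x`, so `f` maps the level set onto the hyperplane `l = 0`
  let f : E n → E n := fun x => x - p + (φ x - l (x - p)) • w
  have hstrict : HasStrictFDerivAt φ l p := by
    refine ((hφ.contDiffAt (hU.mem_nhds hpU)).hasStrictFDerivAt ?_)
    have : r ≠ 0 := by omega
    exact_mod_cast this
  have hf : HasStrictFDerivAt f
      ((ContinuousLinearEquiv.refl ℝ (E n)) : E n →L[ℝ] E n) p := by
    have h1 : HasStrictFDerivAt (fun x : E n => x - p) (ContinuousLinearMap.id ℝ (E n)) p :=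
      (hasStrictFDerivAt_id p).sub_const p
    have h2 := h1.add ((hstrict.sub (l.hasStrictFDerivAt.comp p h1)).smul_const w)
    refine h2.congr_fderiv ?_
    ext x
    simp
  have hc := half_lt_inv_nnnorm_refl n
  obtain ⟨s, hs, hsf⟩ := hf.approximates_deriv_on_nhds (c := 1 / 2) (Or.inr (by norm_num))
  obtain ⟨s', hs's, hs'o, hps'⟩ := mem_nhds_iff.1 (Filter.inter_mem hs (hU.mem_nhds hpU))
  have hsf' := hsf.mono_set fun x hx => (hs's hx).1
  have hlip : LipschitzOnWith (1 / 2) (fun x => f x - x) s' := by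
    exact hsf'.lipschitzOnWith
  refine ⟨hsf'.toOpenPartialHomeomorph f s' hc hs'o, max (1 / 2 + 1) 2, l, hps', ?_, ?_, ?_, ?_⟩
  · refine LipschitzOnWith.weaken (K := 1 / 2 + 1) ?_ (le_max_left _ _)
    have := hlip.add (LipschitzWith.id.lipschitzOnWith (s := s'))
    simpa using this
  · refine LipschitzOnWith.weaken (K := 2) ?_ (le_max_right _ _)
    refine LipschitzOnWith.of_dist_le_mul ?_
    set Φ := hsf'.toOpenPartialHomeomorph f s' hc hs'o with hΦ
    intro y hy z hz
    have ha := Φ.map_target hy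
    have hb := Φ.map_target hz
    have hfa : f (Φ.symm y) = y := Φ.right_inv hy
    have hfb : f (Φ.symm z) = z := Φ.right_inv hz
    generalize Φ.symm y = a at *
    generalize Φ.symm z = b at *
    have h1 := hlip.dist_le_mul a ha b hb
    rw [← hfa, ← hfb]
    rw [dist_eq_norm, dist_eq_norm] at *
    have h2 : a - b = (f a - f b) - ((f a - a) - (f b - b)) := by abel
    have h3 := norm_sub_le (f a - f b) ((f a - a) - (f b - b))
    rw [← h2] at h3
    norm_num at h1 ⊢
    linarith
  · intro h0
    rw [h0] at hw
    simp at hw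
  · intro x hx
    have hxU : x ∈ U := (hs's hx).2
    change x ∈ Γ ↔ l (f x) = 0
    have : l (f x) = φ x := by simp [f, hw]
    rw [this]
    constructor
    · intro hxΓ
      exact (hset.subset ⟨hxΓ, hxU⟩).2
    · intro h0
      exact (hset.superset ⟨hxU, h0⟩).1

lemma mem_closure_ball_inter_halfspace {n : ℕ} {l : E n →L[ℝ] ℝ} (hl : l ≠ 0) {c x : E n}
    {ε : ℝ} (hx : x ∈ Metric.ball c ε) (h0 : l x = 0) :
    x ∈ closure (Metric.ball c ε ∩ {y | 0 < l y}) := by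
  obtain ⟨w, hw⟩ : ∃ w, 0 < l w := by
    obtain ⟨v, hv⟩ : ∃ v, l v ≠ 0 := by
      by_contra! h
      exact hl (ContinuousLinearMap.ext h)
    rcases lt_or_gt_of_ne hv with h | h
    · exact ⟨-v, by rw [map_neg]; linarith⟩
    · exact ⟨v, h⟩
  have hc : Filter.Tendsto (fun t : ℝ => x + t • w) (nhdsWithin 0 (Ioi 0)) (nhds x) := by
    have : Continuous fun t : ℝ => x + t • w := by fun_prop
    simpa using (this.tendsto 0).mono_left nhdsWithin_le_nhds
  refine mem_closure_of_tendsto hc ?_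
  filter_upwards [hc (Metric.isOpen_ball.mem_nhds hx), self_mem_nhdsWithin] with t ht ht0
  refine ⟨ht, ?_⟩
  rw [mem_ofPred_eq, map_add, map_smul, h0, zero_add]
  exact mul_pos ht0 hw

/-- Near each of its points, a Lipschitz hypersurface has two connected sides. -/
lemma IsLipschitzHypersurface.exists_sides {n : ℕ} {S : Set (E n)}
    (hS : IsLipschitzHypersurface S) {p : E n} (hp : p ∈ S) :
    ∃ U V₁ V₂ : Set (E n), IsOpen U ∧ p ∈ U ∧ IsPreconnected V₁ ∧ IsPreconnected V₂ ∧
      U \ S = V₁ ∪ V₂ ∧ U ∩ S ⊆ closure V₁ ∧ U ∩ S ⊆ closure V₂ := by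
  obtain ⟨φ, L, l, hpφ, -, -, hl, hiff⟩ := hS p hp
  obtain ⟨ε, hε, hball⟩ := Metric.isOpen_iff.1 φ.open_target _ (φ.map_source hpφ)
  -- the sides are the preimages of two half balls
  obtain ⟨B, hB⟩ : ∃ B, B = Metric.ball (φ p) ε := ⟨_, rfl⟩
  rw [← hB] at hball
  have hBo : IsOpen B := hB ▸ Metric.isOpen_ball
  have hpB : φ p ∈ B := hB ▸ Metric.mem_ball_self hε
  have hside : ∀ l' : E n →L[ℝ] ℝ, IsPreconnected (φ.symm '' (B ∩ {y | 0 < l' y})) := by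
    intro l'
    refine IsPreconnected.image ?_ _ (φ.continuousOn_symm.mono (inter_subset_left.trans hball))
    rw [hB]
    exact ((convex_ball _ _).inter (convex_halfSpace_gt l'.toLinearMap.isLinear 0)).isPreconnected
  have hcl : ∀ l' : E n →L[ℝ] ℝ, l' ≠ 0 → (∀ y, l y = 0 → l' y = 0) →
      (φ.source ∩ φ ⁻¹' B) ∩ S ⊆ closure (φ.symm '' (B ∩ {y | 0 < l' y})) := by
    intro l' hl' hll x hx
    have hxs : x ∈ φ.source := hx.1.1
    have hxB : φ x ∈ B := hx.1.2
    have hxS : x ∈ S := hx.2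
    have h0 : l' (φ x) = 0 := hll _ ((hiff x hxs).1 hxS)
    have hmem : φ x ∈ closure (B ∩ {y | 0 < l' y}) := by
      rw [hB] at hxB ⊢
      exact mem_closure_ball_inter_halfspace hl' hxB h0
    have hcont : ContinuousWithinAt φ.symm (B ∩ {y | 0 < l' y}) (φ x) :=
      ((φ.continuousOn_symm _ (hball hxB)).mono (inter_subset_left.trans hball))
    have := hcont.mem_closure_image hmem
    rwa [φ.left_inv hxs] at this
  have hneg : ∀ y, (-l) y = -l y := fun y => rfl
  refine ⟨φ.source ∩ φ ⁻¹' B, φ.symm '' (B ∩ {y | 0 < l y}), φ.symm '' (B ∩ {y | 0 < (-l) y}),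
    φ.isOpen_inter_preimage hBo, ⟨hpφ, hpB⟩, hside l,
    hside (-l), ?_, hcl l hl fun y h => h,
    hcl (-l) (neg_ne_zero.2 hl) fun y h => by rw [hneg, h, neg_zero]⟩
  ext x
  constructor
  · rintro ⟨⟨hxs, hxB⟩, hxS⟩
    have h0 : l (φ x) ≠ 0 := fun h => hxS ((hiff x hxs).2 h)
    rcases lt_or_gt_of_ne h0 with h | h
    · exact Or.inr ⟨φ x, ⟨hxB, by rw [mem_ofPred_eq, hneg]; linarith⟩, φ.left_inv hxs⟩
    · exact Or.inl ⟨φ x, ⟨hxB, h⟩, φ.left_inv hxs⟩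
  · have key : ∀ y ∈ B, l y ≠ 0 → φ.symm y ∈ (φ.source ∩ φ ⁻¹' B) \ S := by
      intro y hy h0
      have hyt := hball hy
      refine ⟨⟨φ.map_target hyt, ?_⟩, fun hS' => h0 ?_⟩
      · rw [mem_preimage, φ.right_inv hyt]; exact hy
      · have := (hiff _ (φ.map_target hyt)).1 hS'
        rwa [φ.right_inv hyt] at this
    rintro (⟨y, ⟨hyB, hy⟩, rfl⟩ | ⟨y, ⟨hyB, hy⟩, rfl⟩)
    · exact key y hyB (ne_of_gt hy)
    · refine key y hyB (ne_of_lt ?_)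
      rw [mem_ofPred_eq, hneg] at hy
      linarith

/-! ### The nearest point map of a closed hypersurface -/

lemma nearestPoint_spec {n : ℕ} {Γ : Set (E n)} (hc : IsCompact Γ) (hne : Γ.Nonempty) (x : E n) :
    nearestPoint Γ x ∈ Γ ∧ dist x (nearestPoint Γ x) = Metric.infDist x Γ := by
  obtain ⟨y, hy, h⟩ := hc.exists_infDist_eq_dist hne x
  exact Classical.epsilon_spec (p := fun y => y ∈ Γ ∧ dist x y = Metric.infDist x Γ)
    ⟨y, hy, h.symm⟩

lemma nearestPoint_self {n : ℕ} {Γ : Set (E n)} (hc : IsCompact Γ) {x : E n} (hx : x ∈ Γ) :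
    nearestPoint Γ x = x := by
  have h := (nearestPoint_spec hc ⟨x, hx⟩ x).2
  rw [Metric.infDist_zero_of_mem hx] at h
  exact (dist_eq_zero.1 h).symm

/-- The Lagrange multiplier rule for a nearest point `q` on a level set: the connecting vector
is a multiple of the gradient `g` of the level function. -/
lemma exists_smul_gradient {n : ℕ} {Γ : Set (E n)} {φ : E n → ℝ} {U : Set (E n)}
    (hU : IsOpen U) (hset : Γ ∩ U = {x ∈ U | φ x = 0}) {x q g : E n} (hqU : q ∈ U)
    (hq : q ∈ Γ) (hmin : dist x q = Metric.infDist x Γ)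
    (hφ : HasStrictFDerivAt φ (innerSL ℝ g) q) (hg : g ≠ 0) : ∃ s : ℝ, x - q = s • g := by
  have hφq : φ q = 0 := (hset.subset ⟨hq, hqU⟩).2
  have hext : IsLocalExtrOn (fun y => ‖y - x‖ ^ 2) {y | φ y = φ q} q := by
    left
    have : ∀ᶠ y in nhdsWithin q {y | φ y = φ q}, y ∈ U ∧ φ y = φ q :=
      Filter.Eventually.and (nhdsWithin_le_nhds (hU.mem_nhds hqU)) self_mem_nhdsWithin
    filter_upwards [this] with y hy
    have hyΓ : y ∈ Γ := (hset.superset ⟨hy.1, hy.2.trans hφq⟩).1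
    have h1 : dist x q ≤ dist x y := hmin ▸ Metric.infDist_le_dist_of_mem hyΓ
    rw [dist_eq_norm, dist_eq_norm, ← norm_neg, neg_sub, ← norm_neg (x - y), neg_sub] at h1
    gcongr
  have hdist : HasStrictFDerivAt (fun y => ‖y - x‖ ^ 2) (2 • innerSL ℝ (q - x)) q := by
    have := (hasStrictFDerivAt_norm_sq (q - x)).comp q
      ((hasStrictFDerivAt_id (𝕜 := ℝ) q).sub_const x)
    exact this
  obtain ⟨a, b, hab, hsum⟩ := hext.exists_multipliers_of_hasStrictFDerivAt_1d hφ hdist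
  have hvec : a • g + (2 * b) • (q - x) = 0 := by
    refine ext_inner_right ℝ fun v => ?_
    have := congrArg (fun l : E n →L[ℝ] ℝ => l v) hsum
    simp only [add_apply, smul_apply,
      innerSL_apply_apply, zero_apply, smul_eq_mul, nsmul_eq_mul] at this
    rw [inner_add_left, real_inner_smul_left, real_inner_smul_left, inner_zero_left]
    push_cast at this
    linarith
  have hb : b ≠ 0 := by
    rintro rfl
    have ha : a ≠ 0 := fun h => hab (by rw [h]; rfl)
    simp [ha, hg] at hvec
  refine ⟨a / (2 * b), ?_⟩
  have h2 : (2 * b) • (x - q) = a • g := by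
    have := eq_neg_of_add_eq_zero_left hvec
    rw [this, ← smul_neg, neg_sub]
  have hb2 : (2 * b) ≠ 0 := mul_ne_zero two_ne_zero hb
  rw [div_eq_inv_mul, ← smul_smul, ← h2, smul_smul, inv_mul_cancel₀ hb2, one_smul]

/-- The nearest point map of a `C^{r+1}` hypersurface is `C^r` near the hypersurface. By the
multiplier rule, the nearest point `q` of `x` solves `(q + t ∇φ(q), φ(q)) = (x, 0)` with some
small `t`, and the map on the left is a local diffeomorphism. -/
lemma IsClosedHypersurface.contDiffAt_nearestPoint {n r : ℕ} (hr : 1 ≤ r) {Γ : Set (E n)}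
    (hΓ : IsClosedHypersurface (r + 1) Γ) {p : E n} (hp : p ∈ Γ) :
    ContDiffAt ℝ (r : WithTop ℕ∞) (nearestPoint Γ) p := by
  obtain ⟨U, hU, hpU, φ, hφ, hd, hset⟩ := hΓ.locally_level_set p hp
  have hr0 : (r : WithTop ℕ∞) ≠ 0 := by
    have : r ≠ 0 := by omega
    exact_mod_cast this
  have hr1 : ((r + 1 : ℕ) : WithTop ℕ∞) ≠ 0 := by
    have : r + 1 ≠ 0 := by omega
    exact_mod_cast this
  let g : E n → E n := fun x => (InnerProductSpace.toDual ℝ (E n)).symm (fderiv ℝ φ x)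
  have hgr : ∀ x, innerSL ℝ (g x) = fderiv ℝ φ x := fun x =>
    (InnerProductSpace.toDual ℝ (E n)).apply_symm_apply (fderiv ℝ φ x)
  have hg0 : ∀ x ∈ U, g x ≠ 0 := by
    intro x hx h0
    refine hd x hx ?_
    rw [← hgr, h0, map_zero]
  have hφat : ∀ x ∈ U, ContDiffAt ℝ ((r + 1 : ℕ) : WithTop ℕ∞) φ x := fun x hx =>
    hφ.contDiffAt (hU.mem_nhds hx)
  have hgC : ContDiffAt ℝ (r : WithTop ℕ∞) g p :=
    (InnerProductSpace.toDual ℝ (E n)).symm.contDiff.contDiffAt.comp p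
      ((hφat p hpU).fderiv_right (by norm_cast))
  -- the multiplier equations for `(q, t)` read `Φ (q, t) = (x, 0)`
  let Φ : E n × ℝ → E n × ℝ := fun z => (z.1 + z.2 • g z.1, φ z.1)
  have hΦ : ContDiffAt ℝ (r : WithTop ℕ∞) Φ (p, 0) := by
    have h1 : ContDiffAt ℝ (r : WithTop ℕ∞) (fun z : E n × ℝ => g z.1) (p, 0) :=
      ContDiffAt.comp (p, (0 : ℝ)) (g := g) hgC contDiffAt_fst
    have h2 : ContDiffAt ℝ (r : WithTop ℕ∞) (fun z : E n × ℝ => φ z.1) (p, 0) := by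
      refine ContDiffAt.comp (p, (0 : ℝ)) (g := φ) ?_ contDiffAt_fst
      refine (hφat p hpU).of_le ?_
      norm_cast
      omega
    exact (contDiffAt_fst.add (contDiffAt_snd.smul h1)).prodMk h2
  let l : E n →L[ℝ] ℝ := fderiv ℝ φ p
  let A : E n × ℝ →L[ℝ] E n × ℝ :=
    (ContinuousLinearMap.fst ℝ (E n) ℝ +
      (ContinuousLinearMap.snd ℝ (E n) ℝ).smulRight (g p)).prod
      (l.comp (ContinuousLinearMap.fst ℝ (E n) ℝ))
  have hA : ∀ v t, A (v, t) = (v + t • g p, inner ℝ (g p) v) := by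
    intro v t
    have : l v = inner ℝ (g p) v := by rw [← innerSL_apply_apply ℝ, hgr]
    simp [A, this]
  have hAinj : Function.Injective (A : E n × ℝ →ₗ[ℝ] E n × ℝ) := by
    rw [← LinearMap.ker_eq_bot, LinearMap.ker_eq_bot']
    rintro ⟨v, t⟩ h
    have h' : A (v, t) = 0 := h
    rw [hA, Prod.mk_eq_zero] at h'
    have hv : v = -(t • g p) := eq_neg_of_add_eq_zero_left h'.1
    have ht : t = 0 := by
      have h2 := h'.2
      rw [hv, inner_neg_right, real_inner_smul_right, real_inner_self_eq_norm_sq, neg_eq_zero,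
        mul_eq_zero] at h2
      refine h2.resolve_right (pow_ne_zero _ (norm_ne_zero_iff.2 (hg0 p hpU)))
    rw [ht, zero_smul, neg_zero] at hv
    rw [hv, ht]
    rfl
  let Ae : (E n × ℝ) ≃L[ℝ] (E n × ℝ) :=
    (LinearEquiv.ofInjectiveEndo (A : E n × ℝ →ₗ[ℝ] E n × ℝ) hAinj).toContinuousLinearEquiv
  have hAe : (Ae : (E n × ℝ) →L[ℝ] (E n × ℝ)) = A := by
    ext z <;> rfl
  have hΦd : HasFDerivAt Φ (Ae : (E n × ℝ) →L[ℝ] (E n × ℝ)) (p, 0) := by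
    rw [hAe]
    have hg1 : HasFDerivAt g (fderiv ℝ g p) p := (hgC.differentiableAt hr0).hasFDerivAt
    have hφ1 : HasFDerivAt φ l p := ((hφat p hpU).differentiableAt hr1).hasFDerivAt
    have hf : HasFDerivAt (fun z : E n × ℝ => z.1) (ContinuousLinearMap.fst ℝ (E n) ℝ) (p, 0) :=
      hasFDerivAt_fst
    have hs : HasFDerivAt (fun z : E n × ℝ => z.2) (ContinuousLinearMap.snd ℝ (E n) ℝ) (p, 0) :=
      hasFDerivAt_snd
    have h1 := hs.smul (HasFDerivAt.comp (p, (0 : ℝ)) (g := g) hg1 hf)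
    have h2 := HasFDerivAt.comp (p, (0 : ℝ)) (g := φ) hφ1 hf
    refine ((hf.add h1).prodMk h2).congr_fderiv ?_
    ext z <;> simp [A]
  -- the pairs `(q, t)` of nearest point and multiplier converge to `(p, 0)`
  let q := nearestPoint Γ
  let t : E n → ℝ := fun x => inner ℝ (x - q x) (g (q x)) / ‖g (q x)‖ ^ 2
  have hspec := nearestPoint_spec hΓ.isCompact ⟨p, hp⟩
  have hqp : Filter.Tendsto q (nhds p) (nhds p) := by
    rw [Metric.tendsto_nhds_nhds]
    intro ε hε
    refine ⟨ε / 2, half_pos hε, fun {x} hx => ?_⟩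
    have h1 : dist x (q x) ≤ dist x p := (hspec x).2 ▸ Metric.infDist_le_dist_of_mem hp
    have h2 := dist_triangle_left (q x) p x
    linarith
  have hgq : Filter.Tendsto (fun x => g (q x)) (nhds p) (nhds (g p)) :=
    hgC.continuousAt.tendsto.comp hqp
  have htp : Filter.Tendsto t (nhds p) (nhds 0) := by
    have h1 : Filter.Tendsto (fun x => x - q x) (nhds p) (nhds 0) := by
      simpa using Filter.tendsto_id.sub hqp
    have h2 := (h1.inner hgq).div (hgq.norm.pow 2)
      (pow_ne_zero _ (norm_ne_zero_iff.2 (hg0 p hpU)))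
    rw [inner_zero_left, zero_div] at h2
    exact h2
  have hqt : Filter.Tendsto (fun x => (q x, t x)) (nhds p) (nhds (p, 0)) := hqp.prodMk_nhds htp
  have hinv : ∀ᶠ z in nhds (p, (0 : ℝ)), hΦ.localInverse hΦd hr0 (Φ z) = z :=
    (hΦ.hasStrictFDerivAt' hΦd hr0).eventually_left_inverse
  -- hence the local inverse of `Φ` finds them
  have heq : ∀ᶠ x in nhds p, (hΦ.localInverse hΦd hr0 (x, 0)).1 = q x := by
    filter_upwards [hqt.eventually hinv, hqp.eventually (hU.mem_nhds hpU)] with x hx hxU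
    obtain ⟨s, hs⟩ := exists_smul_gradient hU hset hxU (hspec x).1 (hspec x).2
      (by rw [hgr]; exact (hφat _ hxU).hasStrictFDerivAt hr1) (hg0 _ hxU)
    have hts : t x = s := by
      have hpos : ‖g (q x)‖ ^ 2 ≠ 0 := pow_ne_zero _ (norm_ne_zero_iff.2 (hg0 _ hxU))
      simp only [t]
      rw [show x - q x = s • g (q x) from hs, real_inner_smul_left, real_inner_self_eq_norm_sq,
        mul_div_assoc, div_self hpos, mul_one]
    have hΦx : Φ (q x, t x) = (x, 0) := by
      have hφ0 : φ (q x) = 0 := (hset.subset ⟨(hspec x).1, hxU⟩).2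
      simp only [Φ, hts]
      rw [hφ0, show s • g (q x) = x - q x from hs.symm, add_sub_cancel]
    rw [hΦx] at hx
    rw [hx]
  have hΦp : Φ (p, 0) = (p, 0) := by
    have hφ0 : φ p = 0 := (hset.subset ⟨hp, hpU⟩).2
    simp [Φ, hφ0]
  have hli := hΦ.to_localInverse hΦd hr0
  rw [hΦp] at hli
  have hcomp : ContDiffAt ℝ (r : WithTop ℕ∞)
      (fun x : E n => (hΦ.localInverse hΦd hr0 (x, 0)).1) p :=
    contDiffAt_fst.comp p (ContDiffAt.comp p (by exact hli)
      (contDiffAt_id.prodMk contDiffAt_const))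
  exact hcomp.congr_of_eventuallyEq (heq.mono fun x hx => hx.symm)

/-- Uniformly near the hypersurface, the nearest point map is `C^r` and its derivative is
Lipschitz continuous. -/
lemma IsClosedHypersurface.exists_uniform_tube {n r : ℕ} (hr : 2 ≤ r) {Γ : Set (E n)}
    (hΓ : IsClosedHypersurface (r + 1) Γ) : ∃ δ > 0, ∃ M ≥ 0, ∀ p ∈ Γ,
      (∀ x ∈ Metric.ball p δ, ContDiffAt ℝ (r : WithTop ℕ∞) (nearestPoint Γ) x) ∧
      ∀ x ∈ Metric.ball p δ, ∀ y ∈ Metric.ball p δ,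
        ‖fderiv ℝ (fun z => nearestPoint Γ z - z) x - fderiv ℝ (fun z => nearestPoint Γ z - z) y‖
          ≤ M * ‖x - y‖ := by
  refine hΓ.isCompact.induction_on (p := fun S => ∃ δ > 0, ∃ M ≥ 0, ∀ p ∈ S,
      (∀ x ∈ Metric.ball p δ, ContDiffAt ℝ (r : WithTop ℕ∞) (nearestPoint Γ) x) ∧
      ∀ x ∈ Metric.ball p δ, ∀ y ∈ Metric.ball p δ,
        ‖fderiv ℝ (fun z => nearestPoint Γ z - z) x - fderiv ℝ (fun z => nearestPoint Γ z - z) y‖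
          ≤ M * ‖x - y‖) ?_ ?_ ?_ ?_
  · exact ⟨1, one_pos, 0, le_rfl, fun p hp => absurd hp (Set.notMem_empty p)⟩
  · rintro S T hST ⟨δ, hδ, M, hM, h⟩
    exact ⟨δ, hδ, M, hM, fun p hp => h p (hST hp)⟩
  · rintro S T ⟨δ, hδ, M, hM, h⟩ ⟨δ', hδ', M', hM', h'⟩
    have hb : ∀ p : E n, Metric.ball p (min δ δ') ⊆ Metric.ball p δ := fun p =>
      Metric.ball_subset_ball (min_le_left _ _)
    have hb' : ∀ p : E n, Metric.ball p (min δ δ') ⊆ Metric.ball p δ' := fun p =>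
      Metric.ball_subset_ball (min_le_right _ _)
    refine ⟨min δ δ', lt_min hδ hδ', max M M', le_max_of_le_left hM, ?_⟩
    rintro p (hp | hp)
    · refine ⟨fun x hx => (h p hp).1 x (hb p hx), fun x hx y hy => ?_⟩
      refine ((h p hp).2 x (hb p hx) y (hb p hy)).trans ?_
      gcongr
      exact le_max_left _ _
    · refine ⟨fun x hx => (h' p hp).1 x (hb' p hx), fun x hx y hy => ?_⟩
      refine ((h' p hp).2 x (hb' p hx) y (hb' p hy)).trans ?_
      gcongr
      exact le_max_right _ _
  · intro p hp
    have hC := hΓ.contDiffAt_nearestPoint (by omega) hp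
    have hu : ContDiffAt ℝ 1 (fderiv ℝ fun z => nearestPoint Γ z - z) p := by
      refine (hC.sub contDiffAt_id).fderiv_right (m := 1) ?_
      norm_cast
    obtain ⟨K, t, ht, hK⟩ := hu.exists_lipschitzOnWith
    have hev := hC.eventually (by simp)
    obtain ⟨ε, hε, hball⟩ := Metric.mem_nhds_iff.1 (Filter.inter_mem ht hev)
    refine ⟨Metric.ball p (ε / 2), mem_nhdsWithin_of_mem_nhds (Metric.ball_mem_nhds p
      (half_pos hε)), ε / 2, half_pos hε, K, K.2, fun q hq => ?_⟩
    have hsub : Metric.ball q (ε / 2) ⊆ Metric.ball p ε := by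
      refine Metric.ball_subset_ball' ?_
      have := Metric.mem_ball.1 hq
      linarith
    refine ⟨fun x hx => (hball (hsub hx)).2, fun x hx y hy => ?_⟩
    exact hK.norm_sub_le (hball (hsub hx)).1 (hball (hsub hy)).1

/-! ### Functions that vanish at the vertices of a face -/

/-- A function with Lipschitz derivative that vanishes at points `a i` at mutual distance at most
`D` is `O(D²)`-Lipschitz in the barycentric coordinates with respect to these points: the
derivative in the direction of the differences `a i - a j` is `O(D²)`, since the mean value
of that derivative between `a j` and `a i` is zero. -/
lemma norm_sub_le_of_vanishing {n : ℕ} {ι : Type*} {u : E n → E n} {H : Set (E n)}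
    (hH : Convex ℝ H) (hd : ∀ x ∈ H, DifferentiableAt ℝ u x) {M D : ℝ} (hM0 : 0 ≤ M)
    (hM : ∀ x ∈ H, ∀ y ∈ H, ‖fderiv ℝ u x - fderiv ℝ u y‖ ≤ M * ‖x - y‖)
    (hD : ∀ x ∈ H, ∀ y ∈ H, ‖x - y‖ ≤ D) {S : Finset ι} {a : ι → E n}
    (ha : ∀ i ∈ S, a i ∈ H) (hu : ∀ i ∈ S, u (a i) = 0) {w w' : ι → ℝ}
    (hw : ∀ i ∈ S, 0 ≤ w i) (hw' : ∀ i ∈ S, 0 ≤ w' i) (hws : ∑ i ∈ S, w i = 1)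
    (hws' : ∑ i ∈ S, w' i = 1) :
    ‖u (∑ i ∈ S, w i • a i) - u (∑ i ∈ S, w' i • a i)‖ ≤ M * D ^ 2 * ∑ i ∈ S, |w i - w' i| := by
  obtain ⟨i₀, hi₀⟩ : S.Nonempty := by
    rw [Finset.nonempty_iff_ne_empty]
    rintro rfl
    simp at hws
  have hD0 : 0 ≤ D := (norm_nonneg _).trans (hD _ (ha _ hi₀) _ (ha _ hi₀))
  -- `u` vanishes at `a i` and `a i₀`, so its derivative along the edge is as small as the
  -- oscillation of `fderiv ℝ u`
  have hdir : ∀ y ∈ H, ∀ i ∈ S, ‖fderiv ℝ u y (a i - a i₀)‖ ≤ M * D ^ 2 := by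
    intro y hy i hi
    have h := hH.norm_image_sub_le_of_norm_fderiv_le' (f := u) (φ := fderiv ℝ u y) (C := M * D)
      hd (fun x hx => (hM x hx y hy).trans
        (mul_le_mul_of_nonneg_left (hD x hx y hy) hM0)) (ha _ hi₀) (ha _ hi)
    rw [hu _ hi, hu _ hi₀, sub_zero, zero_sub, norm_neg] at h
    calc _ ≤ M * D * ‖a i - a i₀‖ := h
      _ ≤ M * D * D := by
        gcongr
        exact hD _ (ha _ hi) _ (ha _ hi₀)
      _ = M * D ^ 2 := by ring
  set x := ∑ i ∈ S, w i • a i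
  set x' := ∑ i ∈ S, w' i • a i
  have hx : x ∈ H := hH.sum_mem hw hws ha
  have hx' : x' ∈ H := hH.sum_mem hw' hws' ha
  have hdiff : x - x' = ∑ i ∈ S, (w i - w' i) • (a i - a i₀) := by
    simp only [smul_sub, sub_smul, Finset.sum_sub_distrib, ← Finset.sum_smul, hws, hws', x, x']
    abel
  have hseg : ∀ t ∈ Icc (0 : ℝ) 1, x' + t • (x - x') ∈ H := fun t ht =>
    hH.add_smul_sub_mem hx' hx ht
  have hder : ∀ t ∈ Icc (0 : ℝ) 1, HasDerivWithinAt (fun t : ℝ => u (x' + t • (x - x')))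
      (fderiv ℝ u (x' + t • (x - x')) (x - x')) (Icc 0 1) t := by
    intro t ht
    have h1 : HasDerivAt (fun t : ℝ => x' + t • (x - x')) (x - x') t := by
      simpa using ((hasDerivAt_id t).smul_const (x - x')).const_add x'
    exact ((hd _ (hseg t ht)).hasFDerivAt.comp_hasDerivAt t h1).hasDerivWithinAt
  have := norm_image_sub_le_of_norm_deriv_le_segment_01' hder
    (C := M * D ^ 2 * ∑ i ∈ S, |w i - w' i|) fun t ht => ?_
  · simpa using this
  · have hy := hseg t ⟨ht.1, ht.2.le⟩
    generalize x' + t • (x - x') = y at hy ⊢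
    rw [hdiff, map_sum, Finset.mul_sum]
    refine norm_sum_le_of_le _ fun i hi => ?_
    rw [map_smul, norm_smul, mul_comm, Real.norm_eq_abs]
    exact mul_le_mul_of_nonneg_right (hdir y hy i hi) (abs_nonneg _)

/-! ### Barycentric coordinates of the mesh simplices -/

lemma coord_vertexMap {d : ℕ} (T : Simplex d) (x : E d) (j : Fin (d + 1)) :
    T.coord j (vertexMap T x) = refBary d j x := by
  rw [vertexMap_eq_affineCombination]
  exact T.coord_apply_combination_of_mem (Finset.mem_univ j) (sum_refBary x)

lemma vertexMap_refPoint_coord {d : ℕ} (T : Simplex d) (z : E d) :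
    vertexMap T (refPoint fun j => T.coord j z) = z := by
  simp only [vertexMap, refBary_refPoint (T.sum_coord_apply_eq_one z)]
  exact T.linear_combination_coord_eq_self z

lemma body_eq {d : ℕ} (T : Simplex d) : body T = {z | ∀ j, 0 ≤ T.coord j z} :=
  T.convexHull_eq_nonneg_coord

lemma mem_face_iff {d : ℕ} (T : Simplex d) (s : Finset (Fin (d + 1))) (z : E d) :
    z ∈ face T s ↔ z ∈ body T ∧ ∀ j, j ∉ s → T.coord j z = 0 := by
  rw [face, mem_convexHull_image_iff, body_eq]
  constructor
  · rintro ⟨x, hx, rfl⟩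
    exact ⟨fun j => by rw [coord_vertexMap]; exact hx.1 j,
      fun j hj => by rw [coord_vertexMap]; exact hx.2 j hj⟩
  · rintro ⟨h1, h2⟩
    refine ⟨_, ⟨fun j => ?_, fun j hj => ?_⟩, vertexMap_refPoint_coord T z⟩
    · rw [refBary_refPoint (T.sum_coord_apply_eq_one z)]; exact h1 j
    · rw [refBary_refPoint (T.sum_coord_apply_eq_one z)]; exact h2 j hj

lemma face_subset_body {d : ℕ} (T : Simplex d) (s : Finset (Fin (d + 1))) :
    face T s ⊆ body T := fun _ hz => ((mem_face_iff T s _).1 hz).1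

lemma image_refMap {d : ℕ} (T : Simplex d) : refMap T '' refSimplex d = body T :=
  image_refSimplex T

lemma vertexMap_mem_body {d : ℕ} (T : Simplex d) {x : E d} (hx : x ∈ refSimplex d) :
    vertexMap T x ∈ body T := image_refMap T ▸ mem_image_of_mem (refMap T) hx

lemma vertex_mem_body {d : ℕ} (T : Simplex d) (j : Fin (d + 1)) : T j ∈ body T :=
  subset_convexHull ℝ _ (mem_range_self j)

lemma convex_body {d : ℕ} (T : Simplex d) : Convex ℝ (body T) := convex_convexHull ℝ _

lemma isCompact_body {d : ℕ} (T : Simplex d) : IsCompact (body T) :=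
  (finite_range T).isCompact_convexHull ℝ

lemma isClosed_body {d : ℕ} (T : Simplex d) : IsClosed (body T) := (isCompact_body T).isClosed

lemma interior_body {d : ℕ} (T : Simplex d) :
    interior (body T) = {z | ∀ j, 0 < T.coord j z} := T.interior_convexHull

lemma interior_body_nonempty {d : ℕ} (T : Simplex d) : (interior (body T)).Nonempty := by
  obtain ⟨x, hx⟩ := refInterior_nonempty d
  refine ⟨vertexMap T x, ?_⟩
  rw [interior_body]
  intro j
  rw [coord_vertexMap]
  exact hx j

lemma closure_interior_body {d : ℕ} (T : Simplex d) : closure (interior (body T)) = body T := by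
  rw [(convex_body T).closure_interior_eq_closure_of_nonempty_interior
    (interior_body_nonempty T), (isClosed_body T).closure_eq]

lemma coord_le_one {d : ℕ} {T : Simplex d} {z : E d} (hz : z ∈ body T) (j : Fin (d + 1)) :
    T.coord j z ≤ 1 := by
  rw [body_eq] at hz
  rw [← T.sum_coord_apply_eq_one z]
  exact Finset.single_le_sum (f := fun j => T.coord j z) (fun i _ => hz i) (Finset.mem_univ j)

/-- The differential of a barycentric coordinate. -/
def coordLin {d : ℕ} (T : Simplex d) (j : Fin (d + 1)) : E d →L[ℝ] ℝ :=
  LinearMap.toContinuousLinearMap (T.coord j).linear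

lemma coord_sub {d : ℕ} (T : Simplex d) (j : Fin (d + 1)) (x y : E d) :
    T.coord j x - T.coord j y = coordLin T j (x - y) :=
  ((T.coord j).linearMap_vsub x y).symm

lemma hasFDerivAt_coord {d : ℕ} (T : Simplex d) (j : Fin (d + 1)) (x : E d) :
    HasFDerivAt (T.coord j) (coordLin T j) x := by
  have h : (T.coord j : E d → ℝ) = fun z => coordLin T j z + T.coord j 0 := by
    ext z
    have := coord_sub T j z 0
    rw [sub_zero] at this
    linarith
  rw [h]
  exact (coordLin T j).hasFDerivAt.add_const _

lemma contDiff_coord {d : ℕ} {n : WithTop ℕ∞} (T : Simplex d) (j : Fin (d + 1)) :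
    ContDiff ℝ n (T.coord j) := by
  have h : (T.coord j : E d → ℝ) = fun z => coordLin T j z + T.coord j 0 := by
    ext z
    have := coord_sub T j z 0
    rw [sub_zero] at this
    linarith
  rw [h]
  exact (coordLin T j).contDiff.add contDiff_const

/-- An inscribed ball of radius `r` bounds the differentials of the barycentric coordinates. -/
lemma norm_coordLin_le {d : ℕ} {T : Simplex d} {c : E d} {r : ℝ} (hr : 0 < r)
    (hball : Metric.closedBall c r ⊆ body T) (j : Fin (d + 1)) : ‖coordLin T j‖ ≤ r⁻¹ := by
  refine ContinuousLinearMap.opNorm_le_bound _ (by positivity) fun v => ?_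
  rcases eq_or_ne v 0 with rfl | hv
  · simp
  have hv' : 0 < ‖v‖ := norm_pos_iff.2 hv
  have hmem : c + (r / ‖v‖) • v ∈ body T := by
    refine hball ?_
    rw [Metric.mem_closedBall, dist_eq_norm, add_sub_cancel_left, norm_smul, norm_div, norm_norm,
      Real.norm_of_nonneg hr.le, div_mul_cancel₀ _ hv'.ne']
  have hc : c ∈ body T := hball (Metric.mem_closedBall_self hr.le)
  have h1 := coord_sub T j (c + (r / ‖v‖) • v) c
  rw [add_sub_cancel_left, map_smul, smul_eq_mul] at h1
  have h2 := coord_le_one hmem j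
  have h3 := coord_le_one hc j
  rw [body_eq] at hmem hc
  have h4 := hmem j
  have h5 := hc j
  have h6 : |r / ‖v‖ * coordLin T j v| ≤ 1 := by
    rw [← h1, abs_le]
    constructor <;> linarith
  rw [abs_mul, abs_of_pos (by positivity)] at h6
  rw [Real.norm_eq_abs]
  rw [div_mul_eq_mul_div, div_le_one hv'] at h6
  rw [inv_mul_eq_div, le_div_iff₀ hr]
  linarith

lemma abs_coord_sub_le {d : ℕ} {T : Simplex d} {c : E d} {r : ℝ} (hr : 0 < r)
    (hball : Metric.closedBall c r ⊆ body T) (j : Fin (d + 1)) (x y : E d) :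
    |T.coord j x - T.coord j y| ≤ r⁻¹ * ‖x - y‖ := by
  rw [coord_sub, ← Real.norm_eq_abs]
  exact (coordLin T j).le_of_opNorm_le (norm_coordLin_le hr hball j) _

/-! ### Vertex sums on common faces -/

/-- Two simplices meet in a common face. -/
def MeetInFace {d : ℕ} (T T' : Simplex d) : Prop :=
  ∃ s t : Finset (Fin (d + 1)), body T ∩ body T' = face T s ∧ face T s = face T' t

lemma MeetInFace.symm {d : ℕ} {T T' : Simplex d} (h : MeetInFace T T') : MeetInFace T' T := by
  obtain ⟨s, t, h1, h2⟩ := h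
  exact ⟨t, s, by rw [inter_comm, h1, h2], h2.symm⟩

/-- The piecewise affine interpolant of a function is well defined on common faces. -/
lemma MeetInFace.sum_coord_smul_eq {d : ℕ} {T T' : Simplex d} (h : MeetInFace T T') {x : E d}
    (hx : x ∈ body T) (hx' : x ∈ body T') {W : Type*} [AddCommGroup W] [Module ℝ W]
    (f : E d → W) : ∑ j, T'.coord j x • f (T' j) = ∑ i, T.coord i x • f (T i) := by
  obtain ⟨s, t, hs, hst⟩ := h
  have hxs := (mem_face_iff T s x).1 (hs ▸ ⟨hx, hx'⟩)
  choose! σ hσ using fun i (hi : i ∈ s) => exists_vertex_eq T.ind hst hi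
  have hsum : ∑ i ∈ s, T.coord i x = 1 := by
    rw [← T.sum_coord_apply_eq_one x]
    exact Finset.sum_subset (Finset.subset_univ s) fun i _ hi => hxs.2 i hi
  have hxsum : x = ∑ i ∈ s, T.coord i x • T i := by
    conv_lhs => rw [← T.linear_combination_coord_eq_self x]
    refine (Finset.sum_subset (Finset.subset_univ s) fun i _ hi => ?_).symm
    rw [hxs.2 i hi, zero_smul]
  have hcoord : ∀ j, T'.coord j x = ∑ i ∈ s, T.coord i x * if j = σ i then 1 else 0 := by
    intro j
    have h1 : x = s.affineCombination ℝ T fun i => T.coord i x := by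
      rw [Finset.affineCombination_eq_linear_combination _ _ _ hsum]
      exact hxsum
    conv_lhs => rw [h1]
    rw [Finset.map_affineCombination _ _ _ hsum,
      Finset.affineCombination_eq_linear_combination _ _ _ hsum]
    refine Finset.sum_congr rfl fun i hi => ?_
    rw [smul_eq_mul, Function.comp_apply, ← (hσ i hi).2, T'.coord_apply]
  have hright : ∑ i, T.coord i x • f (T i) = ∑ i ∈ s, T.coord i x • f (T i) := by
    refine (Finset.sum_subset (Finset.subset_univ s) fun i _ hi => ?_).symm
    rw [hxs.2 i hi, zero_smul]
  rw [hright]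
  simp only [hcoord, Finset.sum_smul]
  rw [Finset.sum_comm]
  refine Finset.sum_congr rfl fun i hi => ?_
  rw [Finset.sum_eq_single (σ i) (fun j _ hj => by simp [hj]) (by simp)]
  simp [(hσ i hi).2]

/-! ### The map `Ψ` on one simplex -/

/-- The unnormalized sum `∑ μ_j a_j` over the vertices on the interface. -/
def interfaceSum {d : ℕ} (Γ : Set (E d)) (T : Simplex d) (x : E d) : E d :=
  ∑ j ∈ onInterface Γ T, T.coord j x • T j

lemma mem_onInterface {d : ℕ} {Γ : Set (E d)} {T : Simplex d} {j : Fin (d + 1)} :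
    j ∈ onInterface Γ T ↔ T j ∈ Γ := by simp [onInterface]

lemma yPoint_eq {d : ℕ} (Γ : Set (E d)) (T : Simplex d) (x : E d) :
    yPoint Γ T x = (muTilde Γ T x)⁻¹ • interfaceSum Γ T x := by
  simp only [yPoint, interfaceSum, Finset.smul_sum, smul_smul, div_eq_inv_mul]

lemma psiOn_of_card_lt {d k : ℕ} {Γ : Set (E d)} {T : Simplex d}
    (h : ¬ 2 ≤ (onInterface Γ T).card) (x : E d) : psiOn k Γ T x = x := by
  simp [psiOn, h]

lemma psiOn_of_card {d k : ℕ} {Γ : Set (E d)} {T : Simplex d}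
    (h : 2 ≤ (onInterface Γ T).card) (x : E d) : psiOn k Γ T x = x + muTilde Γ T x ^ (k + 2) •
      (nearestPoint Γ (yPoint Γ T x) - yPoint Γ T x) := by
  by_cases hμ : muTilde Γ T x = 0 <;> simp [psiOn, h, hμ]

lemma muTilde_nonneg {d : ℕ} {Γ : Set (E d)} {T : Simplex d} {x : E d} (hx : x ∈ body T) :
    0 ≤ muTilde Γ T x := by
  rw [body_eq] at hx
  exact Finset.sum_nonneg fun j _ => hx j

lemma muTilde_le_one {d : ℕ} {Γ : Set (E d)} {T : Simplex d} {x : E d} (hx : x ∈ body T) :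
    muTilde Γ T x ≤ 1 := by
  rw [body_eq] at hx
  rw [← T.sum_coord_apply_eq_one x]
  exact Finset.sum_le_sum_of_subset_of_nonneg (Finset.subset_univ _) fun j _ _ => hx j

lemma sum_div_muTilde {d : ℕ} {Γ : Set (E d)} {T : Simplex d} {x : E d}
    (h : muTilde Γ T x ≠ 0) : ∑ j ∈ onInterface Γ T, T.coord j x / muTilde Γ T x = 1 := by
  rw [← Finset.sum_div]
  exact div_self h

lemma yPoint_mem_body {d : ℕ} {Γ : Set (E d)} {T : Simplex d} {x : E d} (hx : x ∈ body T)
    (h : muTilde Γ T x ≠ 0) : yPoint Γ T x ∈ body T := by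
  refine (convex_body T).sum_mem (fun j _ => div_nonneg ?_ (muTilde_nonneg hx))
    (sum_div_muTilde h) fun j _ => vertex_mem_body T j
  rw [body_eq] at hx
  exact hx j

lemma MeetInFace.muTilde_eq {d : ℕ} {Γ : Set (E d)} {T T' : Simplex d} (h : MeetInFace T T')
    {x : E d} (hx : x ∈ body T) (hx' : x ∈ body T') : muTilde Γ T' x = muTilde Γ T x := by
  classical
  have := h.sum_coord_smul_eq hx hx' fun z => if z ∈ Γ then (1 : ℝ) else 0
  simpa [muTilde, onInterface, Finset.sum_filter] using this

lemma MeetInFace.interfaceSum_eq {d : ℕ} {Γ : Set (E d)} {T T' : Simplex d}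
    (h : MeetInFace T T') {x : E d} (hx : x ∈ body T) (hx' : x ∈ body T') :
    interfaceSum Γ T' x = interfaceSum Γ T x := by
  classical
  have := h.sum_coord_smul_eq hx hx' fun z => if z ∈ Γ then z else 0
  simpa [interfaceSum, onInterface, Finset.sum_filter] using this

/-- With at most one vertex on `Γ`, the point `y(x)` is that vertex. -/
lemma yPoint_mem_of_card {d : ℕ} {Γ : Set (E d)} {T : Simplex d}
    (h : ¬ 2 ≤ (onInterface Γ T).card) {x : E d} (hμ : muTilde Γ T x ≠ 0) :
    yPoint Γ T x ∈ Γ := by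
  have hne : (onInterface Γ T).Nonempty := by
    rw [Finset.nonempty_iff_ne_empty]
    intro h0
    simp [muTilde, h0] at hμ
  have h1 : (onInterface Γ T).card = 1 := by
    have := hne.card_pos
    omega
  obtain ⟨j, hj⟩ := Finset.card_eq_one.1 h1
  have hμ' : T.coord j x ≠ 0 := by simpa [muTilde, hj] using hμ
  have : yPoint Γ T x = T j := by simp [yPoint, muTilde, hj, hμ']
  rw [this, ← mem_onInterface, hj]
  simp

/-- The elementwise definitions of `Ψ` agree on common faces. -/
lemma MeetInFace.psiOn_eq {d k : ℕ} {Γ : Set (E d)} (hc : IsCompact Γ) {T T' : Simplex d}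
    (h : MeetInFace T T') {x : E d} (hx : x ∈ body T) (hx' : x ∈ body T') :
    psiOn k Γ T' x = psiOn k Γ T x := by
  have hμ := h.muTilde_eq (Γ := Γ) hx hx'
  have hy : yPoint Γ T' x = yPoint Γ T x := by
    rw [yPoint_eq, yPoint_eq, hμ, h.interfaceSum_eq hx hx']
  by_cases h0 : muTilde Γ T x = 0
  · simp [psiOn, hμ, h0]
  · have hcase : ∀ T'' : Simplex d, yPoint Γ T'' x = yPoint Γ T x → muTilde Γ T'' x ≠ 0 →
        ¬ 2 ≤ (onInterface Γ T'').card → nearestPoint Γ (yPoint Γ T x) = yPoint Γ T x := by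
      intro T'' hy'' hμ'' hcard
      rw [← hy'']
      exact nearestPoint_self hc (yPoint_mem_of_card hcard hμ'')
    by_cases h1 : 2 ≤ (onInterface Γ T).card <;> by_cases h2 : 2 ≤ (onInterface Γ T').card
    · rw [psiOn_of_card h1, psiOn_of_card h2, hy, hμ]
    · rw [psiOn_of_card h1, psiOn_of_card_lt h2, hcase T' hy (by rwa [hμ]) h2]
      simp
    · rw [psiOn_of_card_lt h1, psiOn_of_card h2, hy, hcase T rfl h0 h1]
      simp
    · rw [psiOn_of_card_lt h1, psiOn_of_card_lt h2]

/-- If the simplices of `J` meet in common faces, `Ψ` is well defined. -/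
lemma psi_eq_psiOn {d k : ℕ} {Γ : Set (E d)} (hc : IsCompact Γ) {J : Set (Simplex d)}
    (hJ : ∀ T ∈ J, ∀ T' ∈ J, MeetInFace T T') {T : Simplex d} (hT : T ∈ J) {x : E d}
    (hx : x ∈ body T) : psi k Γ J x = psiOn k Γ T x := by
  have hex : ∃ T ∈ J, x ∈ body T := ⟨T, hT, hx⟩
  rw [psi, dif_pos hex]
  exact (hJ T hT _ hex.choose_spec.1).psiOn_eq hc hx hex.choose_spec.2

lemma psi_of_notMem {d k : ℕ} {Γ : Set (E d)} {J : Set (Simplex d)} {x : E d}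
    (hx : x ∉ region J) : psi k Γ J x = x := by
  rw [psi, dif_neg]
  simpa [region] using hx

/-! ### The interpolant on one simplex -/

lemma node_eq {d k : ℕ} (hk : 1 ≤ k) (T : Simplex d) (α : NodeIndex k d) :
    node k T α.1 = vertexMap T (refNode k α.1) := by
  simp only [node, vertexMap, refBary_refNode hk]

lemma node_mem_body {d k : ℕ} (hk : 1 ≤ k) (T : Simplex d) (α : NodeIndex k d) :
    node k T α.1 ∈ body T :=
  node_eq hk T α ▸ vertexMap_mem_body T (refNode_mem hk α).1

lemma interp_eq {d k : ℕ} (T : Simplex d) (u : E d → E d) (x : E d) :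
    interp k T u x =
      ∑ α : NodeIndex k d, baryBasis k α.1 (fun j => T.coord j x) • u (node k T α.1) := by
  rw [interp, ← Finset.sum_coe_sort]
  rfl

lemma interp_vertexMap {d k : ℕ} (T : Simplex d) (u : E d → E d) (x : E d) :
    interp k T u (vertexMap T x) =
      ∑ α : NodeIndex k d, refBasis k α.1 x • u (node k T α.1) := by
  simp only [interp_eq, coord_vertexMap]
  rfl

lemma interp_vertexMap_mem_polyFun {d k : ℕ} (T : Simplex d) (u : E d → E d) (i : Fin d) :
    (fun x => interp k T u (vertexMap T x) i) ∈ polyFun k d := by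
  have : (fun x => interp k T u (vertexMap T x) i) =
      ∑ α : NodeIndex k d, (u (node k T α.1) i) • refBasis k α.1 := by
    ext x
    simp [interp_vertexMap, Finset.sum_apply, mul_comm]
  rw [this]
  exact Submodule.sum_mem _ fun α _ => Submodule.smul_mem _ _ (refBasis_mem_polyFun α)

/-- The interpolant has the prescribed values at the nodes. -/
lemma interp_vertexMap_node {d k : ℕ} (hk : 1 ≤ k) (T : Simplex d) (u : E d → E d) {x : E d}
    (hx : x ∈ refNodes k d) : interp k T u (vertexMap T x) = u (vertexMap T x) := by
  obtain ⟨α, rfl⟩ := exists_refNode_eq hk hx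
  simp [interp_vertexMap, refBasis_refNode hk, node_eq hk]

/-- The interpolants of a function agree on common faces. -/
lemma MeetInFace.interp_eq {d k : ℕ} (hk : 1 ≤ k) {T T' : Simplex d} (h : MeetInFace T T')
    (u : E d → E d) {z : E d} (hz : z ∈ body T) (hz' : z ∈ body T') :
    interp k T u z = interp k T' u z := by
  obtain ⟨s, t, hs, hst⟩ := h
  have hzs : z ∈ face T s := hs ▸ ⟨hz, hz'⟩
  obtain ⟨x, hx, rfl⟩ := (mem_convexHull_image_iff T s z).1 hzs
  obtain ⟨y, hy⟩ : ∃ y, vertexMap T' y = vertexMap T x := ⟨_, vertexMap_refPoint_coord T' _⟩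
  rw [← hy]
  nth_rw 1 [hy]
  ext i
  refine trace_eq_of_nodes hk T.ind T'.ind hst (interp_vertexMap_mem_polyFun T u i)
    (interp_vertexMap_mem_polyFun T' u i) (fun a ha b hb hab => ?_) hx hy.symm
  rw [interp_vertexMap_node hk T u ha.1, interp_vertexMap_node hk T' u hb, hab]

lemma interp_id {d k : ℕ} (hk : 1 ≤ k) (T : Simplex d) (x : E d) :
    interp k T (fun z => z) x = x := by
  rw [← vertexMap_refPoint_coord T x, interp_vertexMap]
  ext i
  have := lagrange_formula hk (polyFun_mono hk (vertexMap_apply_mem_polyFun T i))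
    (refPoint fun j => T.coord j x)
  rw [this]
  simp [node_eq hk]

lemma interp_sub_id {d k : ℕ} (hk : 1 ≤ k) (T : Simplex d) (u : E d → E d) (x : E d) :
    interp k T u x - x = ∑ α : NodeIndex k d,
      baryBasis k α.1 (fun j => T.coord j x) • (u (node k T α.1) - node k T α.1) := by
  nth_rw 2 [← interp_id hk T x]
  simp only [IsoMesh.interp_eq, smul_sub, Finset.sum_sub_distrib]

/-! ### Smoothness of `Ψ` on a simplex -/

/-- Functions of the form `μ^a • w(N / μ)`, with affine `μ` and `N`, are of class `C^n` also where
`μ` vanishes, if `a ≥ n + 1`: the derivative is of the same form with `a - 1` in place of `a`. -/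
lemma contDiffOn_pow_smul_comp {V : Type} [NormedAddCommGroup V] [NormedSpace ℝ V] {s U K : Set V}
    (hs : UniqueDiffOn ℝ s) (hU : IsOpen U) (hK : IsCompact K) (hKU : K ⊆ U) {μ : V → ℝ}
    {μ' : V →L[ℝ] ℝ} {N : V → V} {N' : V →L[ℝ] V} (hμ : ∀ x, HasFDerivAt μ μ' x)
    (hN : ∀ x, HasFDerivAt N N' x) (hy : ∀ x ∈ s, μ x ≠ 0 → (μ x)⁻¹ • N x ∈ K) (n : ℕ) :
    ∀ {W : Type} [NormedAddCommGroup W] [NormedSpace ℝ W] {w : V → W} {a : ℕ},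
      ContDiffOn ℝ (n : WithTop ℕ∞) w U → n + 1 ≤ a →
      ContDiffOn ℝ (n : WithTop ℕ∞) (fun x => μ x ^ a • w ((μ x)⁻¹ • N x)) s := by
  -- `N / μ` stays in the compact set `K`, so the function is of the order of `μ ^ a`
  have hbound : ∀ {W : Type} [NormedAddCommGroup W] [NormedSpace ℝ W] {w : V → W} (a : ℕ),
      1 ≤ a → ContinuousOn w U → ∃ B, ∀ x ∈ s, ‖μ x ^ a • w ((μ x)⁻¹ • N x)‖ ≤ B * ‖μ x ^ a‖ := by
    intro W _ _ w a ha hw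
    obtain ⟨B, hB⟩ := hK.exists_bound_of_continuousOn (hw.mono hKU)
    refine ⟨B, fun x hx => ?_⟩
    rw [norm_smul, mul_comm]
    by_cases h0 : μ x = 0
    · simp [h0, show a ≠ 0 by omega]
    · exact mul_le_mul_of_nonneg_right (hB _ (hy x hx h0)) (norm_nonneg _)
  induction n with
  | zero =>
    intro W _ _ w a hw ha
    simp only [Nat.cast_zero] at hw ⊢
    rw [contDiffOn_zero] at hw ⊢
    intro x hx
    by_cases h0 : μ x = 0
    · obtain ⟨B, hB⟩ := hbound (w := w) a (by omega) hw
      have hlim : Filter.Tendsto (fun z => B * ‖μ z ^ a‖) (nhdsWithin x s) (nhds 0) := by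
        have h1 : ContinuousAt (fun z => B * ‖μ z ^ a‖) x :=
          continuousAt_const.mul (((hμ x).continuousAt.pow a).norm)
        have h2 := h1.tendsto.mono_left (nhdsWithin_le_nhds (s := s))
        simpa [h0, show a ≠ 0 by omega] using h2
      have hval : μ x ^ a • w ((μ x)⁻¹ • N x) = 0 := by
        rw [h0, zero_pow (by omega), zero_smul]
      rw [ContinuousWithinAt, hval]
      refine squeeze_zero_norm' ?_ hlim
      filter_upwards [self_mem_nhdsWithin] with z hz using hB z hz
    · have hyc : ContinuousAt (fun z => (μ z)⁻¹ • N z) x :=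
        ((hμ x).continuousAt.inv₀ h0).smul (hN x).continuousAt
      have hwc : ContinuousAt w ((μ x)⁻¹ • N x) :=
        hw.continuousAt (hU.mem_nhds (hKU (hy x hx h0)))
      exact (((hμ x).continuousAt.pow a).smul
        (ContinuousAt.comp (f := fun z => (μ z)⁻¹ • N z) hwc hyc)).continuousWithinAt
  | succ n ih =>
    intro W _ _ w a hw ha
    -- the derivative is `μ^(a-1) • w₁(N / μ)`, by the product and chain rules
    let w₁ : V → V →L[ℝ] W := fun y =>
      (a : ℝ) • μ'.smulRight (w y) + (fderiv ℝ w y).comp (N' - μ'.smulRight y)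
    have hw₁ : ContDiffOn ℝ (n : WithTop ℕ∞) w₁ U := by
      have h1 : ContDiffOn ℝ (n : WithTop ℕ∞) (fderiv ℝ w) U :=
        hw.fderiv_of_isOpen hU (by norm_cast)
      have h2 : ContDiffOn ℝ (n : WithTop ℕ∞) w U := hw.of_le (by norm_cast; omega)
      have h3 : ContDiffOn ℝ (n : WithTop ℕ∞) (fun y => (a : ℝ) • μ'.smulRight (w y)) U :=
        (contDiffOn_const.smulRight h2).const_smul (a : ℝ)
      have h4 : ContDiffOn ℝ (n : WithTop ℕ∞) (fun y : V => N' - μ'.smulRight y) U :=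
        contDiffOn_const.sub (contDiffOn_const.smulRight contDiffOn_id)
      exact h3.add (h1.clm_comp h4)
    have hf' := ih hw₁ (a := a - 1) (by omega)
    rw [Nat.cast_succ, contDiffOn_succ_iff_hasFDerivWithinAt_of_uniqueDiffOn hs]
    refine ⟨fun h => absurd h (by simp), _, hf', fun x hx => ?_⟩
    by_cases h0 : μ x = 0
    · rw [h0, zero_pow (by omega), zero_smul]
      obtain ⟨B, hB⟩ := hbound (w := w) a (by omega) hw.continuousOn
      have hO : (fun z => μ z ^ a • w ((μ z)⁻¹ • N z)) =O[nhdsWithin x s] fun z => μ z ^ a :=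
        Asymptotics.IsBigO.of_bound B
          (Filter.eventually_of_mem self_mem_nhdsWithin fun z hz => hB z hz)
      have hO2 : (fun z => μ z ^ a) =O[nhdsWithin x s] fun z => ‖z - x‖ ^ a := by
        refine Asymptotics.IsBigO.pow ?_ a
        have := ((hμ x).isBigO_sub.mono (nhdsWithin_le_nhds (s := s))).norm_right
        simpa [h0] using this
      refine (hO.trans hO2).hasFDerivWithinAt hx (by omega)
    · refine HasFDerivAt.hasFDerivWithinAt ?_
      have hwd : HasFDerivAt w (fderiv ℝ w ((μ x)⁻¹ • N x)) ((μ x)⁻¹ • N x) := by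
        refine DifferentiableAt.hasFDerivAt ?_
        refine (hw.contDiffAt (hU.mem_nhds (hKU (hy x hx h0)))).differentiableAt ?_
        exact_mod_cast Nat.succ_ne_zero n
      have hinv : HasFDerivAt (fun z => (μ z)⁻¹) (-((μ x ^ 2)⁻¹ • μ')) x := by
        have := (hasDerivAt_inv h0).comp_hasFDerivAt x (hμ x)
        rwa [neg_smul] at this
      have hyd : HasFDerivAt (fun z => (μ z)⁻¹ • N z) _ x := hinv.smul (hN x)
      have hpow : HasFDerivAt (fun z => μ z ^ a) _ x := HasFDerivAt.pow (hμ x) a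
      have hcomp := HasFDerivAt.comp x (g := w) (f := fun z => (μ z)⁻¹ • N z) hwd hyd
      refine (hpow.smul hcomp).congr_fderiv ?_
      ext v
      obtain ⟨b, rfl⟩ : ∃ b, a = b + 1 := ⟨a - 1, by omega⟩
      have hNx : N x = μ x • ((μ x)⁻¹ • N x) := by
        rw [smul_smul, mul_inv_cancel₀ h0, one_smul]
      have hval : (w ∘ fun z => (μ z)⁻¹ • N z) x = w ((μ x)⁻¹ • N x) := rfl
      rw [hval]
      generalize (μ x)⁻¹ • N x = y at *
      rw [hNx]
      simp only [add_apply, sub_apply, smul_apply, ContinuousLinearMap.smulRight_apply,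
        ContinuousLinearMap.comp_apply, neg_apply, w₁, map_add, map_sub, map_smul]
      rw [Nat.add_sub_cancel]
      match_scalars
      · field_simp
        ring
      · simp only [smul_eq_mul]
        field_simp
        ring
      · simp
        ring

/-! ### Estimates on one simplex -/

/-- On the balls of radius `δ` about points of `Γ`, the nearest point map is `C^r`, and the
derivative of the displacement to the nearest point has the Lipschitz constant `M`. -/
structure UniformTube {d : ℕ} (Γ : Set (E d)) (r : ℕ) (δ M : ℝ) : Prop where
  M_nonneg : 0 ≤ M
  contDiffAt : ∀ p ∈ Γ, ∀ x ∈ Metric.ball p δ,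
    ContDiffAt ℝ (r : WithTop ℕ∞) (nearestPoint Γ) x
  lipschitz : ∀ p ∈ Γ, ∀ x ∈ Metric.ball p δ, ∀ y ∈ Metric.ball p δ,
    ‖fderiv ℝ (fun z => nearestPoint Γ z - z) x - fderiv ℝ (fun z => nearestPoint Γ z - z) y‖
      ≤ M * ‖x - y‖

lemma dist_le_diam_body {d : ℕ} {T : Simplex d} {x y : E d} (hx : x ∈ body T)
    (hy : y ∈ body T) : dist x y ≤ Metric.diam (body T) :=
  Metric.dist_le_diam_of_mem (isCompact_body T).isBounded hx hy

lemma body_subset_ball {d : ℕ} {T : Simplex d} {δ : ℝ} (hD : Metric.diam (body T) < δ)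
    {y : E d} (hy : y ∈ body T) : body T ⊆ Metric.ball y δ := fun _ hx =>
  Metric.mem_ball.2 ((dist_le_diam_body hx hy).trans_lt hD)

lemma contDiffOn_psiOn {d k : ℕ} {Γ : Set (E d)} {δ M : ℝ} (tube : UniformTube Γ (k + 1) δ M)
    {T : Simplex d} (hD : Metric.diam (body T) < δ) :
    ContDiffOn ℝ ((k + 1 : ℕ) : WithTop ℕ∞) (psiOn k Γ T) (body T) := by
  by_cases hcard : 2 ≤ (onInterface Γ T).card
  · obtain ⟨i, hi⟩ : (onInterface Γ T).Nonempty := Finset.card_pos.1 (by omega)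
    rw [mem_onInterface] at hi
    have hu : ContDiffOn ℝ ((k + 1 : ℕ) : WithTop ℕ∞) (fun z => nearestPoint Γ z - z)
        (Metric.ball (T i) δ) := fun x hx =>
      ((tube.contDiffAt _ hi x hx).sub contDiffAt_id).contDiffWithinAt
    have hμ : ∀ x, HasFDerivAt (muTilde Γ T) (∑ j ∈ onInterface Γ T, coordLin T j) x := fun x =>
      HasFDerivAt.fun_sum fun j _ => hasFDerivAt_coord T j x
    have hN : ∀ x, HasFDerivAt (interfaceSum Γ T)
        (∑ j ∈ onInterface Γ T, (coordLin T j).smulRight (T j)) x := fun x =>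
      HasFDerivAt.fun_sum fun j _ => (hasFDerivAt_coord T j x).smul_const (T j)
    have hs : UniqueDiffOn ℝ (body T) :=
      uniqueDiffOn_convex (convex_body T) (interior_body_nonempty T)
    have := contDiffOn_pow_smul_comp hs Metric.isOpen_ball (isCompact_body T)
      (body_subset_ball hD (vertex_mem_body T i)) hμ hN (fun x hx h0 => by
        rw [← yPoint_eq]; exact yPoint_mem_body hx h0) (k + 1) hu (a := k + 2) le_rfl
    refine (contDiffOn_id.add this).congr fun x _ => ?_
    rw [psiOn_of_card hcard, yPoint_eq]
    rfl
  · exact contDiffOn_id.congr fun x _ => psiOn_of_card_lt hcard x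

section estimates

variable {d k : ℕ} {Γ : Set (E d)} {δ M : ℝ} {T : Simplex d}

lemma norm_displacement_sub_le (hc : IsCompact Γ) (tube : UniformTube Γ (k + 1) δ M)
    (hD : Metric.diam (body T) < δ) {w w' : Fin (d + 1) → ℝ}
    (hw : ∀ i ∈ onInterface Γ T, 0 ≤ w i) (hw' : ∀ i ∈ onInterface Γ T, 0 ≤ w' i)
    (hws : ∑ i ∈ onInterface Γ T, w i = 1) (hws' : ∑ i ∈ onInterface Γ T, w' i = 1) :
    ‖(nearestPoint Γ (∑ i ∈ onInterface Γ T, w i • T i) - ∑ i ∈ onInterface Γ T, w i • T i) -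
      (nearestPoint Γ (∑ i ∈ onInterface Γ T, w' i • T i) - ∑ i ∈ onInterface Γ T, w' i • T i)‖
      ≤ M * Metric.diam (body T) ^ 2 * ∑ i ∈ onInterface Γ T, |w i - w' i| := by
  obtain ⟨i₀, hi₀⟩ : (onInterface Γ T).Nonempty := by
    rw [Finset.nonempty_iff_ne_empty]
    intro h0
    simp [h0] at hws
  have hp := mem_onInterface.1 hi₀
  have hsub := body_subset_ball hD (vertex_mem_body T i₀)
  refine norm_sub_le_of_vanishing (u := fun z => nearestPoint Γ z - z) (convex_body T)
    (fun x hx => ?_) tube.M_nonneg (fun x hx y hy => tube.lipschitz _ hp x (hsub hx) y (hsub hy))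
    (fun x hx y hy => ?_) (fun i _ => vertex_mem_body T i) (fun i hi => ?_) hw hw' hws hws'
  · refine ((tube.contDiffAt _ hp x (hsub hx)).sub contDiffAt_id).differentiableAt ?_
    exact_mod_cast Nat.succ_ne_zero k
  · rw [← dist_eq_norm]
    exact dist_le_diam_body hx hy
  · rw [nearestPoint_self hc (mem_onInterface.1 hi), sub_self]

lemma norm_displacement_yPoint_le (hc : IsCompact Γ) (tube : UniformTube Γ (k + 1) δ M)
    (hD : Metric.diam (body T) < δ) {x : E d} (hx : x ∈ body T) (h0 : muTilde Γ T x ≠ 0) :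
    ‖nearestPoint Γ (yPoint Γ T x) - yPoint Γ T x‖ ≤ 2 * (M * Metric.diam (body T) ^ 2) := by
  obtain ⟨i₀, hi₀⟩ : (onInterface Γ T).Nonempty := by
    rw [Finset.nonempty_iff_ne_empty]
    intro h
    simp [muTilde, h] at h0
  have hw : ∀ i ∈ onInterface Γ T, 0 ≤ T.coord i x / muTilde Γ T x := fun i _ =>
    div_nonneg ((body_eq T ▸ hx : x ∈ {z | ∀ j, 0 ≤ T.coord j z}) i) (muTilde_nonneg hx)
  have hw' : ∀ i ∈ onInterface Γ T, 0 ≤ (Pi.single i₀ 1 : Fin (d + 1) → ℝ) i := fun i _ => by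
    by_cases h : i = i₀ <;> simp [h]
  have hws' : ∑ i ∈ onInterface Γ T, (Pi.single i₀ 1 : Fin (d + 1) → ℝ) i = 1 := by
    simp [Pi.single_apply, hi₀]
  have h := norm_displacement_sub_le hc tube hD hw hw' (sum_div_muTilde h0) hws'
  have hv : ∑ i ∈ onInterface Γ T, (Pi.single i₀ 1 : Fin (d + 1) → ℝ) i • T i = T i₀ := by
    simp [Pi.single_apply, ite_smul, hi₀]
  rw [hv, nearestPoint_self hc (mem_onInterface.1 hi₀), sub_self, sub_zero] at h
  refine h.trans ?_
  rw [mul_comm 2]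
  refine mul_le_mul_of_nonneg_left ?_ (mul_nonneg tube.M_nonneg (sq_nonneg _))
  calc ∑ i ∈ onInterface Γ T, |T.coord i x / muTilde Γ T x - (Pi.single i₀ 1 : Fin (d + 1) → ℝ) i|
      ≤ ∑ i ∈ onInterface Γ T,
        (T.coord i x / muTilde Γ T x + (Pi.single i₀ 1 : Fin (d + 1) → ℝ) i) := by
        refine Finset.sum_le_sum fun i hi => ?_
        refine (abs_sub _ _).trans_eq ?_
        rw [abs_of_nonneg (hw i hi), abs_of_nonneg (hw' i hi)]
    _ = 2 := by
      rw [Finset.sum_add_distrib, sum_div_muTilde h0, hws']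
      norm_num

lemma norm_psiOn_sub_le_mul (hc : IsCompact Γ) (tube : UniformTube Γ (k + 1) δ M)
    (hD : Metric.diam (body T) < δ) {x : E d} (hx : x ∈ body T) :
    ‖psiOn k Γ T x - x‖ ≤ muTilde Γ T x * (2 * (M * Metric.diam (body T) ^ 2)) := by
  have hA : 0 ≤ 2 * (M * Metric.diam (body T) ^ 2) :=
    mul_nonneg zero_le_two (mul_nonneg tube.M_nonneg (sq_nonneg _))
  have hμ := muTilde_nonneg (Γ := Γ) hx
  have hμ1 := muTilde_le_one (Γ := Γ) hx
  by_cases h : 2 ≤ (onInterface Γ T).card ∧ muTilde Γ T x ≠ 0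
  · rw [psiOn_of_card h.1, add_sub_cancel_left, norm_smul, norm_pow, Real.norm_of_nonneg hμ]
    refine mul_le_mul ?_ (norm_displacement_yPoint_le hc tube hD hx h.2) (norm_nonneg _) hμ
    calc muTilde Γ T x ^ (k + 2) ≤ muTilde Γ T x ^ 1 :=
          pow_le_pow_of_le_one hμ hμ1 (by omega)
      _ = muTilde Γ T x := pow_one _
  · have : psiOn k Γ T x = x := if_neg h
    rw [this, sub_self, norm_zero]
    exact mul_nonneg hμ hA

lemma norm_psiOn_sub_le (hc : IsCompact Γ) (tube : UniformTube Γ (k + 1) δ M)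
    (hD : Metric.diam (body T) < δ) {x : E d} (hx : x ∈ body T) :
    ‖psiOn k Γ T x - x‖ ≤ 2 * (M * Metric.diam (body T) ^ 2) := by
  refine (norm_psiOn_sub_le_mul hc tube hD hx).trans ?_
  refine mul_le_of_le_one_left ?_ (muTilde_le_one hx)
  exact mul_nonneg zero_le_two (mul_nonneg tube.M_nonneg (sq_nonneg _))

lemma abs_muTilde_sub_le (x y : E d) : |muTilde Γ T x - muTilde Γ T y| ≤
    ∑ i ∈ onInterface Γ T, |T.coord i x - T.coord i y| := by
  rw [muTilde, muTilde, ← Finset.sum_sub_distrib]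
  exact Finset.abs_sum_le_sum_abs _ _

/-- The displacement `Ψ - id` is `O(diam²)`-Lipschitz in the barycentric coordinates. -/
lemma norm_psiOn_sub_sub_le (hc : IsCompact Γ) (tube : UniformTube Γ (k + 1) δ M)
    (hD : Metric.diam (body T) < δ) {x y : E d} (hx : x ∈ body T) (hy : y ∈ body T) :
    ‖(psiOn k Γ T x - x) - (psiOn k Γ T y - y)‖ ≤ M * Metric.diam (body T) ^ 2 *
      ((2 * k + 6) * ∑ i ∈ onInterface Γ T, |T.coord i x - T.coord i y|) := by
  set A := M * Metric.diam (body T) ^ 2 with hA'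
  have hA : 0 ≤ A := mul_nonneg tube.M_nonneg (sq_nonneg _)
  set L := ∑ i ∈ onInterface Γ T, |T.coord i x - T.coord i y| with hL'
  have hL : 0 ≤ L := Finset.sum_nonneg fun i _ => abs_nonneg _
  have hsL := abs_muTilde_sub_le (Γ := Γ) (T := T) x y
  have hk0 : (0 : ℝ) ≤ k := k.cast_nonneg
  have hAL : 0 ≤ A * L := mul_nonneg hA hL
  have hfix : ∀ z, muTilde Γ T z = 0 → psiOn k Γ T z = z := fun z hz => by
    simp [psiOn, hz]
  -- the case that `μ̃` vanishes at the other point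
  have hone : ∀ z ∈ body T, muTilde Γ T z ≤ L →
      ‖psiOn k Γ T z - z‖ ≤ A * ((2 * k + 6) * L) := by
    intro z hz hzL
    refine (norm_psiOn_sub_le_mul hc tube hD hz).trans ?_
    rw [← hA']
    have : muTilde Γ T z * (2 * A) ≤ L * (2 * A) :=
      mul_le_mul_of_nonneg_right hzL (by positivity)
    nlinarith [mul_nonneg hk0 hAL]
  by_cases hsx : muTilde Γ T x = 0
  · rw [hfix x hsx, sub_self, zero_sub, norm_neg]
    refine hone y hy ?_
    rwa [hsx, zero_sub, abs_neg, abs_of_nonneg (muTilde_nonneg hy)] at hsL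
  by_cases hsy : muTilde Γ T y = 0
  · rw [hfix y hsy, sub_self, sub_zero]
    refine hone x hx ?_
    rwa [hsy, sub_zero, abs_of_nonneg (muTilde_nonneg hx)] at hsL
  by_cases hcard : 2 ≤ (onInterface Γ T).card
  swap
  · rw [psiOn_of_card_lt hcard, psiOn_of_card_lt hcard, sub_self, sub_self, sub_self, norm_zero]
    positivity
  have hx' : ∀ j, 0 ≤ T.coord j x := (body_eq T ▸ hx : x ∈ {z | ∀ j, 0 ≤ T.coord j z})
  have hy' : ∀ j, 0 ≤ T.coord j y := (body_eq T ▸ hy : y ∈ {z | ∀ j, 0 ≤ T.coord j z})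
  have h1 := norm_displacement_sub_le hc tube hD (w := fun i => T.coord i x / muTilde Γ T x)
    (w' := fun i => T.coord i y / muTilde Γ T y)
    (fun i _ => div_nonneg (hx' i) (muTilde_nonneg hx))
    (fun i _ => div_nonneg (hy' i) (muTilde_nonneg hy)) (sum_div_muTilde hsx)
    (sum_div_muTilde hsy)
  have h2 := norm_displacement_yPoint_le hc tube hD hy hsy
  rw [← hA'] at h1 h2
  change ‖(nearestPoint Γ (yPoint Γ T x) - yPoint Γ T x) -
    (nearestPoint Γ (yPoint Γ T y) - yPoint Γ T y)‖ ≤ _ at h1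
  rw [psiOn_of_card hcard, psiOn_of_card hcard, add_sub_cancel_left, add_sub_cancel_left]
  generalize nearestPoint Γ (yPoint Γ T x) - yPoint Γ T x = ux at *
  generalize nearestPoint Γ (yPoint Γ T y) - yPoint Γ T y = uy at *
  have hs0 := muTilde_nonneg (Γ := Γ) hx
  have hs1 := muTilde_le_one (Γ := Γ) hx
  have ht0 := muTilde_nonneg (Γ := Γ) hy
  have ht1 := muTilde_le_one (Γ := Γ) hy
  -- one factor `μ̃` compensates for the normalization of the barycentric coordinates
  have h3 : muTilde Γ T x * ∑ i ∈ onInterface Γ T,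
      |T.coord i x / muTilde Γ T x - T.coord i y / muTilde Γ T y| ≤ 2 * L := by
    rw [Finset.mul_sum]
    calc ∑ i ∈ onInterface Γ T,
          muTilde Γ T x * |T.coord i x / muTilde Γ T x - T.coord i y / muTilde Γ T y|
        ≤ ∑ i ∈ onInterface Γ T, (|T.coord i x - T.coord i y| +
            T.coord i y / muTilde Γ T y * |muTilde Γ T x - muTilde Γ T y|) := by
          refine Finset.sum_le_sum fun i _ => ?_
          rw [← abs_of_nonneg (div_nonneg (hy' i) ht0), ← abs_mul,
            abs_of_nonneg (div_nonneg (hy' i) ht0)]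
          nth_rw 1 [← abs_of_nonneg hs0]
          rw [← abs_mul]
          refine le_trans (le_of_eq ?_) (abs_sub _ _)
          congr 1
          field_simp
          ring
      _ = L + |muTilde Γ T x - muTilde Γ T y| := by
          rw [Finset.sum_add_distrib, ← Finset.sum_mul, sum_div_muTilde hsy, one_mul]
      _ ≤ 2 * L := by linarith
  have h4 : ‖muTilde Γ T x ^ (k + 2) • (ux - uy)‖ ≤ A * (2 * L) := by
    rw [norm_smul, norm_pow, Real.norm_of_nonneg hs0]
    have h5 : muTilde Γ T x ^ (k + 2) ≤ muTilde Γ T x := by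
      calc muTilde Γ T x ^ (k + 2) ≤ muTilde Γ T x ^ 1 :=
            pow_le_pow_of_le_one hs0 hs1 (by omega)
        _ = muTilde Γ T x := pow_one _
    calc muTilde Γ T x ^ (k + 2) * ‖ux - uy‖ ≤ muTilde Γ T x * (A * ∑ i ∈ onInterface Γ T,
          |T.coord i x / muTilde Γ T x - T.coord i y / muTilde Γ T y|) :=
          mul_le_mul h5 h1 (norm_nonneg _) hs0
      _ = A * (muTilde Γ T x * ∑ i ∈ onInterface Γ T,
          |T.coord i x / muTilde Γ T x - T.coord i y / muTilde Γ T y|) := by ring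
      _ ≤ A * (2 * L) := mul_le_mul_of_nonneg_left h3 hA
  have h6 : ‖(muTilde Γ T x ^ (k + 2) - muTilde Γ T y ^ (k + 2)) • uy‖ ≤
      ((k + 2) * L) * (2 * A) := by
    rw [norm_smul, Real.norm_eq_abs]
    refine mul_le_mul ?_ h2 (norm_nonneg _) (by positivity)
    refine (abs_pow_sub_pow_le _ _ _).trans ?_
    rw [abs_of_nonneg hs0, abs_of_nonneg ht0]
    have hmax : max (muTilde Γ T x) (muTilde Γ T y) ^ (k + 2 - 1) ≤ 1 :=
      pow_le_one₀ (le_max_of_le_left hs0) (max_le hs1 ht1)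
    calc _ ≤ |muTilde Γ T x - muTilde Γ T y| * ((k + 2 : ℕ) : ℝ) * 1 := by gcongr
      _ ≤ L * ((k + 2 : ℕ) : ℝ) * 1 := by gcongr
      _ = (k + 2) * L := by push_cast; ring
  have h7 : muTilde Γ T x ^ (k + 2) • ux - muTilde Γ T y ^ (k + 2) • uy =
      muTilde Γ T x ^ (k + 2) • (ux - uy) +
        (muTilde Γ T x ^ (k + 2) - muTilde Γ T y ^ (k + 2)) • uy := by
    module
  rw [h7]
  refine (norm_add_le _ _).trans ((add_le_add h4 h6).trans (le_of_eq ?_))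
  ring

end estimates

/-- The Lagrange basis polynomials and their derivatives are bounded on the unit cube. -/
lemma exists_bound_baryBasis (k d : ℕ) : ∃ B ≥ 0, ∀ α : NodeIndex k d,
    ∀ w ∈ Icc (0 : Fin (d + 1) → ℝ) 1,
      ‖baryBasis k α.1 w‖ ≤ B ∧ ‖fderiv ℝ (baryBasis k α.1) w‖ ≤ B := by
  have hcomp : IsCompact (Icc (0 : Fin (d + 1) → ℝ) 1) := isCompact_Icc
  have h1 : ∀ α : NodeIndex k d, ∃ B, ∀ w ∈ Icc (0 : Fin (d + 1) → ℝ) 1,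
      ‖baryBasis k α.1 w‖ ≤ B := fun α =>
    hcomp.exists_bound_of_continuousOn (contDiff_baryBasis (n := 0) k α.1).continuous.continuousOn
  have h2 : ∀ α : NodeIndex k d, ∃ B, ∀ w ∈ Icc (0 : Fin (d + 1) → ℝ) 1,
      ‖fderiv ℝ (baryBasis k α.1) w‖ ≤ B := fun α =>
    hcomp.exists_bound_of_continuousOn
      ((contDiff_baryBasis (n := 1) k α.1).continuous_fderiv one_ne_zero).continuousOn
  choose B₁ hB₁ using h1
  choose B₂ hB₂ using h2
  have hle : ∀ α, |B₁ α| + |B₂ α| ≤ ∑ α, (|B₁ α| + |B₂ α|) := fun α =>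
    Finset.single_le_sum (f := fun α => |B₁ α| + |B₂ α|) (fun _ _ => by positivity)
      (Finset.mem_univ α)
  refine ⟨∑ α, (|B₁ α| + |B₂ α|), Finset.sum_nonneg fun _ _ => by positivity,
    fun α w hw => ⟨?_, ?_⟩⟩
  · have := hB₁ α w hw
    have h3 := le_abs_self (B₁ α)
    have h4 := abs_nonneg (B₂ α)
    linarith [hle α]
  · have := hB₂ α w hw
    have h3 := le_abs_self (B₂ α)
    have h4 := abs_nonneg (B₁ α)
    linarith [hle α]

lemma contDiff_interp {d k : ℕ} {n : WithTop ℕ∞} (T : Simplex d) (u : E d → E d) :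
    ContDiff ℝ n (interp k T u) := by
  have : interp k T u = fun x => ∑ α : NodeIndex k d,
      baryBasis k α.1 (fun j => T.coord j x) • u (node k T α.1) := funext fun x => interp_eq T u x
  rw [this]
  have hb : ∀ α : NodeIndex k d, ContDiff ℝ n fun x => baryBasis k α.1 fun j => T.coord j x :=
    fun α => (contDiff_baryBasis k α.1).comp (contDiff_pi.2 fun j => contDiff_coord T j)
  exact ContDiff.sum fun α _ => (hb α).smul contDiff_const

/-- Only the size of the nodal displacements enters the estimate of the interpolant. -/
lemma norm_interp_sub_le {d k : ℕ} (hk : 1 ≤ k) {B : ℝ} (hB0 : 0 ≤ B)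
    (hB : ∀ α : NodeIndex k d, ∀ w ∈ Icc (0 : Fin (d + 1) → ℝ) 1,
      ‖baryBasis k α.1 w‖ ≤ B ∧ ‖fderiv ℝ (baryBasis k α.1) w‖ ≤ B) {T : Simplex d} {c : E d}
    {r : ℝ} (hr : 0 < r) (hball : Metric.closedBall c r ⊆ body T) {u : E d → E d} {e : ℝ}
    (hu : ∀ z ∈ body T, ‖u z - z‖ ≤ e) {x : E d} (hx : x ∈ body T) :
    ‖interp k T u x - x‖ ≤ Fintype.card (NodeIndex k d) * B * e ∧
    ‖fderiv ℝ (fun z => interp k T u z - z) x‖ ≤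
      Fintype.card (NodeIndex k d) * B * (r⁻¹ * e) := by
  have hw : (fun j => T.coord j x) ∈ Icc (0 : Fin (d + 1) → ℝ) 1 :=
    ⟨fun j => (body_eq T ▸ hx : x ∈ {z | ∀ j, 0 ≤ T.coord j z}) j, fun j => coord_le_one hx j⟩
  have hnode : ∀ α : NodeIndex k d, ‖u (node k T α.1) - node k T α.1‖ ≤ e := fun α =>
    hu _ (node_mem_body hk T α)
  constructor
  · rw [interp_sub_id hk]
    calc _ ≤ ∑ _α : NodeIndex k d, B * e := by
          refine norm_sum_le_of_le _ fun α _ => ?_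
          rw [norm_smul]
          exact mul_le_mul (hB α _ hw).1 (hnode α) (norm_nonneg _) hB0
      _ = _ := by rw [Finset.sum_const, Finset.card_univ, nsmul_eq_mul]; ring
  · let P : E d →L[ℝ] (Fin (d + 1) → ℝ) := ContinuousLinearMap.pi fun j => coordLin T j
    have hP : ‖P‖ ≤ r⁻¹ := by
      refine ContinuousLinearMap.opNorm_le_bound _ (by positivity) fun v => ?_
      refine (pi_norm_le_iff_of_nonneg (by positivity)).2 fun j => ?_
      exact (coordLin T j).le_of_opNorm_le (norm_coordLin_le hr hball j) v
    have hcoord : HasFDerivAt (fun z j => T.coord j z) P x :=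
      hasFDerivAt_pi.2 fun j => hasFDerivAt_coord T j x
    have hder : HasFDerivAt (fun z => interp k T u z - z) (∑ α : NodeIndex k d,
        ((fderiv ℝ (baryBasis k α.1) fun j => T.coord j x).comp P).smulRight
          (u (node k T α.1) - node k T α.1)) x := by
      have heq : (fun z => interp k T u z - z) = fun z => ∑ α : NodeIndex k d,
          baryBasis k α.1 (fun j => T.coord j z) • (u (node k T α.1) - node k T α.1) :=
        funext fun z => interp_sub_id hk T u z
      rw [heq]
      refine HasFDerivAt.fun_sum fun α _ => HasFDerivAt.smul_const ?_ _
      have hb : HasFDerivAt (baryBasis k α.1) (fderiv ℝ (baryBasis k α.1) fun j => T.coord j x)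
          (fun j => T.coord j x) :=
        ((contDiff_baryBasis (n := 1) k α.1).differentiable one_ne_zero _).hasFDerivAt
      exact HasFDerivAt.comp x (g := baryBasis k α.1) hb hcoord
    rw [hder.fderiv]
    calc _ ≤ ∑ _α : NodeIndex k d, B * r⁻¹ * e := by
          refine norm_sum_le_of_le _ fun α _ => ?_
          rw [ContinuousLinearMap.norm_smulRight_apply]
          refine mul_le_mul ?_ (hnode α) (norm_nonneg _) (by positivity)
          refine (ContinuousLinearMap.opNorm_comp_le _ _).trans ?_
          exact mul_le_mul (hB α _ hw).2 hP (norm_nonneg _) hB0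
      _ = _ := by rw [Finset.sum_const, Finset.card_univ, nsmul_eq_mul]; ring

/-- On a small shape regular simplex, `Ψ` is `C^{k+1}`, and both `Ψ` and its interpolant are
perturbations of the identity of the order of the diameter, in the Lipschitz sense. -/
lemma exists_simplex_estimates {d k : ℕ} (hk : 1 ≤ k) {Γ : Set (E d)}
    (hΓ : IsClosedHypersurface (k + 2) Γ) (κ : ℝ) : ∃ h₁ > 0, ∃ C ≥ 0, ∀ T : Simplex d,
      (∃ c r, 0 < r ∧ Metric.diam (body T) ≤ κ * r ∧ Metric.closedBall c r ⊆ body T) →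
      Metric.diam (body T) < h₁ →
      ContDiffOn ℝ ((k + 1 : ℕ) : WithTop ℕ∞) (psiOn k Γ T) (body T) ∧
      (∀ x ∈ body T, ‖psiOn k Γ T x - x‖ ≤ C * Metric.diam (body T)) ∧
      (∀ x ∈ body T, ∀ y ∈ body T, ‖(psiOn k Γ T x - x) - (psiOn k Γ T y - y)‖ ≤
        C * Metric.diam (body T) * ‖x - y‖) ∧
      ∀ u : E d → E d, (∀ z ∈ body T, u z = psiOn k Γ T z) → ∀ x ∈ body T,
        ‖interp k T u x - x‖ ≤ C * Metric.diam (body T) ∧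
        ‖fderiv ℝ (fun z => interp k T u z - z) x‖ ≤ C * Metric.diam (body T) := by
  obtain ⟨δ, hδ, M, hM, hδM⟩ := IsClosedHypersurface.exists_uniform_tube (r := k + 1)
    (by omega) hΓ
  have tube : UniformTube Γ (k + 1) δ M :=
    ⟨hM, fun p hp => (hδM p hp).1, fun p hp => (hδM p hp).2⟩
  obtain ⟨B, hB0, hB⟩ := exists_bound_baryBasis k d
  set N : ℝ := (Fintype.card (NodeIndex k d) : ℝ)
  have hN : 0 ≤ N := Nat.cast_nonneg _
  have hk0 : (0 : ℝ) ≤ k := k.cast_nonneg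
  refine ⟨min δ 1, lt_min hδ one_pos, 2 * M + M * (2 * k + 6) * (d + 1) * |κ| +
    (N * B * (2 * M) + N * B * (|κ| * (2 * M))), by positivity, ?_⟩
  rintro T ⟨c, r, hr, hκ, hball⟩ hD
  have hDδ := hD.trans_le (min_le_left _ _)
  have hD1 := (hD.trans_le (min_le_right _ _)).le
  have hc := hΓ.isCompact
  set D := Metric.diam (body T) with hDdef
  have hD0 : 0 ≤ D := Metric.diam_nonneg
  -- of the two factors `D` in the estimates, shape regularity spends one on the gradients of the
  -- barycentric coordinates, which are bounded by `r⁻¹`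
  have hDr : r⁻¹ * D ≤ |κ| := by
    rw [inv_mul_eq_div, div_le_iff₀ hr]
    exact hκ.trans (mul_le_mul_of_nonneg_right (le_abs_self κ) hr.le)
  have hD2 : D ^ 2 ≤ D := by nlinarith
  have t1 : 0 ≤ 2 * M := by positivity
  have t2 : 0 ≤ M * (2 * k + 6) * (d + 1) * |κ| := by positivity
  have t3 : 0 ≤ N * B * (2 * M) := by positivity
  have t4 : 0 ≤ N * B * (|κ| * (2 * M)) := by positivity
  have hsize : ∀ x ∈ body T, ‖psiOn k Γ T x - x‖ ≤ 2 * M * D ^ 2 := fun x hx =>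
    (norm_psiOn_sub_le hc tube hDδ hx).trans_eq (by ring)
  refine ⟨contDiffOn_psiOn tube hDδ, fun x hx => ?_, fun x hx y hy => ?_, fun u hu x hx => ?_⟩
  · refine (hsize x hx).trans ?_
    calc 2 * M * D ^ 2 ≤ 2 * M * D := by gcongr
      _ ≤ _ := mul_le_mul_of_nonneg_right (by linarith) hD0
  · refine (norm_psiOn_sub_sub_le hc tube hDδ hx hy).trans ?_
    rw [← hDdef]
    have hsum : ∑ i ∈ onInterface Γ T, |T.coord i x - T.coord i y| ≤
        (d + 1) * (r⁻¹ * ‖x - y‖) := by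
      calc _ ≤ ∑ i, |T.coord i x - T.coord i y| :=
            Finset.sum_le_sum_of_subset_of_nonneg (Finset.subset_univ _)
              fun _ _ _ => abs_nonneg _
        _ ≤ ∑ _i : Fin (d + 1), r⁻¹ * ‖x - y‖ :=
            Finset.sum_le_sum fun i _ => abs_coord_sub_le hr hball i x y
        _ = _ := by simp
    calc M * D ^ 2 * ((2 * k + 6) * ∑ i ∈ onInterface Γ T, |T.coord i x - T.coord i y|)
        ≤ M * D ^ 2 * ((2 * k + 6) * ((d + 1) * (r⁻¹ * ‖x - y‖))) := by gcongr
      _ = M * (2 * k + 6) * (d + 1) * (r⁻¹ * D) * D * ‖x - y‖ := by ring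
      _ ≤ M * (2 * k + 6) * (d + 1) * |κ| * D * ‖x - y‖ := by gcongr
      _ ≤ _ := by
        refine mul_le_mul_of_nonneg_right (mul_le_mul_of_nonneg_right ?_ hD0) (norm_nonneg _)
        linarith
  · have husize : ∀ z ∈ body T, ‖u z - z‖ ≤ 2 * M * D ^ 2 := fun z hz => by
      rw [hu z hz]; exact hsize z hz
    obtain ⟨h1, h2⟩ := norm_interp_sub_le hk hB0 hB hr hball husize hx
    constructor
    · refine h1.trans ?_
      calc N * B * (2 * M * D ^ 2) ≤ N * B * (2 * M * D) := by gcongr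
        _ = N * B * (2 * M) * D := by ring
        _ ≤ _ := mul_le_mul_of_nonneg_right (by linarith) hD0
    · refine h2.trans ?_
      calc N * B * (r⁻¹ * (2 * M * D ^ 2)) = N * B * ((r⁻¹ * D) * (2 * M)) * D := by ring
        _ ≤ N * B * (|κ| * (2 * M)) * D := by gcongr
        _ ≤ _ := mul_le_mul_of_nonneg_right (by linarith) hD0

/-! ### The two sides of the hypersurface -/

section sides

variable {n : ℕ} {Γ Ω₁ : Set (E n)}

/-- Near a point of `Γ = ∂Ω₁`, the exterior of `Ω₁` is contained in one connected side of `Γ`. -/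
lemma exists_exterior_side (hΓ : IsLipschitzHypersurface Γ) (hΩ₁ : IsOpen Ω₁)
    (hfr : frontier Ω₁ = Γ) {p : E n} (hp : p ∈ Γ) :
    ∃ U V : Set (E n), IsOpen U ∧ p ∈ U ∧ IsPreconnected V ∧ U ∩ (closure Ω₁)ᶜ ⊆ V ∧
      (V ⊆ (closure Ω₁)ᶜ ∨ V ⊆ Ω₁) ∧ U ∩ Γ ⊆ closure V := by
  obtain ⟨U, V₁, V₂, hU, hpU, hV₁, hV₂, hUV, hcl₁, hcl₂⟩ := hΓ.exists_sides hp
  have hdisj : Disjoint (closure Ω₁)ᶜ Ω₁ :=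
    disjoint_left.2 fun x hx hx' => hx (subset_closure hx')
  have hcov : ∀ x, x ∉ Γ → x ∈ (closure Ω₁)ᶜ ∪ Ω₁ := by
    intro x hx
    by_contra h
    rw [mem_union, not_or, mem_compl_iff, not_not] at h
    rw [← hfr, hΩ₁.frontier_eq] at hx
    exact hx h
  have hside : ∀ V, V ⊆ V₁ ∪ V₂ → IsPreconnected V → V ⊆ (closure Ω₁)ᶜ ∨ V ⊆ Ω₁ := by
    intro V hV hVc
    refine hVc.subset_or_subset isClosed_closure.isOpen_compl hΩ₁ hdisj fun x hx => hcov x ?_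
    have := hV hx
    rw [← hUV] at this
    exact this.2
  have hΓW : ∀ x ∈ (closure Ω₁)ᶜ, x ∉ Γ := fun x hx hxΓ =>
    hx (frontier_subset_closure (hfr ▸ hxΓ))
  have hUW : U ∩ (closure Ω₁)ᶜ ⊆ V₁ ∪ V₂ := fun x hx => hUV ▸ ⟨hx.1, hΓW x hx.2⟩
  have hone : ∀ V V', V ∪ V' = V₁ ∪ V₂ → IsPreconnected V → (V ∩ Ω₁).Nonempty →
      U ∩ (closure Ω₁)ᶜ ⊆ V' := by
    rintro V V' hVV hV ⟨y, hyV, hyΩ⟩ x hx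
    have hx' := hUW hx
    rw [← hVV] at hx'
    refine hx'.resolve_left fun hxV => ?_
    rcases hside V (hVV ▸ subset_union_left) hV with h | h
    · exact h hyV (subset_closure hyΩ)
    · exact hx.2 (subset_closure (h hxV))
  obtain ⟨y, hyU, hyΩ⟩ : (U ∩ Ω₁).Nonempty :=
    mem_closure_iff.1 (frontier_subset_closure (hfr ▸ hp : p ∈ frontier Ω₁)) U hU hpU
  have hyΓ : y ∉ Γ := by
    rw [← hfr, hΩ₁.frontier_eq]
    exact fun h => h.2 hyΩ
  have hy : y ∈ V₁ ∪ V₂ := hUV ▸ ⟨hyU, hyΓ⟩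
  rcases hy with hy | hy
  · exact ⟨U, V₂, hU, hpU, hV₂, hone V₁ V₂ rfl hV₁ ⟨y, hy, hyΩ⟩,
      hside V₂ subset_union_right hV₂, hcl₂⟩
  · exact ⟨U, V₁, hU, hpU, hV₁, hone V₂ V₁ (union_comm _ _) hV₂ ⟨y, hy, hyΩ⟩,
      hside V₁ subset_union_left hV₁, hcl₁⟩

/-- The exterior of `Ω₁` is adherent to all points of the connected hypersurface `∂Ω₁`. -/
lemma subset_closure_exterior (hΓ : IsLipschitzHypersurface Γ) (hΓc : IsConnected Γ)
    (hΩ₁ : IsOpen Ω₁) (hfr : frontier Ω₁ = Γ) (hne : closure Ω₁ ≠ univ) :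
    Γ ⊆ closure (closure Ω₁)ᶜ := by
  have hloc : ∀ p ∈ Γ ∩ closure (closure Ω₁)ᶜ, ∃ U, IsOpen U ∧ p ∈ U ∧
      U ∩ Γ ⊆ closure (closure Ω₁)ᶜ := by
    rintro p ⟨hp, hpW⟩
    obtain ⟨U, V, hU, hpU, -, hUV, hV, hcl⟩ := exists_exterior_side hΓ hΩ₁ hfr hp
    obtain ⟨x, hxU, hxW⟩ := mem_closure_iff.1 hpW U hU hpU
    have hVW : V ⊆ (closure Ω₁)ᶜ :=
      hV.resolve_right fun h => hxW (subset_closure (h (hUV ⟨hxU, hxW⟩)))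
    exact ⟨U, hU, hpU, hcl.trans (closure_mono hVW)⟩
  choose! U hUo hpU hUΓ using hloc
  have hopen : IsOpen (⋃ p ∈ Γ ∩ closure (closure Ω₁)ᶜ, U p) :=
    isOpen_biUnion fun p hp => hUo p hp
  have hcov : Γ ⊆ (⋃ p ∈ Γ ∩ closure (closure Ω₁)ᶜ, U p) ∪ (closure (closure Ω₁)ᶜ)ᶜ := by
    intro p hp
    by_cases h : p ∈ closure (closure Ω₁)ᶜ
    · exact Or.inl (mem_iUnion₂.2 ⟨p, ⟨hp, h⟩, hpU p ⟨hp, h⟩⟩)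
    · exact Or.inr h
  have hint : Γ ∩ ((⋃ p ∈ Γ ∩ closure (closure Ω₁)ᶜ, U p) ∩ (closure (closure Ω₁)ᶜ)ᶜ) = ∅ := by
    refine eq_empty_of_forall_notMem ?_
    rintro x ⟨hxΓ, hxU, hx⟩
    obtain ⟨p, hp, hxp⟩ := mem_iUnion₂.1 hxU
    exact hx (hUΓ p hp ⟨hxp, hxΓ⟩)
  rcases isPreconnected_iff_subset_of_disjoint.1 hΓc.isPreconnected _ _ hopen
    isClosed_closure.isOpen_compl hcov hint with h | h
  · intro x hx
    obtain ⟨p, hp, hxp⟩ := mem_iUnion₂.1 (h hx)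
    exact hUΓ p hp ⟨hxp, hx⟩
  · -- otherwise the exterior would be open and closed
    exfalso
    have hclosed : IsClosed (closure Ω₁)ᶜ := by
      refine isClosed_of_closure_subset fun x hx hxΩ => ?_
      have hxn : x ∉ Ω₁ := fun hx1 => by
        obtain ⟨y, hy, hyW⟩ := mem_closure_iff.1 hx Ω₁ hΩ₁ hx1
        exact hyW (subset_closure hy)
      have hxΓ : x ∈ Γ := by
        rw [← hfr, hΩ₁.frontier_eq]
        exact ⟨hxΩ, hxn⟩
      exact h hxΓ hx
    obtain ⟨p, hp⟩ := hΓc.nonempty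
    rcases isClopen_iff.1 ⟨hclosed, isClosed_closure.isOpen_compl⟩ with h0 | h0
    · exact hne (compl_empty_iff.1 h0)
    · have : p ∈ closure Ω₁ := frontier_subset_closure (hfr ▸ hp)
      exact (h0 ▸ mem_univ p : p ∈ (closure Ω₁)ᶜ) this

/-- Every point of the exterior of `Ω₁` is joined, within the exterior, to a point at a distance
from `Ω₁` that is bounded from below. -/
lemma exists_exterior_depth (hΓ : IsLipschitzHypersurface Γ) (hΓk : IsCompact Γ)
    (hΓne : Γ.Nonempty) (hΩ₁ : IsOpen Ω₁) (hfr : frontier Ω₁ = Γ) :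
    ∃ δ > 0, ∀ w ∈ (closure Ω₁)ᶜ, ∃ C : Set (E n), IsPreconnected C ∧ C ⊆ (closure Ω₁)ᶜ ∧
      w ∈ C ∧ ∃ z ∈ C, δ ≤ Metric.infDist z (closure Ω₁) := by
  have hΩne : (closure Ω₁).Nonempty := by
    obtain ⟨p, hp⟩ := hΓne
    exact ⟨p, frontier_subset_closure (hfr ▸ hp)⟩
  -- near a point of `Γ`, the exterior lies in one connected side; take the depth of a point of it
  have hloc : ∃ δ > 0, ∀ p ∈ Γ, ∀ A ⊆ (closure Ω₁)ᶜ, p ∈ closure A → ∃ C : Set (E n),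
      IsPreconnected C ∧ C ⊆ (closure Ω₁)ᶜ ∧ (A ∩ C).Nonempty ∧
      ∃ z ∈ C, δ ≤ Metric.infDist z (closure Ω₁) := by
    refine hΓk.induction_on (p := fun S => ∃ δ > 0, ∀ p ∈ S, ∀ A ⊆ (closure Ω₁)ᶜ,
      p ∈ closure A → ∃ C : Set (E n), IsPreconnected C ∧ C ⊆ (closure Ω₁)ᶜ ∧
      (A ∩ C).Nonempty ∧ ∃ z ∈ C, δ ≤ Metric.infDist z (closure Ω₁)) ?_ ?_ ?_ ?_
    · exact ⟨1, one_pos, fun p hp => absurd hp (Set.notMem_empty p)⟩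
    · rintro S T hST ⟨δ, hδ, h⟩
      exact ⟨δ, hδ, fun p hp => h p (hST hp)⟩
    · rintro S T ⟨δ, hδ, h⟩ ⟨δ', hδ', h'⟩
      refine ⟨min δ δ', lt_min hδ hδ', ?_⟩
      rintro p (hp | hp) A hA hpA
      · obtain ⟨C, h1, h2, h3, z, hz, h4⟩ := h p hp A hA hpA
        exact ⟨C, h1, h2, h3, z, hz, (min_le_left _ _).trans h4⟩
      · obtain ⟨C, h1, h2, h3, z, hz, h4⟩ := h' p hp A hA hpA
        exact ⟨C, h1, h2, h3, z, hz, (min_le_right _ _).trans h4⟩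
    · intro p hp
      obtain ⟨U, V, hU, hpU, hVc, hUV, hV, hcl⟩ := exists_exterior_side hΓ hΩ₁ hfr hp
      obtain ⟨z, hz⟩ : V.Nonempty := closure_nonempty_iff.1 ⟨p, hcl ⟨hpU, hp⟩⟩
      by_cases hVW : V ⊆ (closure Ω₁)ᶜ
      · refine ⟨U, mem_nhdsWithin_of_mem_nhds (hU.mem_nhds hpU), Metric.infDist z (closure Ω₁),
          (isClosed_closure.notMem_iff_infDist_pos hΩne).1 (hVW hz), fun q hq A hA hqA => ?_⟩
        obtain ⟨x, hxU, hxA⟩ := mem_closure_iff.1 hqA U hU hq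
        exact ⟨V, hVc, hVW, ⟨x, hxA, hUV ⟨hxU, hA hxA⟩⟩, z, hz, le_rfl⟩
      · refine ⟨U, mem_nhdsWithin_of_mem_nhds (hU.mem_nhds hpU), 1, one_pos,
          fun q hq A hA hqA => ?_⟩
        obtain ⟨x, hxU, hxA⟩ := mem_closure_iff.1 hqA U hU hq
        have hx := (hV.resolve_left hVW) (hUV ⟨hxU, hA hxA⟩)
        exact absurd (subset_closure hx) (hA hxA)
  obtain ⟨δ, hδ, h⟩ := hloc
  refine ⟨δ, hδ, fun w hw => ?_⟩
  set A := connectedComponentIn (closure Ω₁)ᶜ w with hA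
  have hWo : IsOpen (closure Ω₁)ᶜ := isClosed_closure.isOpen_compl
  have hAo : IsOpen A := hWo.connectedComponentIn
  have hAW : A ⊆ (closure Ω₁)ᶜ := connectedComponentIn_subset _ _
  have hwA : w ∈ A := mem_connectedComponentIn hw
  -- the component has a boundary point, which lies on `Γ`
  obtain ⟨p, hp⟩ : (frontier A).Nonempty := by
    rw [nonempty_iff_ne_empty, Ne, frontier_eq_empty_iff, not_or]
    refine ⟨fun h0 => (h0 ▸ hwA : w ∈ (∅ : Set (E n))), fun h1 => ?_⟩
    obtain ⟨y, hy⟩ := hΩne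
    exact hAW (h1 ▸ mem_univ y) hy
  have hpA : p ∈ closure A := frontier_subset_closure hp
  have hpW : p ∈ closure Ω₁ := by
    by_contra hpW
    have hopen : IsOpen (connectedComponentIn (closure Ω₁)ᶜ p) := hWo.connectedComponentIn
    obtain ⟨y, hyp, hyA⟩ := mem_closure_iff.1 hpA _ hopen (mem_connectedComponentIn hpW)
    have h1 := connectedComponentIn_eq hyp
    have h2 : A = _ := connectedComponentIn_eq hyA
    rw [hAo.frontier_eq] at hp
    refine hp.2 ?_
    rw [h2, ← h1]
    exact mem_connectedComponentIn hpW
  have hpΓ : p ∈ Γ := by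
    rw [← hfr, hΩ₁.frontier_eq]
    refine ⟨hpW, fun hp1 => ?_⟩
    obtain ⟨y, hy, hyA⟩ := mem_closure_iff.1 hpA Ω₁ hΩ₁ hp1
    exact hAW hyA (subset_closure hy)
  obtain ⟨C, h1, h2, h3, z, hz, h4⟩ := h p hpΓ A hAW hpA
  exact ⟨A ∪ C, isPreconnected_connectedComponentIn.union' h3 h1, union_subset hAW h2,
    Or.inl hwA, z, Or.inr hz, h4⟩

end sides

/-! ### The interface of the straight mesh -/

lemma volume_affineSpan_eq_zero {d : ℕ} (A : Finset (E d)) (hA : A.card ≤ d) :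
    MeasureTheory.volume (affineSpan ℝ (A : Set (E d)) : Set (E d)) = 0 := by
  classical
  rcases A.eq_empty_or_nonempty with rfl | hne
  · simp
  refine MeasureTheory.Measure.addHaar_affineSubspace _ _ fun htop => ?_
  obtain ⟨n, hn⟩ : ∃ n, A.card = n + 1 := ⟨A.card - 1, by have := hne.card_pos; omega⟩
  have h1 := finrank_vectorSpan_image_finset_le ℝ (fun x : E d => x) A hn
  have h2 : vectorSpan ℝ (A : Set (E d)) = ⊤ := by
    rw [← direction_affineSpan, htop, AffineSubspace.direction_top]
  rw [Finset.image_id', h2, finrank_top, finrank_euclideanSpace_fin] at h1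
  omega

/-- Two open sets are joined by a segment that misses finitely many affine subspaces of
codimension at least two. -/
lemma exists_segment_disjoint {d : ℕ} {ι : Type*} {I : Set ι} (hI : I.Finite)
    (A : ι → Finset (E d)) (hA : ∀ i ∈ I, (A i).card + 1 ≤ d) {O O' : Set (E d)} (hO : IsOpen O)
    (hO' : IsOpen O') (hne : O.Nonempty) (hne' : O'.Nonempty) :
    ∃ a ∈ O, ∃ b ∈ O', ∀ i ∈ I, ∀ z ∈ segment ℝ a b, z ∉ convexHull ℝ (A i : Set (E d)) := by
  classical
  have key : ∀ (B : ι → Finset (E d)), (∀ i ∈ I, (B i).card ≤ d) → ∀ {O : Set (E d)}, IsOpen O →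
      O.Nonempty → ∃ a ∈ O, ∀ i ∈ I, a ∉ affineSpan ℝ (B i : Set (E d)) := by
    intro B hB O hO hne
    have hnull : MeasureTheory.volume (⋃ i ∈ I, (affineSpan ℝ (B i : Set (E d)) : Set (E d))) = 0 :=
      (MeasureTheory.measure_biUnion_null_iff hI.countable).2 fun i hi =>
        volume_affineSpan_eq_zero _ (hB i hi)
    by_contra! hcon
    have hsub : O ⊆ ⋃ i ∈ I, (affineSpan ℝ (B i : Set (E d)) : Set (E d)) := by
      intro a ha
      obtain ⟨i, hi, hai⟩ := hcon a ha
      exact mem_iUnion₂.2 ⟨i, hi, hai⟩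
    exact (hO.measure_pos MeasureTheory.volume hne).ne' (MeasureTheory.measure_mono_null hsub hnull)
  -- `a` avoids the subspaces, and `b` their joins with `a`
  obtain ⟨a, ha, haA⟩ := key A (fun i hi => by have := hA i hi; omega) hO hne
  obtain ⟨b, hb, hbA⟩ := key (fun i => insert a (A i))
    (fun i hi => (Finset.card_insert_le _ _).trans (hA i hi)) hO' hne'
  refine ⟨a, ha, b, hb, fun i hi z hz hzA => ?_⟩
  have hzs : z ∈ affineSpan ℝ (A i : Set (E d)) := convexHull_subset_affineSpan _ hzA
  rw [segment_eq_image_lineMap] at hz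
  obtain ⟨t, -, rfl⟩ := hz
  have ht : t ≠ 0 := by
    rintro rfl
    rw [AffineMap.lineMap_apply_zero] at hzs
    exact haA i hi hzs
  refine hbA i hi ?_
  have hsub : affineSpan ℝ (A i : Set (E d)) ≤
      affineSpan ℝ ((insert a (A i) : Finset (E d)) : Set (E d)) :=
    affineSpan_mono ℝ (by simp)
  have ha' : a ∈ affineSpan ℝ ((insert a (A i) : Finset (E d)) : Set (E d)) :=
    subset_affineSpan ℝ _ (by simp)
  have hb' : b = AffineMap.lineMap a (AffineMap.lineMap a b t) t⁻¹ := by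
    simp only [AffineMap.lineMap_apply, vsub_eq_sub, vadd_eq_add, add_sub_cancel_right, smul_smul,
      inv_mul_cancel₀ ht, one_smul, sub_add_cancel]
  rw [hb']
  exact AffineMap.lineMap_mem _ ha' (hsub hzs)

/-- The union of the interface facets. -/
def straightInterface {d : ℕ} (J₁ J₂ : Set (Simplex d)) : Set (E d) :=
  ⋃ p ∈ interfaceFacets J₁ J₂, facet p.1 p.2

lemma isClosed_region {d : ℕ} {J : Set (Simplex d)} (hJ : J.Finite) : IsClosed (region J) :=
  hJ.isClosed_biUnion fun T _ => isClosed_body T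

lemma isCompact_region {d : ℕ} {J : Set (Simplex d)} (hJ : J.Finite) : IsCompact (region J) :=
  hJ.isCompact_biUnion fun T _ => isCompact_body T

lemma body_subset_region {d : ℕ} {J : Set (Simplex d)} {T : Simplex d} (hT : T ∈ J) :
    body T ⊆ region J := subset_biUnion_of_mem hT

lemma region_union {d : ℕ} (J₁ J₂ : Set (Simplex d)) :
    region (J₁ ∪ J₂) = region J₁ ∪ region J₂ := biUnion_union _ _ _

lemma closure_interior_region {d : ℕ} {J : Set (Simplex d)} (hJ : J.Finite) :
    closure (interior (region J)) = region J := by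
  refine Subset.antisymm
    ((closure_mono interior_subset).trans (isClosed_region hJ).closure_eq.subset) ?_
  refine iUnion₂_subset fun T hT => ?_
  rw [← closure_interior_body]
  exact closure_mono (interior_mono (body_subset_region hT))

section mesh

variable {d : ℕ} {Ω Ω₁ Γ : Set (E d)} {h κ : ℝ} {J₁ J₂ : Set (Simplex d)}

lemma IsInitialMesh.meetInFace (hM : IsInitialMesh Ω Ω₁ Γ h κ J₁ J₂) {T T' : Simplex d}
    (hT : T ∈ J₁ ∪ J₂) (hT' : T' ∈ J₁ ∪ J₂) : MeetInFace T T' := by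
  rcases eq_or_ne T T' with rfl | hne
  · exact ⟨Finset.univ, Finset.univ, by simp [face, body], rfl⟩
  · obtain ⟨s, t, -, -, h1, h2⟩ := hM.admissible T hT T' hT' hne
    exact ⟨s, t, h1, h2⟩

lemma IsInitialMesh.disjoint (hM : IsInitialMesh Ω Ω₁ Γ h κ J₁ J₂) : Disjoint J₁ J₂ := by
  rw [Set.disjoint_left]
  intro T h1 h2
  obtain ⟨x, hx⟩ := interior_body_nonempty T
  have hxR : x ∈ closure (Ω \ region J₁) :=
    hM.region₂ ▸ body_subset_region h2 (interior_subset hx)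
  obtain ⟨y, hy, hyΩ⟩ := mem_closure_iff.1 hxR _ isOpen_interior hx
  exact hyΩ.2 (body_subset_region h1 (interior_subset hy))

lemma IsInitialMesh.finite (hM : IsInitialMesh Ω Ω₁ Γ h κ J₁ J₂) : (J₁ ∪ J₂).Finite :=
  hM.finite₁.union hM.finite₂

lemma IsInitialMesh.finite_interfaceFacets (hM : IsInitialMesh Ω Ω₁ Γ h κ J₁ J₂) :
    (interfaceFacets J₁ J₂).Finite :=
  (hM.finite₁.prod finite_univ).subset fun p hp => ⟨hp.1, mem_univ p.2⟩

lemma IsInitialMesh.isCompact_straightInterface (hM : IsInitialMesh Ω Ω₁ Γ h κ J₁ J₂) :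
    IsCompact (straightInterface J₁ J₂) :=
  hM.finite_interfaceFacets.isCompact_biUnion fun p _ =>
    ((finite_range p.1).subset (image_subset_range _ _)).isCompact_convexHull ℝ

lemma straightInterface_subset :
    straightInterface J₁ J₂ ⊆ region J₁ ∩ region J₂ := by
  refine iUnion₂_subset fun p hp x hx => ?_
  obtain ⟨T', hT', hpT'⟩ := hp.2
  rw [← hpT'] at hx
  exact ⟨body_subset_region hp.1 hx.1, body_subset_region hT' hx.2⟩

/-- Inside `Ω`, the two regions of the mesh meet in the interface facets only. If a neighbourhood
of a common point missed the interface, it would contain a segment from the interior of one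
region to that of the other, which avoids all faces of codimension at least two. -/
lemma IsInitialMesh.inter_subset_straightInterface (hM : IsInitialMesh Ω Ω₁ Γ h κ J₁ J₂)
    (hΩ : IsOpen Ω) :
    region J₁ ∩ region J₂ ∩ Ω ⊆ straightInterface J₁ J₂ := by
  classical
  rintro x ⟨⟨hx1, hx2⟩, hxΩ⟩
  by_contra hxI
  obtain ⟨ε, hε, hball⟩ := Metric.isOpen_iff.1
    (hΩ.inter hM.isCompact_straightInterface.isClosed.isOpen_compl) x ⟨hxΩ, hxI⟩
  obtain ⟨T₁, hT₁, hxT₁⟩ := mem_iUnion₂.1 hx1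
  obtain ⟨T₂, hT₂, hxT₂⟩ := mem_iUnion₂.1 hx2
  have hne : ∀ T : Simplex d, x ∈ body T → (interior (body T) ∩ Metric.ball x ε).Nonempty := by
    intro T hxT
    rw [← closure_interior_body] at hxT
    rw [inter_comm]
    exact mem_closure_iff.1 hxT _ Metric.isOpen_ball (Metric.mem_ball_self hε)
  let I : Set (Simplex d × Finset (Fin (d + 1))) := {p | p.1 ∈ J₁ ∪ J₂ ∧ p.2.card + 1 ≤ d}
  have hI : I.Finite := (hM.finite.prod finite_univ).subset fun p hp => ⟨hp.1, mem_univ _⟩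
  obtain ⟨a, ⟨haT, haB⟩, b, ⟨hbT, hbB⟩, hseg⟩ := exists_segment_disjoint hI
    (fun p => p.2.image p.1)
    (fun p hp => (Nat.add_le_add_right Finset.card_image_le 1).trans hp.2)
    (isOpen_interior.inter Metric.isOpen_ball) (isOpen_interior.inter Metric.isOpen_ball)
    (hne T₁ hxT₁) (hne T₂ hxT₂)
  have hsegB : segment ℝ a b ⊆ Metric.ball x ε := (convex_ball x ε).segment_subset haB hbB
  have hcov : segment ℝ a b ⊆ region J₁ ∪ region J₂ := by
    rw [← IsoMesh.region_union J₁ J₂, hM.region_union]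
    exact fun z hz => subset_closure (hball (hsegB hz)).1
  -- the connected segment has a point in both regions
  obtain ⟨z, hz, hz1, hz2⟩ := isPreconnected_closed_iff.1 (convex_segment a b).isPreconnected
    _ _ (isClosed_region hM.finite₁) (isClosed_region hM.finite₂) hcov
    ⟨a, left_mem_segment ℝ a b, body_subset_region hT₁ (interior_subset haT)⟩
    ⟨b, right_mem_segment ℝ a b, body_subset_region hT₂ (interior_subset hbT)⟩
  obtain ⟨T, hT, hzT⟩ := mem_iUnion₂.1 hz1
  obtain ⟨T', hT', hzT'⟩ := mem_iUnion₂.1 hz2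
  have hTT' : T ≠ T' := fun heq => Set.disjoint_left.1 hM.disjoint hT (heq ▸ hT')
  obtain ⟨s, t, hs, -, h1, -⟩ := hM.admissible T (Or.inl hT) T' (Or.inr hT') hTT'
  have hzs : z ∈ face T s := h1 ▸ ⟨hzT, hzT'⟩
  have hcard : s.card < d + 1 := by
    obtain ⟨l, hl⟩ : ∃ l, l ∉ s := by
      by_contra! hall
      exact hs (Finset.eq_univ_iff_forall.2 hall)
    simpa using Finset.card_lt_univ_of_notMem hl
  by_cases hsd : s.card = d
  · obtain ⟨j, hj⟩ : ∃ j, sᶜ = {j} := by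
      rw [← Finset.card_eq_one, Finset.card_compl, Fintype.card_fin, hsd]
      omega
    have hsj : s = {j}ᶜ := by rw [← hj, compl_compl]
    have hfac : body T ∩ body T' = facet T j := by rw [h1, hsj]; rfl
    refine (hball (hsegB hz)).2 (mem_iUnion₂.2 ⟨(T, j), ⟨hT, T', hT', hfac⟩, ?_⟩)
    change z ∈ facet T j
    rw [← hfac]
    exact ⟨hzT, hzT'⟩
  · have hsd' : s.card + 1 ≤ d := by omega
    refine hseg (T, s) ⟨Or.inl hT, hsd'⟩ z hz ?_
    simpa [face] using hzs

end mesh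

/-! ### Extension of elementwise maps to the whole space -/

/-- A map that is the identity outside a mesh, and a Lipschitz perturbation of the identity on
each simplex, is a bi-Lipschitz homeomorphism of the whole space. -/
lemma exists_homeomorph_of_region {d : ℕ} {J : Set (Simplex d)} (hJ : J.Finite) {f : E d → E d}
    (hid : ∀ x ∈ closure (region J)ᶜ, f x = x)
    (hlip : ∀ T ∈ J, ∀ x ∈ body T, ∀ y ∈ body T,
      ‖(f x - x) - (f y - y)‖ ≤ 1 / 2 * ‖x - y‖) :
    ∃ H : E d ≃ₜ E d, (∀ x, H x = f x) ∧ IsBiLipschitz H := by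
  refine exists_homeomorph_of_lipschitz_sub_id ?_
  have : Finite J := hJ
  refine lipschitzWith_of_finite_closed_cover (ι := Option J)
    (C := fun i => i.elim (closure (region J)ᶜ) fun T => body T.1) ?_ ?_ ?_
  · rintro (_ | T)
    · exact isClosed_closure
    · exact isClosed_body T.1
  · refine eq_univ_of_forall fun x => ?_
    by_cases hx : x ∈ region J
    · obtain ⟨T, hT, hxT⟩ := mem_iUnion₂.1 hx
      exact mem_iUnion.2 ⟨some ⟨T, hT⟩, hxT⟩
    · exact mem_iUnion.2 ⟨none, subset_closure hx⟩
  · rintro (_ | T)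
    · refine LipschitzOnWith.of_dist_le_mul fun x hx y hy => ?_
      rw [hid x hx, hid y hy, sub_self, sub_self, dist_self]
      positivity
    · refine LipschitzOnWith.of_dist_le_mul fun x hx y hy => ?_
      rw [dist_eq_norm, dist_eq_norm]
      have := hlip T.1 T.2 x hx y hy
      norm_num at this ⊢
      exact this

/-! ### The two homeomorphisms attached to a fine mesh -/

/-- The elementwise interpolants of `Ψ`, continued by the identity outside the mesh. -/
def globalCurve {d : ℕ} (k : ℕ) (Γ : Set (E d)) (J : Set (Simplex d)) (x : E d) : E d :=
  open Classical in if hx : ∃ T ∈ J, x ∈ body T then curve k Γ J hx.choose x else x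

lemma globalCurve_eq {d k : ℕ} (hk : 1 ≤ k) {Γ : Set (E d)} {J : Set (Simplex d)}
    (hJ : ∀ T ∈ J, ∀ T' ∈ J, MeetInFace T T') {T : Simplex d} (hT : T ∈ J) {x : E d}
    (hx : x ∈ body T) : globalCurve k Γ J x = curve k Γ J T x := by
  have hex : ∃ T ∈ J, x ∈ body T := ⟨T, hT, hx⟩
  rw [globalCurve, dif_pos hex]
  exact (hJ _ hex.choose_spec.1 T hT).interp_eq hk _ hex.choose_spec.2 hx

lemma globalCurve_of_notMem {d k : ℕ} {Γ : Set (E d)} {J : Set (Simplex d)} {x : E d}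
    (hx : x ∉ region J) : globalCurve k Γ J x = x := by
  rw [globalCurve, dif_neg]
  simpa [region] using hx

/-- The estimates that hold on a sufficiently fine mesh: `Ψ` and its interpolant differ from the
identity by at most `e`, the differences have Lipschitz constant at most `1 / 2` on each simplex,
and the simplices at `closure Ω₁` do not reach the boundary of `Ω`. -/
structure IsFineMesh {d : ℕ} (k : ℕ) (Ω Ω₁ Γ : Set (E d)) (h κ e : ℝ) (J₁ J₂ : Set (Simplex d)) :
    Prop where
  mesh : IsInitialMesh Ω Ω₁ Γ h κ J₁ J₂
  contDiffOn : ∀ T ∈ J₁ ∪ J₂, ContDiffOn ℝ ((k + 1 : ℕ) : WithTop ℕ∞) (psiOn k Γ T) (body T)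
  psiOn_sub_le : ∀ T ∈ J₁ ∪ J₂, ∀ x ∈ body T, ‖psiOn k Γ T x - x‖ ≤ e
  psiOn_lipschitz : ∀ T ∈ J₁ ∪ J₂, ∀ x ∈ body T, ∀ y ∈ body T,
    ‖(psiOn k Γ T x - x) - (psiOn k Γ T y - y)‖ ≤ 1 / 2 * ‖x - y‖
  curve_sub_le : ∀ T ∈ J₁ ∪ J₂, ∀ x ∈ body T, ‖curve k Γ (J₁ ∪ J₂) T x - x‖ ≤ e
  curve_fderiv_le : ∀ T ∈ J₁ ∪ J₂, ∀ x ∈ body T,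
    ‖fderiv ℝ (fun z => curve k Γ (J₁ ∪ J₂) T z - z) x‖ ≤ 1 / 2
  lt_dist : ∀ x ∈ closure Ω₁, ∀ y ∉ Ω, 2 * h < dist x y

section fine

variable {d k : ℕ} {Ω Ω₁ Γ : Set (E d)} {h κ e : ℝ} {J₁ J₂ : Set (Simplex d)}

lemma IsInitialMesh.diam_le (hM : IsInitialMesh Ω Ω₁ Γ h κ J₁ J₂) {T : Simplex d}
    (hT : T ∈ J₁ ∪ J₂) : Metric.diam (body T) ≤ 2 * h := by
  rcases hT with hT | hT
  · have := hM.diam₁ T hT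
    have := hM.h_pos
    linarith
  · exact hM.diam₂ T hT

/-- A map that moves only the simplices with a vertex on `Γ` is a homeomorphism that maps `Ω`
onto itself. -/
lemma IsFineMesh.exists_homeomorph (hF : IsFineMesh k Ω Ω₁ Γ h κ e J₁ J₂) (hΩ : IsOpen Ω)
    (hΓΩ₁ : Γ ⊆ closure Ω₁) {f : E d → E d} (hid : ∀ x ∉ region (J₁ ∪ J₂), f x = x)
    (hT : ∀ T ∈ J₁ ∪ J₂, onInterface Γ T = ∅ → ∀ x ∈ body T, f x = x)
    (hlip : ∀ T ∈ J₁ ∪ J₂, ∀ x ∈ body T, ∀ y ∈ body T,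
      ‖(f x - x) - (f y - y)‖ ≤ 1 / 2 * ‖x - y‖) :
    ∃ H : E d ≃ₜ E d, (∀ x, H x = f x) ∧ IsBiLipschitz H ∧ H '' Ω = Ω := by
  have hM := hF.mesh
  have hout : ∀ x ∉ Ω, f x = x := by
    intro x hx
    by_cases hxR : x ∈ region (J₁ ∪ J₂)
    · obtain ⟨T, hTJ, hxT⟩ := mem_iUnion₂.1 hxR
      refine hT T hTJ ?_ x hxT
      refine Finset.eq_empty_of_forall_notMem fun j hj => ?_
      rw [mem_onInterface] at hj
      have h1 := hF.lt_dist _ (hΓΩ₁ hj) x hx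
      have h2 := dist_le_diam_body (vertex_mem_body T j) hxT
      exact absurd (h2.trans (hM.diam_le hTJ)) (not_le.2 h1)
    · exact hid x hxR
  have hcl : ∀ x ∈ closure (region (J₁ ∪ J₂))ᶜ, f x = x := by
    refine fun x hx => hout x fun hxΩ => ?_
    rw [hM.region_union] at hx
    obtain ⟨y, hy, hyc⟩ := mem_closure_iff.1 hx Ω hΩ hxΩ
    exact hyc (subset_closure hy)
  obtain ⟨H, hH, hL⟩ := exists_homeomorph_of_region hM.finite hcl hlip
  refine ⟨H, hH, hL, ?_⟩
  have hc : H '' Ωᶜ = Ωᶜ := by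
    have hfix : EqOn H id Ωᶜ := fun x hx => (hH x).trans (hout x hx)
    rw [hfix.image_eq, image_id]
  rw [image_compl_eq H.bijective] at hc
  exact compl_injective hc

lemma psiOn_of_onInterface_empty {T : Simplex d} (hT : onInterface Γ T = ∅) (x : E d) :
    psiOn k Γ T x = x := psiOn_of_card_lt (by simp [hT]) x

lemma IsFineMesh.psi_eq (hF : IsFineMesh k Ω Ω₁ Γ h κ e J₁ J₂) (hc : IsCompact Γ)
    {T : Simplex d} (hT : T ∈ J₁ ∪ J₂) {x : E d} (hx : x ∈ body T) :
    psi k Γ (J₁ ∪ J₂) x = psiOn k Γ T x :=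
  psi_eq_psiOn hc (fun _ hT _ hT' => hF.mesh.meetInFace hT hT') hT hx

lemma IsFineMesh.globalCurve_eq (hF : IsFineMesh k Ω Ω₁ Γ h κ e J₁ J₂) (hk : 1 ≤ k)
    {T : Simplex d} (hT : T ∈ J₁ ∪ J₂) {x : E d} (hx : x ∈ body T) :
    globalCurve k Γ (J₁ ∪ J₂) x = curve k Γ (J₁ ∪ J₂) T x :=
  IsoMesh.globalCurve_eq hk (fun _ hT _ hT' => hF.mesh.meetInFace hT hT') hT hx

/-- `Ψ` is a homeomorphism of the whole space. -/
lemma IsFineMesh.exists_homeomorph_psi (hF : IsFineMesh k Ω Ω₁ Γ h κ e J₁ J₂) (hΩ : IsOpen Ω)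
    (hc : IsCompact Γ) (hΓΩ₁ : Γ ⊆ closure Ω₁) :
    ∃ H : E d ≃ₜ E d, (∀ x, H x = psi k Γ (J₁ ∪ J₂) x) ∧ IsBiLipschitz H ∧ H '' Ω = Ω := by
  refine hF.exists_homeomorph hΩ hΓΩ₁ (fun x hx => psi_of_notMem hx) (fun T hT h0 x hx => ?_)
    (fun T hT x hx y hy => ?_)
  · rw [hF.psi_eq hc hT hx, psiOn_of_onInterface_empty h0]
  · rw [hF.psi_eq hc hT hx, hF.psi_eq hc hT hy]
    exact hF.psiOn_lipschitz T hT x hx y hy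

/-- The interpolant of `Ψ` is a homeomorphism of the whole space. -/
lemma IsFineMesh.exists_homeomorph_curve (hF : IsFineMesh k Ω Ω₁ Γ h κ e J₁ J₂) (hk : 1 ≤ k)
    (hΩ : IsOpen Ω) (hc : IsCompact Γ) (hΓΩ₁ : Γ ⊆ closure Ω₁) :
    ∃ H : E d ≃ₜ E d, (∀ x, H x = globalCurve k Γ (J₁ ∪ J₂) x) ∧ IsBiLipschitz H ∧
      H '' Ω = Ω := by
  refine hF.exists_homeomorph hΩ hΓΩ₁ (fun x hx => globalCurve_of_notMem hx)
    (fun T hT h0 x hx => ?_) (fun T hT x hx y hy => ?_)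
  · rw [hF.globalCurve_eq hk hT hx]
    have h1 : ∀ α : NodeIndex k d,
        psi k Γ (J₁ ∪ J₂) (node k T α.1) - node k T α.1 = 0 := fun α => by
      rw [hF.psi_eq hc hT (node_mem_body hk T α), psiOn_of_onInterface_empty h0, sub_self]
    have h2 := interp_sub_id hk T (psi k Γ (J₁ ∪ J₂)) x
    simp only [h1, smul_zero, Finset.sum_const_zero] at h2
    exact sub_eq_zero.1 h2
  · rw [hF.globalCurve_eq hk hT hx, hF.globalCurve_eq hk hT hy]
    refine (convex_body T).norm_image_sub_le_of_norm_fderiv_le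
      (f := fun z => curve k Γ (J₁ ∪ J₂) T z - z) (fun z _ => ?_)
      (hF.curve_fderiv_le T hT) hy hx
    exact (((contDiff_interp (n := 1) T _).sub contDiff_id).differentiable one_ne_zero) z

/-! ### The image of the straight mesh under `Ψ` -/

/-- On a face with at least two vertices, all on `Γ`, the map `Ψ` is the closest point map. -/
lemma psiOn_mem_of_mem_face (hc : IsCompact Γ) {T : Simplex d} {s : Finset (Fin (d + 1))}
    (hs : ∀ i ∈ s, T i ∈ Γ) (hcard : 2 ≤ s.card) {x : E d} (hx : x ∈ face T s) :
    psiOn k Γ T x ∈ Γ := by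
  have hsub : s ⊆ onInterface Γ T := fun i hi => mem_onInterface.2 (hs i hi)
  obtain ⟨-, hx0⟩ := (mem_face_iff T s x).1 hx
  have hμ : muTilde Γ T x = 1 := by
    rw [← T.sum_coord_apply_eq_one x]
    exact Finset.sum_subset (Finset.subset_univ _) fun i _ hi => hx0 i fun h => hi (hsub h)
  have hy : yPoint Γ T x = x := by
    conv_rhs => rw [← T.linear_combination_coord_eq_self x]
    rw [yPoint, hμ]
    simp only [div_one]
    refine Finset.sum_subset (Finset.subset_univ _) fun i _ hi => ?_
    rw [hx0 i fun h => hi (hsub h), zero_smul]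
  rw [psiOn_of_card (hcard.trans (Finset.card_le_card hsub)), hμ, hy, one_pow, one_smul,
    add_sub_cancel]
  obtain ⟨i, hi⟩ := Finset.card_pos.1 (show 0 < s.card by omega)
  exact (nearestPoint_spec hc ⟨T i, hs i hi⟩ x).1

lemma IsFineMesh.psi_mem_of_mem_straightInterface (hF : IsFineMesh k Ω Ω₁ Γ h κ e J₁ J₂)
    (hd : 2 ≤ d) (hc : IsCompact Γ) {x : E d} (hx : x ∈ straightInterface J₁ J₂) :
    psi k Γ (J₁ ∪ J₂) x ∈ Γ := by
  obtain ⟨p, hp, hxp⟩ := mem_iUnion₂.1 hx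
  rw [hF.psi_eq hc (Or.inl hp.1) (face_subset_body _ _ hxp)]
  refine psiOn_mem_of_mem_face hc (fun i hi => hF.mesh.interface_vertices p hp i ?_) ?_ hxp
  · simpa using hi
  · rw [Finset.card_compl, Fintype.card_fin, Finset.card_singleton]
    omega

/-- No simplex has all its vertices on `Γ`: otherwise `Ψ` would map its interior onto an open
subset of `Γ`. -/
lemma IsFineMesh.exists_vertex_notMem (hF : IsFineMesh k Ω Ω₁ Γ h κ e J₁ J₂)
    (hd : 2 ≤ d) (hc : IsCompact Γ) (hΩ : IsOpen Ω) (hΩ₁ : IsOpen Ω₁) (hfr : frontier Ω₁ = Γ)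
    {T : Simplex d} (hT : T ∈ J₁ ∪ J₂) : ∃ j, T j ∉ Γ := by
  by_contra! hall
  obtain ⟨H, hH, -, -⟩ := hF.exists_homeomorph_psi hΩ hc
    (hfr ▸ frontier_subset_closure)
  have hsub : H '' interior (body T) ⊆ Γ := by
    rintro _ ⟨x, hx, rfl⟩
    rw [hH, hF.psi_eq hc hT (interior_subset hx)]
    refine psiOn_mem_of_mem_face (s := Finset.univ) hc (fun i _ => hall i) ?_ ?_
    · rw [Finset.card_univ, Fintype.card_fin]; omega
    · simpa [face, body] using interior_subset hx
  have hint : interior Γ = ∅ := by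
    rw [← hfr, ← frontier_compl]
    exact interior_frontier hΩ₁.isClosed_compl
  have hopen : IsOpen (H '' interior (body T)) := H.isOpenMap _ isOpen_interior
  obtain ⟨x, hx⟩ := (interior_body_nonempty T).image H
  have := interior_maximal hsub hopen hx
  rw [hint] at this
  exact this

/-- A vertex off `Γ` is a fixed point of `Ψ`. -/
lemma psiOn_vertex {T : Simplex d} {j : Fin (d + 1)} (hj : T j ∉ Γ) :
    psiOn k Γ T (T j) = T j := by
  have hμ : muTilde Γ T (T j) = 0 := by
    refine Finset.sum_eq_zero fun i hi => ?_
    rw [mem_onInterface] at hi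
    refine T.coord_apply_ne fun hij => hj (hij ▸ hi)
  simp [psiOn, hμ]

lemma IsFineMesh.region₁_subset (hF : IsFineMesh k Ω Ω₁ Γ h κ e J₁ J₂) : region J₁ ⊆ Ω := by
  refine iUnion₂_subset fun T hT x hx => ?_
  by_contra hxΩ
  have h1 := hF.lt_dist _ (hF.mesh.vertices₁ T hT 0) x hxΩ
  have h2 := dist_le_diam_body (vertex_mem_body T 0) hx
  exact absurd (h2.trans (hF.mesh.diam_le (Or.inl hT))) (not_le.2 h1)

lemma IsFineMesh.region_inter (hF : IsFineMesh k Ω Ω₁ Γ h κ e J₁ J₂) (hΩ : IsOpen Ω) :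
    region J₁ ∩ region J₂ = straightInterface J₁ J₂ :=
  Subset.antisymm (fun _ hx => hF.mesh.inter_subset_straightInterface hΩ
    ⟨hx, hF.region₁_subset hx.1⟩) straightInterface_subset

/-- The homeomorphism `Ψ` maps the straight interface onto `Γ`, and the two regions of the
straight mesh onto the closures of `Ω₁` and of its complement in `Ω`. -/
lemma IsFineMesh.image_psi (hF : IsFineMesh k Ω Ω₁ Γ h κ e J₁ J₂) (hd : 2 ≤ d)
    (hΩ : IsOpen Ω) (hΩ₁ : IsOpen Ω₁) (hΩ₁c : IsConnected Ω₁) (hc : IsCompact Γ)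
    (hfr : frontier Ω₁ = Γ) (hΓW : Γ ⊆ closure (closure Ω₁)ᶜ) {δ : ℝ} (hδ : h + e < δ)
    (hdepth : ∀ w ∈ (closure Ω₁)ᶜ, ∃ C : Set (E d), IsPreconnected C ∧ C ⊆ (closure Ω₁)ᶜ ∧
      w ∈ C ∧ ∃ z ∈ C, δ ≤ Metric.infDist z (closure Ω₁))
    {H : E d ≃ₜ E d} (hH : ∀ x, H x = psi k Γ (J₁ ∪ J₂) x) (hHΩ : H '' Ω = Ω) :
    H '' straightInterface J₁ J₂ = Γ ∧ H '' region J₁ = closure Ω₁ ∧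
      H '' region J₂ = closure (Ω \ Ω₁) := by
  have hM := hF.mesh
  have hΓ₁ : Disjoint Ω₁ Γ := by
    rw [← hfr, hΩ₁.frontier_eq]
    exact disjoint_sdiff_right
  have hΓcl : Γ ⊆ closure Ω₁ := hfr ▸ frontier_subset_closure
  have hcl : ∀ x ∈ closure Ω₁, x ∉ Γ → x ∈ Ω₁ := by
    intro x hx hxΓ
    by_contra hx1
    exact hxΓ (hfr ▸ hΩ₁.frontier_eq ▸ ⟨hx, hx1⟩)
  have hI : ∀ x ∈ straightInterface J₁ J₂, H x ∈ Γ := fun x hx => by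
    rw [hH]; exact hF.psi_mem_of_mem_straightInterface hd hc hx
  -- off the interface, the inner region is the complement of the outer one in `Ω`
  have hopen : IsOpen (region J₁ \ straightInterface J₁ J₂) := by
    have : region J₁ \ straightInterface J₁ J₂ = Ω \ region J₂ := by
      rw [← hF.region_inter hΩ]
      ext x
      constructor
      · exact fun hx => ⟨hF.region₁_subset hx.1, fun h2 => hx.2 ⟨hx.1, h2⟩⟩
      · intro hx
        refine ⟨?_, fun h2 => hx.2 h2.2⟩
        have : x ∈ region J₁ ∪ region J₂ := by
          rw [← IsoMesh.region_union J₁ J₂, hM.region_union]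
          exact subset_closure hx.1
        exact this.resolve_right hx.2
    rw [this]
    exact hΩ.sdiff (isClosed_region hM.finite₂)
  obtain ⟨U, hU⟩ : ∃ U, U = H '' (region J₁ \ straightInterface J₁ J₂) := ⟨_, rfl⟩
  obtain ⟨V, hV⟩ : ∃ V, V = H '' (region J₁)ᶜ := ⟨_, rfl⟩
  have hUo : IsOpen U := hU ▸ H.isOpenMap _ hopen
  have hVo : IsOpen V := hV ▸ H.isOpenMap _ (isClosed_region hM.finite₁).isOpen_compl
  have hUV : Disjoint U V := by
    rw [hU, hV, disjoint_image_iff H.injective]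
    exact disjoint_compl_right.mono_left sdiff_subset
  have hcov : ∀ x ∉ Γ, x ∈ U ∪ V := by
    intro x hx
    obtain ⟨y, rfl⟩ := H.surjective x
    by_cases hy : y ∈ region J₁
    · exact Or.inl (hU ▸ ⟨y, ⟨hy, fun hyI => hx (hI y hyI)⟩, rfl⟩)
    · exact Or.inr (hV ▸ ⟨y, hy, rfl⟩)
  -- the interior of the inner region covers `Ω₁`, since it contains a fixed vertex
  have hΩU : Ω₁ ⊆ U := by
    obtain ⟨T, hT⟩ := hM.nonempty₁
    obtain ⟨j, hj⟩ := hF.exists_vertex_notMem hd hc hΩ hΩ₁ hfr (Or.inl hT)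
    have hfix : H (T j) = T j := by
      rw [hH, hF.psi_eq hc (Or.inl hT) (vertex_mem_body T j), psiOn_vertex hj]
    refine hΩ₁c.isPreconnected.subset_left_of_subset_union hUo hVo hUV
      (fun x hx => hcov x (Set.disjoint_left.1 hΓ₁ hx)) ⟨T j, hcl _ (hM.vertices₁ T hT j) hj, ?_⟩
    rw [hU]
    refine ⟨T j, ⟨body_subset_region hT (vertex_mem_body T j), fun hjI => hj ?_⟩, hfix⟩
    exact hfix ▸ hI _ hjI
  -- a point beyond `closure Ω₁` would drag along points far away from `Ω₁`
  have hsub : H '' region J₁ ⊆ closure Ω₁ := by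
    rintro _ ⟨x, hx, rfl⟩
    by_contra hw
    obtain ⟨C, hCc, hCW, hwC, z, hz, hzδ⟩ := hdepth _ hw
    have hCU : C ⊆ U := by
      refine hCc.subset_left_of_subset_union hUo hVo hUV
        (fun y hy => hcov y fun hyΓ => hCW hy (hΓcl hyΓ)) ⟨_, hwC, ?_⟩
      exact hU ▸ ⟨x, ⟨hx, fun hxI => hw (hΓcl (hI x hxI))⟩, rfl⟩
    obtain ⟨y, ⟨hy, -⟩, rfl⟩ : z ∈ H '' (region J₁ \ straightInterface J₁ J₂) := hU ▸ hCU hz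
    obtain ⟨T, hT, hyT⟩ := mem_iUnion₂.1 hy
    have h1 : dist (H y) y ≤ e := by
      rw [hH, hF.psi_eq hc (Or.inl hT) hyT, dist_eq_norm]
      exact hF.psiOn_sub_le T (Or.inl hT) y hyT
    have h2 : dist y (T 0) ≤ h :=
      (dist_le_diam_body hyT (vertex_mem_body T 0)).trans (hM.diam₁ T hT)
    have h3 := Metric.infDist_le_dist_of_mem (x := H y) (hM.vertices₁ T hT 0)
    have h4 := dist_triangle (H y) y (T 0)
    linarith
  have hR₁ : H '' region J₁ = closure Ω₁ := by
    refine Subset.antisymm hsub (closure_minimal (hΩU.trans ?_) ?_)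
    · rw [hU]
      exact image_mono sdiff_subset
    · exact H.isClosedMap _ (isClosed_region hM.finite₁)
  refine ⟨Subset.antisymm (image_subset_iff.2 hI) fun x hx => ?_, hR₁, ?_⟩
  · have hx1 : x ∈ H '' region J₁ := hR₁ ▸ hΓcl hx
    obtain ⟨y, hy, rfl⟩ := hx1
    by_contra hyI
    have hyU : H y ∈ U := hU ▸ ⟨y, ⟨hy, fun h' => hyI ⟨y, h', rfl⟩⟩, rfl⟩
    obtain ⟨w, hwU, hw⟩ := mem_closure_iff.1 (hΓW hx) U hUo hyU
    refine hw (hsub ?_)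
    rw [hU] at hwU
    exact image_mono sdiff_subset hwU
  · rw [hM.region₂, H.image_closure, image_sdiff H.injective, hHΩ, hR₁]
    refine Subset.antisymm (closure_mono (sdiff_subset_sdiff_right subset_closure))
      (closure_minimal (fun x hx => ?_) isClosed_closure)
    by_cases hxc : x ∈ closure Ω₁
    · have hxΓ : x ∈ Γ := by
        by_contra hxΓ
        exact hx.2 (hcl x hxc hxΓ)
      refine mem_closure_iff.2 fun O hO hxO => ?_
      obtain ⟨y, hy, hyW⟩ := mem_closure_iff.1 (hΓW hxΓ) (O ∩ Ω) (hO.inter hΩ) ⟨hxO, hx.1⟩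
      exact ⟨y, hy.1, hy.2, hyW⟩
    · exact subset_closure ⟨hx.1, hxc⟩

end fine

/-! ### Curved bulk and surface elements -/

/-- The linear part of the affine map with prescribed vertices. -/
def vertexLin {m n : ℕ} (v : Fin (m + 1) → E n) : E m →L[ℝ] E n :=
  ∑ i : Fin m, (EuclideanSpace.proj i : E m →L[ℝ] ℝ).smulRight (v i.succ - v 0)

lemma vertexMap_eq_vertexLin_add {m n : ℕ} (v : Fin (m + 1) → E n) (x : E m) :
    vertexMap v x = vertexLin v x + v 0 := by
  have h : vertexLin v x = ∑ i : Fin m, x i • (v i.succ - v 0) := by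
    simp [vertexLin, sum_apply]
  rw [h, vertexMap, Fin.sum_univ_succ]
  simp only [refBary_zero, refBary_succ, smul_sub, Finset.sum_sub_distrib, sub_smul, one_smul,
    Finset.sum_smul]
  abel

lemma vertexLin_injective {m n : ℕ} {v : Fin (m + 1) → E n} (hv : AffineIndependent ℝ v) :
    Function.Injective (vertexLin v) := by
  intro x y hxy
  refine vertexMap_injective hv ?_
  rw [vertexMap_eq_vertexLin_add, vertexMap_eq_vertexLin_add, hxy]

lemma hasFDerivAt_vertexMap {m n : ℕ} (v : Fin (m + 1) → E n) (x : E m) :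
    HasFDerivAt (vertexMap v) (vertexLin v) x := by
  have : vertexMap v = fun x => vertexLin v x + v 0 := funext (vertexMap_eq_vertexLin_add v)
  rw [this]
  exact (vertexLin v).hasFDerivAt.add_const _

/-- The linear part of the reference map of a simplex, as an isomorphism. -/
def refEquiv {d : ℕ} (T : Simplex d) : E d ≃L[ℝ] E d :=
  (LinearEquiv.ofInjectiveEndo (vertexLin T : E d →ₗ[ℝ] E d)
    (vertexLin_injective T.ind)).toContinuousLinearEquiv

lemma refEquiv_apply {d : ℕ} (T : Simplex d) (x : E d) : refEquiv T x = vertexLin T x := rfl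

/-- The reference map of a simplex as a homeomorphism of the whole space. -/
def refHomeomorph {d : ℕ} (T : Simplex d) : E d ≃ₜ E d :=
  (refEquiv T).toHomeomorph.trans (Homeomorph.addRight (T 0))

lemma refHomeomorph_apply {d : ℕ} (T : Simplex d) (x : E d) :
    refHomeomorph T x = refMap T x := (vertexMap_eq_vertexLin_add T x).symm

lemma norm_refEquiv_pos {d : ℕ} (hd : 1 ≤ d) (T : Simplex d) :
    0 < ‖(refEquiv T : E d →L[ℝ] E d)‖ := by
  have : Nontrivial (E d) := by
    have : Nonempty (Fin d) := ⟨⟨0, hd⟩⟩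
    infer_instance
  refine norm_pos_iff.2 fun h0 => ?_
  obtain ⟨x, hx⟩ := exists_ne (0 : E d)
  refine hx ((refEquiv T).injective ?_)
  have := congrArg (fun L : E d →L[ℝ] E d => L x) h0
  simpa using this

/-- A smooth map that is close to the identity on a simplex, and is there the restriction of a
homeomorphism, transports the reference element of the simplex to a curved bulk element. -/
lemma isBulkElement_comp_refMap {d k : ℕ} (hd : 1 ≤ d) (hk : 1 ≤ k) {T : Simplex d}
    {G : E d → E d} (hG : ContDiff ℝ ((k + 1 : ℕ) : WithTop ℕ∞) G)
    (hfd : ∀ x ∈ body T, ‖fderiv ℝ (fun z => G z - z) x‖ ≤ 1 / 2) (H : E d ≃ₜ E d)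
    (hH : ∀ x ∈ body T, H x = G x) : IsBulkElement k (G ∘ refMap T) := by
  have heq : ∀ x ∈ refSimplex d, (G ∘ refMap T) x = ((refHomeomorph T).trans H) x := by
    intro x hx
    rw [Homeomorph.trans_apply, refHomeomorph_apply]
    exact (hH _ (vertexMap_mem_body T hx)).symm
  have himg : ∀ s ⊆ refSimplex d, (G ∘ refMap T) '' s = ((refHomeomorph T).trans H) '' s :=
    fun s hs => image_congr fun x hx => heq x (hs hx)
  have hinj : InjOn (G ∘ refMap T) (refSimplex d) := by
    intro x hx y hy hxy
    rw [heq x hx, heq y hy] at hxy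
    exact ((refHomeomorph T).trans H).injective hxy
  have hT : ContDiff ℝ ((k + 1 : ℕ) : WithTop ℕ∞) (refMap T) := contDiff_vertexMap T
  have hg : ContDiff ℝ ((k + 1 : ℕ) : WithTop ℕ∞) fun z => G z - z := hG.sub contDiff_id
  have hΦ : ContDiff ℝ ((k + 1 : ℕ) : WithTop ℕ∞) fun x => G (refMap T x) - refMap T x :=
    hg.comp hT
  have hk0 : ((k + 1 : ℕ) : WithTop ℕ∞) ≠ 0 := by
    exact_mod_cast Nat.succ_ne_zero k
  refine ⟨(hG.comp hT).contDiffOn, hinj, ⟨refEquiv T, T 0,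
    fun x => G (refMap T x) - refMap T x, fun x => ?_, ⟨1 / 2, by norm_num, fun x hx => ?_⟩,
    fun n _ hn => ?_⟩, ?_, ?_, mapElement_isUnisolvent hk hinj⟩
  · rw [refEquiv_apply, ← vertexMap_eq_vertexLin_add]
    exact (add_sub_cancel _ _).symm
  · have hd1 : HasFDerivAt (fun x => G (refMap T x) - refMap T x)
        ((fderiv ℝ (fun z => G z - z) (refMap T x)).comp (vertexLin T)) x :=
      HasFDerivAt.comp (g := fun z => G z - z) x
        ((hg.differentiable hk0) (refMap T x)).hasFDerivAt (hasFDerivAt_vertexMap T x)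
    rw [hd1.hasFDerivWithinAt.fderivWithin (uniqueDiffOn_refSimplex d x hx)]
    have hcomp : ((fderiv ℝ (fun z => G z - z) (refMap T x)).comp (vertexLin T)).comp
        ((refEquiv T).symm : E d →L[ℝ] E d) = fderiv ℝ (fun z => G z - z) (refMap T x) := by
      ext1 y
      change fderiv ℝ (fun z => G z - z) (refMap T x) (refEquiv T ((refEquiv T).symm y)) = _
      rw [ContinuousLinearEquiv.apply_symm_apply]
    rw [hcomp]
    exact hfd _ (vertexMap_mem_body T hx)
  · -- the higher derivatives are bounded on the compact reference simplex
    obtain ⟨B, hB⟩ := (isCompact_refSimplex d).exists_bound_of_continuousOn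
      (hΦ.contDiffOn.continuousOn_iteratedFDerivWithin (m := n) (by exact_mod_cast hn)
        (uniqueDiffOn_refSimplex d))
    have hA := pow_pos (norm_refEquiv_pos hd T) n
    refine ⟨B / ‖(refEquiv T : E d →L[ℝ] E d)‖ ^ n, fun x hx => ?_⟩
    rw [div_mul_cancel₀ _ hA.ne']
    exact hB x hx
  · rw [himg _ Subset.rfl, ← Homeomorph.image_interior]
    exact (interior_refSimplex_nonempty d).image _
  · rw [himg _ Subset.rfl, ← Homeomorph.image_frontier, frontier_refSimplex, image_iUnion]
    exact iUnion_congr fun j => (himg _ fun x hx => hx.1).symm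

lemma affineIndependent_facet {m : ℕ} (p : Simplex (m + 1) × Fin (m + 2)) :
    AffineIndependent ℝ fun i => p.1 (p.2.succAbove i) :=
  p.1.ind.comp_embedding p.2.succAboveEmb

lemma image_facetMap {m : ℕ} (p : Simplex (m + 1) × Fin (m + 2)) :
    facetMap p '' refSimplex m = facet p.1 p.2 := by
  refine (image_refSimplex fun i => p.1 (p.2.succAbove i)).trans ?_
  rw [facet, face, Finset.coe_compl, Finset.coe_singleton, ← Fin.range_succAbove, ← range_comp]
  rfl

/-- A smooth map close to the identity on a simplex transports the reference element of a facet
to a surface element: its differential is invertible. -/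
lemma isSurfaceElement_comp_facetMap {m k : ℕ} (hk : 1 ≤ k)
    {p : Simplex (m + 1) × Fin (m + 2)} {G : E (m + 1) → E (m + 1)}
    (hG : ContDiff ℝ ((k + 1 : ℕ) : WithTop ℕ∞) G)
    (hfd : ∀ x ∈ body p.1, ‖fderiv ℝ (fun z => G z - z) x‖ ≤ 1 / 2) (hinj : InjOn G (body p.1)) :
    IsSurfaceElement k (G ∘ facetMap p) := by
  have hmem : ∀ x ∈ refSimplex m, facetMap p x ∈ body p.1 := fun x hx =>
    face_subset_body _ _ (image_facetMap p ▸ mem_image_of_mem (facetMap p) hx)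
  have hk0 : ((k + 1 : ℕ) : WithTop ℕ∞) ≠ 0 := by
    exact_mod_cast Nat.succ_ne_zero k
  have hinj' : InjOn (G ∘ facetMap p) (refSimplex m) := fun x hx y hy hxy =>
    vertexMap_injective (affineIndependent_facet p) (hinj (hmem x hx) (hmem y hy) hxy)
  refine ⟨(hG.comp (contDiff_vertexMap _)).contDiffOn, hinj', fun x hx => ?_,
    mapElement_isUnisolvent hk hinj'⟩
  have hd1 : HasFDerivAt (G ∘ facetMap p)
      ((fderiv ℝ G (facetMap p x)).comp (vertexLin fun i => p.1 (p.2.succAbove i))) x :=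
    HasFDerivAt.comp x ((hG.differentiable hk0) (facetMap p x)).hasFDerivAt
      (hasFDerivAt_vertexMap _ x)
  rw [hd1.hasFDerivWithinAt.fderivWithin (uniqueDiffOn_refSimplex m x hx)]
  refine Function.Injective.comp (g := fderiv ℝ G (facetMap p x)) ?_
    (vertexLin_injective (affineIndependent_facet p))
  -- `DG = id + D(G - id)` has trivial kernel
  have hsub : fderiv ℝ (fun z => G z - z) (facetMap p x) =
      fderiv ℝ G (facetMap p x) - ContinuousLinearMap.id ℝ _ :=
    (((hG.differentiable hk0) (facetMap p x)).hasFDerivAt.sub (hasFDerivAt_id _)).fderiv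
  refine (injective_iff_map_eq_zero _).2 fun w hw => ?_
  have h1 := (fderiv ℝ (fun z => G z - z) (facetMap p x)).le_of_opNorm_le (hfd _ (hmem x hx)) w
  have h2 : fderiv ℝ (fun z => G z - z) (facetMap p x) w = -w := by
    rw [hsub]
    simp [hw]
  rw [h2, norm_neg] at h1
  have h3 := norm_nonneg w
  exact norm_eq_zero.1 (by linarith)

/-! ### Intersections of facets -/

/-- Two facets of simplices that meet in a common face meet in a common face. -/
lemma MeetInFace.exists_facet_inter {d : ℕ} {T T' : Simplex d} (hTT' : MeetInFace T T')
    (j j' : Fin (d + 1)) :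
    ∃ s : Finset (Fin (d + 1)), j ∉ s ∧ facet T j ∩ facet T' j' = face T s := by
  classical
  refine ⟨Finset.univ.filter fun i => i ≠ j ∧ T i ∈ facet T' j', by simp, ?_⟩
  refine Subset.antisymm ?_ (subset_inter ?_ ?_)
  · rintro z ⟨hz, hz'⟩
    obtain ⟨hzT, hz0⟩ := (mem_face_iff _ _ _).1 hz
    obtain ⟨hzT', hz0'⟩ := (mem_face_iff _ _ _).1 hz'
    refine (mem_face_iff _ _ _).2 ⟨hzT, fun i hi => ?_⟩
    by_cases hij : i = j
    · exact hz0 i (by simp [hij])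
    -- compare the coefficients of the vertex `T' j'` in both representations of `z`
    have hsum := hTT'.sum_coord_smul_eq hzT hzT' fun w => if w = T' j' then (1 : ℝ) else 0
    have hL : ∑ l, T'.coord l z • (if T' l = T' j' then (1 : ℝ) else 0) = 0 := by
      refine Finset.sum_eq_zero fun l _ => ?_
      split_ifs with hl
      · rw [hz0' l (by simp [T'.ind.injective hl]), zero_smul]
      · rw [smul_zero]
    rw [hL] at hsum
    have hnn := (body_eq T ▸ hzT : z ∈ {z | ∀ j, 0 ≤ T.coord j z})
    have hzero := (Finset.sum_eq_zero_iff_of_nonneg fun l _ => smul_nonneg (hnn l)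
      (by split_ifs <;> norm_num)).1 hsum.symm i (Finset.mem_univ i)
    obtain ⟨s, t, hs, hst⟩ := hTT'
    by_cases his : i ∈ s
    · obtain ⟨b, hb, hbi⟩ := exists_vertex_eq T.ind hst his
      by_cases hbj : b = j'
      · rw [if_pos (by rw [← hbi, hbj]), smul_eq_mul, mul_one] at hzero
        exact hzero
      · refine absurd (Finset.mem_filter.2 ⟨Finset.mem_univ i, hij, ?_⟩) hi
        rw [← hbi]
        exact subset_convexHull ℝ _ ⟨b, by simpa using hbj, rfl⟩
    · have hzs : z ∈ face T s := hs ▸ ⟨hzT, hzT'⟩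
      exact ((mem_face_iff _ _ _).1 hzs).2 i his
  · refine convexHull_min ?_ (convex_convexHull ℝ _)
    rintro _ ⟨i, hi, rfl⟩
    exact subset_convexHull ℝ _ ⟨i, by simpa using (Finset.mem_filter.1 hi).2.1, rfl⟩
  · refine convexHull_min ?_ (convex_convexHull ℝ _)
    rintro _ ⟨i, hi, rfl⟩
    exact (Finset.mem_filter.1 hi).2.2

lemma eq_of_facet_subset_facet {d : ℕ} {T : Simplex d} {j j' : Fin (d + 1)}
    (h : facet T j ⊆ facet T j') : j = j' := by
  by_contra hne
  have h1 : T j' ∈ facet T j := subset_convexHull ℝ _ ⟨j', by simpa using Ne.symm hne, rfl⟩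
  have h2 := ((mem_face_iff _ _ _).1 (h h1)).2 j' (by simp)
  rw [T.coord_apply_eq] at h2
  exact one_ne_zero h2

/-- A face of a facet, in the vertex numbering of the facet. -/
lemma exists_face_facet {m : ℕ} (T : Simplex (m + 1)) (j : Fin (m + 2))
    {s : Finset (Fin (m + 2))} (hj : j ∉ s) : ∃ s' : Finset (Fin (m + 1)),
      (s' = Finset.univ → s = {j}ᶜ) ∧
      face T s = convexHull ℝ ((fun i => T (j.succAbove i)) '' s') := by
  classical
  refine ⟨Finset.univ.filter fun i => j.succAbove i ∈ s, fun hs => ?_, ?_⟩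
  · ext i
    rw [Finset.mem_compl, Finset.mem_singleton]
    refine ⟨fun hi hij => hj (hij ▸ hi), fun hi => ?_⟩
    obtain ⟨l, rfl⟩ := Fin.exists_succAbove_eq hi
    exact (Finset.mem_filter.1 (hs ▸ Finset.mem_univ l : l ∈ _)).2
  · rw [face]
    congr 1
    ext z
    constructor
    · rintro ⟨i, hi, rfl⟩
      obtain ⟨l, rfl⟩ := Fin.exists_succAbove_eq (fun hij : i = j => hj (hij ▸ hi))
      exact ⟨l, by simpa using hi, rfl⟩
    · rintro ⟨l, hl, rfl⟩
      exact ⟨j.succAbove l, by simpa using hl, rfl⟩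

lemma convexHull_range_facet {m : ℕ} (p : Simplex (m + 1) × Fin (m + 2)) :
    convexHull ℝ (range fun i => p.1 (p.2.succAbove i)) = facet p.1 p.2 := by
  rw [← image_facetMap]
  exact (image_refSimplex _).symm

/-- Two interface facets meet in a common proper face. It is proper, since a facet with all its
vertices on `Γ` lies in a single element of the inner mesh. -/
lemma IsInitialMesh.facets_admissible {m : ℕ} {Ω Ω₁ Γ : Set (E (m + 1))} {h κ : ℝ}
    {J₁ J₂ : Set (Simplex (m + 1))} (hM : IsInitialMesh Ω Ω₁ Γ h κ J₁ J₂)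
    {p q : Simplex (m + 1) × Fin (m + 2)} (hp : p ∈ interfaceFacets J₁ J₂)
    (hq : q ∈ interfaceFacets J₁ J₂) (hpq : p ≠ q) : ∃ s t : Finset (Fin (m + 1)),
      s ≠ Finset.univ ∧ t ≠ Finset.univ ∧
      convexHull ℝ (range fun i => p.1 (p.2.succAbove i)) ∩
        convexHull ℝ (range fun i => q.1 (q.2.succAbove i)) =
        convexHull ℝ ((fun i => p.1 (p.2.succAbove i)) '' s) ∧
      convexHull ℝ ((fun i => p.1 (p.2.succAbove i)) '' s) =
        convexHull ℝ ((fun i => q.1 (q.2.succAbove i)) '' t) := by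
  have hmeet := hM.meetInFace (Or.inl hp.1) (Or.inl hq.1)
  have hnot : ∀ p ∈ interfaceFacets J₁ J₂, ∀ q ∈ interfaceFacets J₁ J₂, p ≠ q →
      ¬ facet p.1 p.2 ⊆ facet q.1 q.2 := by
    intro p hp q hq hpq hsub
    have h1 : q.1 = p.1 := hM.boundary_facet J₁ (Or.inl rfl) p.1 hp.1 p.2
      (hM.interface_vertices p hp) q.1 hq.1 (hsub.trans (face_subset_body _ _))
    rw [h1] at hsub
    exact hpq (Prod.ext h1.symm (eq_of_facet_subset_facet hsub))
  obtain ⟨s, hjs, hs⟩ := hmeet.exists_facet_inter p.2 q.2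
  obtain ⟨t, hjt, ht⟩ := hmeet.symm.exists_facet_inter q.2 p.2
  obtain ⟨s', hs', hsf⟩ := exists_face_facet p.1 p.2 hjs
  obtain ⟨t', ht', htf⟩ := exists_face_facet q.1 q.2 hjt
  refine ⟨s', t', fun hu => ?_, fun hu => ?_, ?_, ?_⟩
  · refine hnot p hp q hq hpq ?_
    have : facet p.1 p.2 ∩ facet q.1 q.2 = facet p.1 p.2 := by rw [hs, hs' hu]; rfl
    exact this ▸ inter_subset_right
  · refine hnot q hq p hp hpq.symm ?_
    have : facet q.1 q.2 ∩ facet p.1 p.2 = facet q.1 q.2 := by rw [ht, ht' hu]; rfl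
    exact this ▸ inter_subset_right
  · rw [convexHull_range_facet, convexHull_range_facet, hs, hsf]
  · rw [← hsf, ← htf, ← hs, ← ht, inter_comm]

/-! ### The curved mesh as the image of the straight mesh -/

/-- Sufficiently small mesh sizes are fine, with displacements of the order of `h`. -/
lemma exists_isFineMesh {d k : ℕ} (hk : 1 ≤ k) {Ω Ω₁ Γ : Set (E d)} (hΩ : IsOpen Ω)
    (hΓ : IsClosedHypersurface (k + 2) Γ) (hΩ₁ : IsCompact (closure Ω₁))
    (hΩ₁Ω : closure Ω₁ ⊆ Ω) (κ : ℝ) {δ : ℝ} (hδ : 0 < δ) :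
    ∃ h₀ > 0, ∃ C ≥ 0, ∀ (h : ℝ) (J₁ J₂ : Set (Simplex d)),
      IsInitialMesh Ω Ω₁ Γ h κ J₁ J₂ → h ≤ h₀ →
      IsFineMesh k Ω Ω₁ Γ h κ (C * (2 * h)) J₁ J₂ ∧ h + C * (2 * h) < δ := by
  obtain ⟨h₁, hh₁, C, hC, hest⟩ := exists_simplex_estimates hk hΓ κ
  obtain ⟨η, hη, hηΩ⟩ := hΩ₁.exists_thickening_subset_open hΩ hΩ₁Ω
  refine ⟨min (min (h₁ / 4) (η / 4)) (min (1 / (4 * (C + 1))) (δ / (4 * (C + 1)))), ?_, C, hC, ?_⟩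
  · exact lt_min (lt_min (by positivity) (by positivity)) (lt_min (by positivity) (by positivity))
  intro h J₁ J₂ hM hh
  obtain ⟨⟨ha, hb⟩, hc, he⟩ : (h ≤ h₁ / 4 ∧ h ≤ η / 4) ∧ h ≤ 1 / (4 * (C + 1)) ∧
      h ≤ δ / (4 * (C + 1)) := by simpa only [le_min_iff] using hh
  have hC1 : 0 < 4 * (C + 1) := by positivity
  rw [le_div_iff₀ hC1] at hc he
  have hh0 := hM.h_pos
  have hsmall : C * (2 * h) ≤ 1 / 2 := by nlinarith
  have hdiam : ∀ T ∈ J₁ ∪ J₂, C * Metric.diam (body T) ≤ C * (2 * h) := fun T hT =>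
    mul_le_mul_of_nonneg_left (hM.diam_le hT) hC
  have hest' := fun T hT => hest T (hM.shapeRegular T hT)
    ((hM.diam_le hT).trans_lt (by linarith))
  have hpsi : ∀ T ∈ J₁ ∪ J₂, ∀ z ∈ body T, psi k Γ (J₁ ∪ J₂) z = psiOn k Γ T z :=
    fun T hT z hz => psi_eq_psiOn hΓ.isCompact (fun _ h _ h' => hM.meetInFace h h') hT hz
  refine ⟨⟨hM, fun T hT => (hest' T hT).1,
    fun T hT x hx => ((hest' T hT).2.1 x hx).trans (hdiam T hT), fun T hT x hx y hy => ?_,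
    fun T hT x hx => (((hest' T hT).2.2.2 _ (hpsi T hT)) x hx).1.trans (hdiam T hT),
    fun T hT x hx => ((((hest' T hT).2.2.2 _ (hpsi T hT)) x hx).2.trans (hdiam T hT)).trans hsmall,
    fun x hx y hy => ?_⟩, by nlinarith⟩
  · refine ((hest' T hT).2.2.1 x hx y hy).trans ?_
    exact mul_le_mul_of_nonneg_right ((hdiam T hT).trans hsmall) (norm_nonneg _)
  · by_contra! hlt
    refine hy (hηΩ (Metric.mem_thickening_iff.2 ⟨x, hx, ?_⟩))
    rw [dist_comm]
    linarith

lemma hausdorffEDist_image_le {d : ℕ} {f g : E d → E d} {X : Set (E d)} {r : ℝ}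
    (hr : ∀ x ∈ X, dist (f x) (g x) ≤ r) :
    Metric.hausdorffEDist (f '' X) (g '' X) ≤ ENNReal.ofReal r := by
  refine Metric.hausdorffEDist_le_of_mem_edist ?_ ?_
  · rintro _ ⟨x, hx, rfl⟩
    refine ⟨g x, mem_image_of_mem g hx, ?_⟩
    rw [edist_dist]
    exact ENNReal.ofReal_le_ofReal (hr x hx)
  · rintro _ ⟨x, hx, rfl⟩
    refine ⟨f x, mem_image_of_mem f hx, ?_⟩
    rw [edist_comm, edist_dist]
    exact ENNReal.ofReal_le_ofReal (hr x hx)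

section curved

variable {m k : ℕ} {Ω Ω₁ Γ : Set (E (m + 1))} {h κ e : ℝ} {J₁ J₂ : Set (Simplex (m + 1))}

lemma IsFineMesh.curve_eq (hF : IsFineMesh k Ω Ω₁ Γ h κ e J₁ J₂) (hk : 1 ≤ k)
    {H : E (m + 1) ≃ₜ E (m + 1)} (hH : ∀ x, H x = globalCurve k Γ (J₁ ∪ J₂) x)
    {T : Simplex (m + 1)} (hT : T ∈ J₁ ∪ J₂) : EqOn (curve k Γ (J₁ ∪ J₂) T) H (body T) :=
  fun x hx => ((hH x).trans (hF.globalCurve_eq hk hT hx)).symm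

lemma IsFineMesh.curvedRegion_eq (hF : IsFineMesh k Ω Ω₁ Γ h κ e J₁ J₂) (hk : 1 ≤ k)
    {H : E (m + 1) ≃ₜ E (m + 1)} (hH : ∀ x, H x = globalCurve k Γ (J₁ ∪ J₂) x)
    {J : Set (Simplex (m + 1))} (hJ : J ⊆ J₁ ∪ J₂) :
    curvedRegion k Γ (J₁ ∪ J₂) J = H '' region J := by
  rw [region, image_iUnion₂]
  exact iUnion₂_congr fun T hT => (hF.curve_eq hk hH (hJ hT)).image_eq

lemma IsFineMesh.curvedInterface_eq (hF : IsFineMesh k Ω Ω₁ Γ h κ e J₁ J₂) (hk : 1 ≤ k)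
    {H : E (m + 1) ≃ₜ E (m + 1)} (hH : ∀ x, H x = globalCurve k Γ (J₁ ∪ J₂) x) :
    curvedInterface k Γ J₁ J₂ = H '' straightInterface J₁ J₂ := by
  rw [straightInterface, image_iUnion₂]
  exact iUnion₂_congr fun p hp =>
    ((hF.curve_eq hk hH (Or.inl hp.1)).mono (face_subset_body _ _)).image_eq

lemma IsFineMesh.isBulkElement (hF : IsFineMesh k Ω Ω₁ Γ h κ e J₁ J₂) (hk : 1 ≤ k)
    {H : E (m + 1) ≃ₜ E (m + 1)} (hH : ∀ x, H x = globalCurve k Γ (J₁ ∪ J₂) x)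
    {T : Simplex (m + 1)} (hT : T ∈ J₁ ∪ J₂) : IsBulkElement k (curvedMap k Γ (J₁ ∪ J₂) T) :=
  isBulkElement_comp_refMap (by omega) hk (contDiff_interp T _) (hF.curve_fderiv_le T hT) H
    fun _ hx => (hF.curve_eq hk hH hT hx).symm

lemma IsFineMesh.isTriangulatedBulkDomain (hF : IsFineMesh k Ω Ω₁ Γ h κ e J₁ J₂) (hk : 1 ≤ k)
    {H : E (m + 1) ≃ₜ E (m + 1)} (hH : ∀ x, H x = globalCurve k Γ (J₁ ∪ J₂) x)
    {J : Set (Simplex (m + 1))} (hJ : J ⊆ J₁ ∪ J₂) (hne : (region J).Nonempty) :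
    IsTriangulatedBulkDomain k J (curvedMap k Γ (J₁ ∪ J₂)) (curvedRegion k Γ (J₁ ∪ J₂) J) := by
  have hfin := hF.mesh.finite.subset hJ
  have hreg := hF.curvedRegion_eq hk hH hJ
  refine ⟨hreg ▸ hne.image H, ?_, fun T hT => hF.isBulkElement hk hH (hJ hT), ?_⟩
  · rw [hreg, ← H.image_interior, ← H.image_closure, closure_interior_region hfin]
  · refine isConformingSubdivision_of_straight hk hfin (v := fun T => T) (fun T _ => T.ind)
      H.injective (fun T hT x hx => hF.curve_eq hk hH (hJ hT) (vertexMap_mem_body T hx)) ?_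
      fun T hT T' hT' hTT' => hF.mesh.admissible T (hJ hT) T' (hJ hT') hTT'
    rw [hreg, region, image_iUnion₂]
    rfl

lemma IsFineMesh.isTriangulatedHypersurface (hF : IsFineMesh k Ω Ω₁ Γ h κ e J₁ J₂) (hk : 1 ≤ k)
    {H : E (m + 1) ≃ₜ E (m + 1)} (hH : ∀ x, H x = globalCurve k Γ (J₁ ∪ J₂) x)
    (hne : (straightInterface J₁ J₂).Nonempty)
    (hS : IsLipschitzHypersurface (H '' straightInterface J₁ J₂)) :
    IsTriangulatedHypersurface k (interfaceFacets J₁ J₂) (curvedFacetMap k Γ (J₁ ∪ J₂))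
      (curvedInterface k Γ J₁ J₂) := by
  have hreg := hF.curvedInterface_eq hk hH
  refine ⟨hreg ▸ hne.image H, hreg ▸ hS, fun p hp => ?_, ?_⟩
  · exact isSurfaceElement_comp_facetMap hk (contDiff_interp p.1 _)
      (hF.curve_fderiv_le p.1 (Or.inl hp.1))
      (H.injective.injOn.congr (hF.curve_eq hk hH (Or.inl hp.1)).symm)
  · refine isConformingSubdivision_of_straight hk hF.mesh.finite_interfaceFacets
      (v := fun p i => p.1 (p.2.succAbove i)) (fun p _ => affineIndependent_facet p)
      H.injective (fun p hp x hx => hF.curve_eq hk hH (Or.inl hp.1) ?_) ?_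
      fun p hp q hq hpq => hF.mesh.facets_admissible hp hq hpq
    · exact face_subset_body _ _ (image_facetMap p ▸ mem_image_of_mem (facetMap p) hx)
    · rw [hreg, straightInterface, image_iUnion₂]
      simp only [convexHull_range_facet]

/-- The Lagrange nodes of a facet are Lagrange nodes of the simplex. -/
lemma facetMap_mem_image_refNodes {p : Simplex (m + 1) × Fin (m + 2)} {x : E m}
    (hx : x ∈ refNodes k m) : ∃ y ∈ refNodes k (m + 1), vertexMap p.1 y = facetMap p x := by
  -- the opposite vertex gets the coordinate `0`
  obtain ⟨w, hw⟩ : ∃ w : Fin (m + 2) → ℝ, w = p.2.insertNth 0 fun i => refBary m i x := ⟨_, rfl⟩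
  have hw0 : w p.2 = 0 := by rw [hw, Fin.insertNth_apply_same]
  have hws : ∀ i, w (p.2.succAbove i) = refBary m i x := fun i => by
    rw [hw, Fin.insertNth_apply_succAbove]
  have hsum : ∑ j, w j = 1 := by
    rw [Fin.sum_univ_succAbove _ p.2, hw0, zero_add]
    simp only [hws, sum_refBary]
  refine ⟨refPoint w, ⟨fun j => ?_, fun j => ?_⟩, ?_⟩
  · rw [refBary_refPoint hsum]
    rcases Fin.eq_self_or_eq_succAbove p.2 j with rfl | ⟨i, rfl⟩
    · rw [hw0]
    · rw [hws]
      exact hx.1 i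
  · rw [refBary_refPoint hsum]
    rcases Fin.eq_self_or_eq_succAbove p.2 j with rfl | ⟨i, rfl⟩
    · exact ⟨0, by rw [hw0]; simp⟩
    · rw [hws]
      exact hx.2 i
  · simp only [vertexMap, refBary_refPoint hsum]
    rw [Fin.sum_univ_succAbove _ p.2, hw0, zero_smul, zero_add]
    simp only [hws]
    rfl

lemma IsFineMesh.curvedFacetMap_node_mem (hF : IsFineMesh k Ω Ω₁ Γ h κ e J₁ J₂) (hk : 1 ≤ k)
    (hm : 1 ≤ m) (hc : IsCompact Γ) {p : Simplex (m + 1) × Fin (m + 2)}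
    (hp : p ∈ interfaceFacets J₁ J₂) :
    curvedFacetMap k Γ (J₁ ∪ J₂) p '' refNodes k m ⊆ Γ := by
  rintro _ ⟨x, hx, rfl⟩
  obtain ⟨y, hy, hyx⟩ := facetMap_mem_image_refNodes (p := p) hx
  have h1 : curvedFacetMap k Γ (J₁ ∪ J₂) p x = psi k Γ (J₁ ∪ J₂) (facetMap p x) := by
    change interp k p.1 _ (facetMap p x) = _
    rw [← hyx, interp_vertexMap_node hk _ _ hy]
  rw [h1]
  refine hF.psi_mem_of_mem_straightInterface (by omega) hc (mem_iUnion₂.2 ⟨p, hp, ?_⟩)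
  exact image_facetMap p ▸ mem_image_of_mem (facetMap p) hx.1

lemma IsFineMesh.dist_globalCurve_psi_le (hF : IsFineMesh k Ω Ω₁ Γ h κ e J₁ J₂) (hk : 1 ≤ k)
    (hc : IsCompact Γ) {x : E (m + 1)} (hx : x ∈ region (J₁ ∪ J₂)) :
    dist (globalCurve k Γ (J₁ ∪ J₂) x) (psi k Γ (J₁ ∪ J₂) x) ≤ 2 * e := by
  obtain ⟨T, hT, hxT⟩ := mem_iUnion₂.1 hx
  rw [hF.globalCurve_eq hk hT hxT, hF.psi_eq hc hT hxT]
  refine (dist_triangle_right _ _ x).trans ?_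
  rw [dist_eq_norm, dist_eq_norm]
  linarith [hF.curve_sub_le T hT x hxT, hF.psiOn_sub_le T hT x hxT]

end curved

end IsoMesh

end

theorem mainTheorem5 (m : ℕ) (hm : m = 1 ∨ m = 2) (k : ℕ) (hk : 1 ≤ k)
    (Ω Ω₁ Γ : Set (IsoMesh.E (m + 1)))
    (hΩ : IsOpen Ω) (hΩc : IsConnected Ω)
    (hΩ₁ : IsOpen Ω₁) (hΩ₁c : IsConnected Ω₁) (hΩ₁Ω : Ω₁ ⊆ Ω)
    (hΓ : IsoMesh.IsClosedHypersurface (k + 2) Γ) (hΓΩ : Γ ⊆ Ω) (hΓΩ₁ : frontier Ω₁ = Γ)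
    (κ : ℝ) :
    ∃ h₀ > (0 : ℝ), ∃ C : ℝ, ∀ (h : ℝ) (J₁ J₂ : Set (IsoMesh.Simplex (m + 1))),
      IsoMesh.IsInitialMesh Ω Ω₁ Γ h κ J₁ J₂ → h ≤ h₀ →
      -- the map `Ψ` on the simplices and on the interface facets
      (∀ T ∈ J₁ ∪ J₂,
        Set.EqOn (IsoMesh.psi k Γ (J₁ ∪ J₂)) (IsoMesh.psiOn k Γ T) (IsoMesh.body T) ∧
        ContDiffOn ℝ ((k + 1 : ℕ) : WithTop ℕ∞) (IsoMesh.psi k Γ (J₁ ∪ J₂)) (IsoMesh.body T) ∧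
        Set.InjOn (IsoMesh.psi k Γ (J₁ ∪ J₂)) (IsoMesh.body T)) ∧
      IsoMesh.psi k Γ (J₁ ∪ J₂) ''
        (⋃ p ∈ IsoMesh.interfaceFacets J₁ J₂, IsoMesh.facet p.1 p.2) = Γ ∧
      -- the curved elements and the three subdivisions
      (∀ T ∈ J₁ ∪ J₂, IsoMesh.IsBulkElement k (IsoMesh.curvedMap k Γ (J₁ ∪ J₂) T)) ∧
      IsoMesh.IsTriangulatedBulkDomain k J₁ (IsoMesh.curvedMap k Γ (J₁ ∪ J₂))
        (IsoMesh.curvedRegion k Γ (J₁ ∪ J₂) J₁) ∧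
      IsoMesh.IsTriangulatedBulkDomain k J₂ (IsoMesh.curvedMap k Γ (J₁ ∪ J₂))
        (IsoMesh.curvedRegion k Γ (J₁ ∪ J₂) J₂) ∧
      IsoMesh.IsTriangulatedBulkDomain k (J₁ ∪ J₂) (IsoMesh.curvedMap k Γ (J₁ ∪ J₂))
        (IsoMesh.curvedRegion k Γ (J₁ ∪ J₂) (J₁ ∪ J₂)) ∧
      IsoMesh.curvedRegion k Γ (J₁ ∪ J₂) (J₁ ∪ J₂) = closure Ω ∧
      -- the two curved meshes share their interface facets
      (∀ T₁ ∈ J₁, ∀ T₂ ∈ J₂, ∀ j,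
        IsoMesh.body T₁ ∩ IsoMesh.body T₂ = IsoMesh.facet T₁ j →
        Set.EqOn (IsoMesh.curve k Γ (J₁ ∪ J₂) T₁) (IsoMesh.curve k Γ (J₁ ∪ J₂) T₂)
          (IsoMesh.facet T₁ j) ∧
        IsoMesh.curve k Γ (J₁ ∪ J₂) T₁ '' IsoMesh.body T₁ ∩
            IsoMesh.curve k Γ (J₁ ∪ J₂) T₂ '' IsoMesh.body T₂ =
          IsoMesh.curve k Γ (J₁ ∪ J₂) T₁ '' IsoMesh.facet T₁ j) ∧
      IsoMesh.curvedInterface k Γ J₁ J₂ =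
        IsoMesh.curvedRegion k Γ (J₁ ∪ J₂) J₁ ∩ IsoMesh.curvedRegion k Γ (J₁ ∪ J₂) J₂ ∧
      IsoMesh.IsTriangulatedHypersurface k (IsoMesh.interfaceFacets J₁ J₂)
        (IsoMesh.curvedFacetMap k Γ (J₁ ∪ J₂)) (IsoMesh.curvedInterface k Γ J₁ J₂) ∧
      -- approximation: the nodes of the curved interface lie on `Γ`, and the Hausdorff distances
      -- are at most `C h`
      (∀ p ∈ IsoMesh.interfaceFacets J₁ J₂,
        IsoMesh.curvedFacetMap k Γ (J₁ ∪ J₂) p '' IsoMesh.refNodes k m ⊆ Γ) ∧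
      Metric.hausdorffEDist (IsoMesh.curvedInterface k Γ J₁ J₂) Γ ≤ ENNReal.ofReal (C * h) ∧
      Metric.hausdorffEDist (IsoMesh.curvedRegion k Γ (J₁ ∪ J₂) J₁) (closure Ω₁) ≤
        ENNReal.ofReal (C * h) ∧
      Metric.hausdorffEDist (IsoMesh.curvedRegion k Γ (J₁ ∪ J₂) J₂) (closure (Ω \ Ω₁)) ≤
        ENNReal.ofReal (C * h) := by

  have hcl : closure Ω₁ = Ω₁ ∪ Γ := by rw [closure_eq_self_union_frontier, hΓΩ₁]
  have hclΩ : closure Ω₁ ⊆ Ω := hcl ▸ Set.union_subset hΩ₁Ω hΓΩ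
  by_cases hbdd : Bornology.IsBounded Ω
  swap
  · -- an unbounded domain is not the union of finitely many simplices
    refine ⟨1, one_pos, 0, fun h J₁ J₂ hM _ => absurd ?_ hbdd⟩
    refine (IsoMesh.isCompact_region hM.finite).isBounded.subset ?_
    rw [hM.region_union]
    exact subset_closure
  have hcomp : IsCompact (closure Ω₁) := (hbdd.subset hΩ₁Ω).isCompact_closure
  have hne : closure Ω₁ ≠ Set.univ := fun hu =>
    noncompact_univ (IsoMesh.E (m + 1)) (hu ▸ hcomp)
  have hLip := hΓ.isLipschitzHypersurface (by omega)
  obtain ⟨δ, hδ, hdepth⟩ := IsoMesh.exists_exterior_depth hLip hΓ.isCompact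
    hΓ.isConnected.nonempty hΩ₁ hΓΩ₁
  have hΓW := IsoMesh.subset_closure_exterior hLip hΓ.isConnected hΩ₁ hΓΩ₁ hne
  obtain ⟨h₀, hh₀, C, hC, hfine⟩ := IsoMesh.exists_isFineMesh hk hΩ hΓ hcomp hclΩ κ hδ
  refine ⟨h₀, hh₀, 4 * C, fun h J₁ J₂ hM hh => ?_⟩
  obtain ⟨hF, hhδ⟩ := hfine h J₁ J₂ hM hh
  have hΓcl : Γ ⊆ closure Ω₁ := hcl ▸ Set.subset_union_right
  -- `H` extends `Ψ`, and `G` its interpolant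
  obtain ⟨H, hH, hHL, hHΩ⟩ := hF.exists_homeomorph_psi hΩ hΓ.isCompact hΓcl
  obtain ⟨G, hG, hGL, hGΩ⟩ := hF.exists_homeomorph_curve hk hΩ hΓ.isCompact hΓcl
  obtain ⟨hHI, hH₁, hH₂⟩ := hF.image_psi (by omega) hΩ hΩ₁ hΩ₁c hΓ.isCompact hΓΩ₁ hΓW hhδ hdepth
    hH hHΩ
  have hHfun : (H : IsoMesh.E (m + 1) → IsoMesh.E (m + 1)) = IsoMesh.psi k Γ (J₁ ∪ J₂) :=
    funext hH
  have hIne : (IsoMesh.straightInterface J₁ J₂).Nonempty := by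
    rw [← Set.image_nonempty (f := H), hHI]
    exact hΓ.isConnected.nonempty
  obtain ⟨x₀, hx₀⟩ := hIne
  obtain ⟨hx₁, hx₂⟩ := IsoMesh.straightInterface_subset hx₀
  have hreg := IsoMesh.region_union J₁ J₂
  -- the interface of the curved mesh is a bi-Lipschitz image of `Γ`
  have hS : IsoMesh.IsLipschitzHypersurface (G '' IsoMesh.straightInterface J₁ J₂) := by
    have := hLip.image (hHL.symm.trans hGL)
    rw [← hHI] at this
    convert this using 1
    rw [Set.image_image]
    exact Set.image_congr fun x _ => by simp
  have hdist : ∀ X ⊆ IsoMesh.region (J₁ ∪ J₂), Metric.hausdorffEDist (G '' X) (H '' X) ≤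
      ENNReal.ofReal (4 * C * h) := by
    refine fun X hX => IsoMesh.hausdorffEDist_image_le fun x hx => ?_
    rw [hG, hH]
    refine (hF.dist_globalCurve_psi_le hk hΓ.isCompact (hX hx)).trans (le_of_eq ?_)
    ring
  refine ⟨fun T hT => ⟨fun x hx => hF.psi_eq hΓ.isCompact hT hx, ?_, ?_⟩, ?_,
    fun T hT => hF.isBulkElement hk hG hT, ?_, ?_, ?_, ?_, ?_, ?_, ?_, ?_, ?_, ?_, ?_⟩
  · exact (hF.contDiffOn T hT).congr fun x hx => hF.psi_eq hΓ.isCompact hT hx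
  · rw [← hHfun]
    exact H.injective.injOn
  · rw [← hHfun]
    exact hHI
  · exact hF.isTriangulatedBulkDomain hk hG Set.subset_union_left ⟨x₀, hx₁⟩
  · exact hF.isTriangulatedBulkDomain hk hG Set.subset_union_right ⟨x₀, hx₂⟩
  · exact hF.isTriangulatedBulkDomain hk hG Set.Subset.rfl ⟨x₀, hreg ▸ Or.inl hx₁⟩
  · rw [hF.curvedRegion_eq hk hG Set.Subset.rfl, hM.region_union, G.image_closure, hGΩ]
  · intro T₁ hT₁ T₂ hT₂ j hj
    have h₁ := hF.curve_eq hk hG (Or.inl hT₁)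
    have h₂ := hF.curve_eq hk hG (Or.inr hT₂)
    have hj₁ : IsoMesh.facet T₁ j ⊆ IsoMesh.body T₁ := hj ▸ Set.inter_subset_left
    have hj₂ : IsoMesh.facet T₁ j ⊆ IsoMesh.body T₂ := hj ▸ Set.inter_subset_right
    refine ⟨(h₁.mono hj₁).trans (h₂.mono hj₂).symm, ?_⟩
    rw [h₁.image_eq, h₂.image_eq, (h₁.mono hj₁).image_eq, ← Set.image_inter G.injective, hj]
  · rw [hF.curvedInterface_eq hk hG, hF.curvedRegion_eq hk hG Set.subset_union_left,
      hF.curvedRegion_eq hk hG Set.subset_union_right, ← Set.image_inter G.injective,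
      hF.region_inter hΩ]
  · exact hF.isTriangulatedHypersurface hk hG ⟨x₀, hx₀⟩ hS
  · exact fun p hp => hF.curvedFacetMap_node_mem hk (by omega) hΓ.isCompact hp
  · rw [hF.curvedInterface_eq hk hG]
    refine le_of_eq_of_le (by rw [hHI]) (hdist (IsoMesh.straightInterface J₁ J₂) ?_)
    exact fun x hx => hreg ▸ Or.inl (IsoMesh.straightInterface_subset hx).1
  · rw [hF.curvedRegion_eq hk hG Set.subset_union_left, ← hH₁]
    exact hdist _ (hreg ▸ Set.subset_union_left)
  · rw [hF.curvedRegion_eq hk hG Set.subset_union_right, ← hH₂]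
    exact hdist _ (hreg ▸ Set.subset_union_right)
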